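/- Let $0<s<1$ and $\kappa_0\in(0,\tfrac1{10}]$. Let $u,\theta$ be smooth real functions on $[0,1]$ with $u'\ge c_0>0$ and $\theta\ge c_0>0$ on $[0,1]$, such that $u''$ and $\theta'$ vanish on $[0,1]\setminus[4\kappa_0,1-4\kappa_0]$ and are Gevrey of exponent $s$ on $[0,1]$. Here a smooth function $g$ is called Gevrey of exponent $s$ on a set $S\subset\mathbb R$ if there are $L,M>0$ with $|g^{(m)}(y)|\le L\,M^m (m!)^{1/s}(m+1)^{-2}$ for all $m\ge0$ and $y\in S$. Let $\Upsilon\in C^\infty(\mathbb R;\mathbb R)$ be Gevrey of exponent $s$ on $\mathbb R$ with compact support in $(u(0),u(1))$. For a function $\varphi$ on $[0,1]$ define $\widetilde\varphi$ on $[u(0),u(1)]$ by $\widetilde\varphi(u(y))=\varphi(y)$. Let $\mathbb T=\mathbb R/2\pi\mathbb Z$, $\langle x\rangle=(1+x^2)^{1/2}$, and for $k\in\mathbb Z$, $\eta\in\mathbb R$ let $\widehat f(k,\eta)=\frac1{2\pi}\int_{\mathbb T\times\mathbb R}f(z,v)e^{-izk-iv\eta}\,dz\,dv$. Then there are constants $C,\lambda_\Delta>0$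 and a kernel $\mathcal G(t,k,\xi,\eta)\in\mathbb C$, defined for $t,\xi,\eta\in\mathbb R$ and $k\in\mathbb Z$, all depending only on $u,\theta,\Upsilon,s$, such that for all $t,k,\xi,\eta$ $$|\mathcal G(t,k,\xi,\eta)|\le C\min\left\{\frac{e^{-\lambda_\Delta\langle\xi-\eta\rangle^s}}{1+k^2+(\xi-kt)^2},\ \frac{e^{-\lambda_\Delta\langle\xi-\eta\rangle^s}}{1+k^2+(\eta-kt)^2}\right\},$$ and such that the following holds for every $t\in\mathbb R$. Let $\Omega:\mathbb T\times\mathbb R\to\mathbb C$ be compactly supported in $\mathbb T\times(u(0),u(1))$, and let $\Psi:\mathbb T\times[u(0),u(1)]\to\mathbb C$ be continuous, of class $C^2$ on $\mathbb T\times(u(0),u(1))$, and solve $$\widetilde\theta^{-1}\partial_{zz}\Psi+\widetilde{u'}(\partial_v-t\partial_z)\Big(\widetilde\theta^{-1}\widetilde{u'}(\partial_v-t\partial_z)\Psi\Big)=\Omega\quad\text{on }\mathbb T\times(u(0),u(1)),\qquad \Psi(z,u(0))=\Psi(z,u(1))=0 .$$ Then for all $k\in\mathbb Z$ and $\xi\in\mathbb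 R$ the function $\eta\mapsto\mathcal G(t,k,\xi,\eta)\,\widehat\Omega(k,\eta)$ is integrable and $$\widehat{(\Upsilon\Psi)}(k,\xi)=\int_{\mathbb R}\mathcal G(t,k,\xi,\eta)\,\widehat\Omega(k,\eta)\,d\eta .$$ -/

import Mathlib

open Set MeasureTheory

namespace DistortedElliptic

noncomputable section

/-- The Gevrey weight `Γ_s(m) = (m!)^{1/s} (m+1)^{-2}`. -/
def gevreyWeight (s : ℝ) (m : ℕ) : ℝ :=
  (m.factorial : ℝ) ^ (1 / s) / ((m : ℝ) + 1) ^ 2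

/-- `g` has Gevrey regularity of exponent `s` (class Gevrey-`1/s`) on `S`: for some `M > 0`
the norm `sup_{y ∈ S, m ≥ 0} |g^{(m)}(y)| / (Γ_s(m) M^m)` is finite. -/
def IsGevreyOn (s : ℝ) (S : Set ℝ) (g : ℝ → ℝ) : Prop :=
  ∃ L M : ℝ, 0 < M ∧ ∀ m : ℕ, ∀ y ∈ S, |iteratedDeriv m g y| ≤ L * M ^ m * gevreyWeight s m

/-- For a function `φ` of `y ∈ [0,1]` and a shear profile `u`, injective on `[0,1]`, the function
`tilde u φ` of `v ∈ [u(0), u(1)]` with `tilde u φ (u y) = φ y`, that is `φ ∘ u⁻¹`. -/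
def tilde (u φ : ℝ → ℝ) (v : ℝ) : ℝ :=
  φ (Function.invFunOn u (Icc 0 1) v)

/-- The derivative `∂_z f` of a function `f(z, v)`. -/
def dz (f : ℝ → ℝ → ℂ) (z v : ℝ) : ℂ :=
  deriv (fun z' => f z' v) z

/-- The derivative `(∂_v - t ∂_z) f` of a function `f(z, v)`. -/
def dvt (t : ℝ) (f : ℝ → ℝ → ℂ) (z v : ℝ) : ℂ :=
  deriv (fun v' => f z v') v - (t : ℂ) * deriv (fun z' => f z' v) z

/-- The distorted elliptic operator at time `t`,
`θ̃⁻¹ ∂_zz Ψ + ũ' (∂_v - t ∂_z) (θ̃⁻¹ ũ' (∂_v - t ∂_z) Ψ)`. -/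
def distortedOp (u θ : ℝ → ℝ) (t : ℝ) (Ψ : ℝ → ℝ → ℂ) (z v : ℝ) : ℂ :=
  (((tilde u θ v)⁻¹ : ℝ) : ℂ) * dz (dz Ψ) z v
    + ((tilde u (deriv u) v : ℝ) : ℂ) *
      dvt t (fun z' v' =>
        (((tilde u θ v')⁻¹ * tilde u (deriv u) v' : ℝ) : ℂ) * dvt t Ψ z' v') z v

/-- `Ψ`, a function on `𝕋 × [u(0), u(1)]` with `𝕋 = ℝ / 2πℤ`, is a classical solution at time `t`
of the distorted elliptic equation with right-hand side `Ω` and Dirichlet boundary conditions.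
Functions on `𝕋` are `2π`-periodic functions on `ℝ`; values of `Ψ` for `v` outside
`[u(0), u(1)]` play no role. -/
structure IsDirichletSolution (u θ : ℝ → ℝ) (t : ℝ) (Ω Ψ : ℝ → ℝ → ℂ) : Prop where
  periodic : ∀ z, ∀ v ∈ Icc (u 0) (u 1), Ψ (z + 2 * Real.pi) v = Ψ z v
  continuousOn : ContinuousOn (Function.uncurry Ψ) (univ ×ˢ Icc (u 0) (u 1))
  contDiffOn : ContDiffOn ℝ 2 (Function.uncurry Ψ) (univ ×ˢ Ioo (u 0) (u 1))
  equation : ∀ z, ∀ v ∈ Ioo (u 0) (u 1), distortedOp u θ t Ψ z v = Ω z v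
  boundary_left : ∀ z, Ψ z (u 0) = 0
  boundary_right : ∀ z, Ψ z (u 1) = 0

/-- `Ω(z, v)` is compactly supported in `𝕋 × (α, β)`. -/
def CompactlySupportedIn (α β : ℝ) (Ω : ℝ → ℝ → ℂ) : Prop :=
  ∃ a b : ℝ, α < a ∧ b < β ∧ ∀ z v, v ∉ Icc a b → Ω z v = 0

/-- The Fourier transform in the first variable,
`(1 / 2π) ∫_𝕋 f(z, v) e^{-izk} dz`. -/
def fourierZ (f : ℝ → ℝ → ℂ) (k : ℤ) (v : ℝ) : ℂ :=
  (1 / (2 * (Real.pi : ℂ))) *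
    ∫ z in (0 : ℝ)..(2 * Real.pi), f z v * Complex.exp (-(Complex.I * z * k))

/-- The Fourier transform in both variables,
`(1 / 2π) ∫_{𝕋 × ℝ} f(z, v) e^{-izk - ivη} dz dv`. -/
def fourierZV (f : ℝ → ℝ → ℂ) (k : ℤ) (η : ℝ) : ℂ :=
  ∫ v : ℝ, fourierZ f k v * Complex.exp (-(Complex.I * v * η))

/-- The bracket `⟨x⟩ = (1 + |x|²)^{1/2}`. -/
def bracket (x : ℝ) : ℝ := Real.sqrt (1 + x ^ 2)

end

end DistortedElliptic

namespace DistortedElliptic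

open scoped Topology

/-! ### The Gevrey weights -/

/-! Write `b`, `ϑ` for u', θ as functions of v, and put p = b/ϑ, q = 1/(bϑ). Let Ω_k be the k-th
mode of Ω in z, and let Φ be the k-th mode of Ψ multiplied by e^{-iktv}. Then Φ solves the Dirichlet
problem (pΦ')' - k²qΦ = e^{-iktv} Ω_k / b, in which t no longer enters the operator. The transform
of ΥΨ at (k, ξ) is the pairing of Φ with Υ e^{-iωv}, where ω = ξ - kt. By symmetry of the operator
(`green_identity`, `IsDirichletSolution.fourierZV_mul_eq`) it equals the pairing of the source of Φ
with the solution h of (ph')' - k²qh = Υ e^{-iωv}. Writing h = e^{-iωv} F turns this into ∫ Ω_k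
(F/b) e^{-ivξ} dv. By Fourier inversion that is a convolution whose kernel is `kernelFT (χ F / b) (ξ
- η)`, with χ a Gevrey cutoff equal to 1 on [u(0), u(1)].

It remains to show that F extends smoothly past the end points and satisfies Gevrey bounds uniform
in (k, ω), with constant of order (1 + |k| + |ω|)⁻² (`exists_dirichlet_family`). Gevrey bounds give
the stretched exponential decay of the kernel (`le_exp_of_moments`). Two further derivatives give a
factor (1 + (ξ-η)²)⁻¹, which allows the elliptic weight to be moved from ξ - kt to η - kt
(`exists_kernel_bound`).

The estimate of F rests on a factorization. If R is p times the logarithmic derivative of the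
homogeneous solution vanishing at the left end point, then R' = k²q - R²/p, and the second order
equation splits into ζ' = -(R/p - iω)ζ + Υ and F' = (R/p + iω)F + ζ/p. The first is damped to the
right and the second to the left, with rate at least c(1 + k). Differentiating a damped equation m
times leaves the damping unchanged, and the commutators are absorbed by enlarging the geometric rate
of the Gevrey bound, so each factor gains (1 + k + |ω|)⁻¹ (`gevreyAt_of_damped`,
`UniformGevrey.of_damped`). The bounds for R, uniform in k, come from the damping of the linearized
Riccati equation (`UniformGevrey.of_riccati`). Near the end points the coefficients are constant and
Υ vanishes, so the solution is an explicit hyperbolic sine. This fixes the boundary data and the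
extension; the exponential growth of the profile is beaten by its size at a more distant interior
point. -/

lemma gevreyWeight_pos (s : ℝ) (m : ℕ) : 0 < gevreyWeight s m := by
  unfold gevreyWeight
  have : (0 : ℝ) < m.factorial := by exact_mod_cast m.factorial_pos
  positivity

lemma gevreyWeight_zero (s : ℝ) : gevreyWeight s 0 = 1 := by
  simp [gevreyWeight]

lemma one_le_one_div_of_lt {s : ℝ} (hs : 0 < s ∧ s < 1) : 1 ≤ 1 / s := by
  rw [le_div_iff₀ hs.1]; linarith [hs.2]

lemma gevreyWeight_succ (s : ℝ) (m : ℕ) :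
    gevreyWeight s (m + 1) =
      ((m : ℝ) + 1) ^ (1 / s) * (((m : ℝ) + 1) / (m + 2)) ^ 2 * gevreyWeight s m := by
  unfold gevreyWeight
  rw [Nat.factorial_succ, Nat.cast_mul, Real.mul_rpow (by positivity) (by positivity)]
  push_cast
  have h1 : (m : ℝ) + 1 ≠ 0 := by positivity
  have h2 : (m : ℝ) + 2 ≠ 0 := by positivity
  have h3 : (m : ℝ) + 1 + 1 ≠ 0 := by positivity
  field_simp
  ring

/-- Since m + 1 ≤ 2^m, an index shift costs only a geometric factor. Differentiation therefore
preserves Gevrey bounds at the price of a larger rate. -/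
lemma gevreyWeight_succ_le {s : ℝ} (hs : 0 < s ∧ s < 1) (m : ℕ) :
    gevreyWeight s (m + 1) ≤ ((2 : ℝ) ^ (1 / s)) ^ m * gevreyWeight s m := by
  rw [gevreyWeight_succ]
  have hw := gevreyWeight_pos s m
  have h1 : ((m : ℝ) + 1) ^ (1 / s) ≤ ((2 : ℝ) ^ (1 / s)) ^ m := by
    rw [← Real.rpow_natCast, ← Real.rpow_mul (by norm_num), mul_comm, Real.rpow_mul (by norm_num),
      Real.rpow_natCast]
    apply Real.rpow_le_rpow (by positivity) _ (by have := hs.1; positivity)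
    have := Nat.lt_two_pow_self (n := m)
    exact_mod_cast this
  have h2 : (((m : ℝ) + 1) / (m + 2)) ^ 2 ≤ 1 := by
    apply pow_le_one₀ (by positivity)
    rw [div_le_one (by positivity)]; linarith
  calc _ ≤ ((2 : ℝ) ^ (1 / s)) ^ m * 1 * gevreyWeight s m := by gcongr
    _ = _ := by ring

lemma gevreyWeight_le_succ {s : ℝ} (hs : 0 < s ∧ s < 1) (m : ℕ) :
    gevreyWeight s m ≤ 4 * gevreyWeight s (m + 1) := by
  rw [gevreyWeight_succ]
  have hw := gevreyWeight_pos s m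
  have h1 : 1 ≤ ((m : ℝ) + 1) ^ (1 / s) :=
    Real.one_le_rpow (by linarith [Nat.cast_nonneg (α := ℝ) m]) (by have := hs.1; positivity)
  have h2 : (1 / 2 : ℝ) ^ 2 ≤ (((m : ℝ) + 1) / (m + 2)) ^ 2 := by
    apply pow_le_pow_left₀ (by norm_num)
    rw [div_le_div_iff₀ (by norm_num) (by positivity)]
    linarith [Nat.cast_nonneg (α := ℝ) m]
  calc gevreyWeight s m = 4 * (1 * (1 / 2 : ℝ) ^ 2 * gevreyWeight s m) := by ring
    _ ≤ _ := by gcongr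

/-- Analytic bounds imply Gevrey bounds: 1/s ≥ 1 handles the factorial and (m+1)² ≤ 4^m handles the
denominator. -/
lemma factorial_le_gevreyWeight {s : ℝ} (hs : 0 < s ∧ s < 1) (m : ℕ) :
    (m.factorial : ℝ) ≤ 4 ^ m * gevreyWeight s m := by
  unfold gevreyWeight
  rw [← mul_div_assoc, le_div_iff₀ (by positivity)]
  have h1 : (m.factorial : ℝ) ≤ (m.factorial : ℝ) ^ (1 / s) := by
    conv_lhs => rw [← Real.rpow_one (m.factorial : ℝ)]
    apply Real.rpow_le_rpow_of_exponent_le _ (one_le_one_div_of_lt hs)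
    exact_mod_cast m.factorial_pos
  have h2 : ((m : ℝ) + 1) ^ 2 ≤ 4 ^ m := by
    have : m + 1 ≤ 2 ^ m := Nat.lt_two_pow_self
    have : ((m : ℝ) + 1) ≤ 2 ^ m := by exact_mod_cast this
    calc ((m : ℝ) + 1) ^ 2 ≤ (2 ^ m) ^ 2 := by gcongr
      _ = 4 ^ m := by rw [← pow_mul, mul_comm, pow_mul]; norm_num
  calc _ ≤ (m.factorial : ℝ) ^ (1 / s) * 4 ^ m := by gcongr
    _ = _ := by ring

lemma sum_inv_sq_le (m : ℕ) :
    ∑ j ∈ Finset.range (m + 1), 1 / ((j : ℝ) + 1) ^ 2 ≤ 2 - 1 / ((m : ℝ) + 1) := by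
  induction m with
  | zero => norm_num
  | succ m ih =>
    rw [Finset.sum_range_succ]
    have : 1 / (((m + 1 : ℕ) : ℝ) + 1) ^ 2 ≤ 1 / ((m : ℝ) + 1) - 1 / (((m + 1 : ℕ) : ℝ) + 1) := by
      push_cast
      rw [div_sub_div _ _ (by positivity) (by positivity),
        div_le_div_iff₀ (by positivity) (by positivity)]
      nlinarith [Nat.cast_nonneg (α := ℝ) m]
    linarith

/-- The binomial coefficient is at most its own power 1/s, so the factorials recombine into
(m!)^{1/s}. The polynomial factors are handled by (j+n+1)² ≤ 2((j+1)² + (n+1)²). -/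
lemma choose_mul_gevreyWeight_le {s : ℝ} (hs : 0 < s ∧ s < 1) {m j : ℕ} (hj : j ≤ m) :
    (m.choose j : ℝ) * gevreyWeight s j * gevreyWeight s (m - j) ≤
      gevreyWeight s m *
        (2 * (1 / ((j : ℝ) + 1) ^ 2 + 1 / (((m - j : ℕ) : ℝ) + 1) ^ 2)) := by
  obtain ⟨n, rfl⟩ := Nat.exists_eq_add_of_le hj
  rw [Nat.add_sub_cancel_left]
  unfold gevreyWeight
  have h1 : ((j + n).choose j : ℝ) * (j.factorial : ℝ) ^ (1 / s) * (n.factorial : ℝ) ^ (1 / s)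
      ≤ ((j + n).factorial : ℝ) ^ (1 / s) := by
    have hc : ((j + n).choose j : ℝ) ≤ ((j + n).choose j : ℝ) ^ (1 / s) := by
      conv_lhs => rw [← Real.rpow_one ((j + n).choose j : ℝ)]
      apply Real.rpow_le_rpow_of_exponent_le _ (one_le_one_div_of_lt hs)
      exact_mod_cast Nat.choose_pos hj
    calc _ ≤ ((j + n).choose j : ℝ) ^ (1 / s) * (j.factorial : ℝ) ^ (1 / s) *
          (n.factorial : ℝ) ^ (1 / s) := by gcongr
      _ = _ := by
        rw [← Real.mul_rpow (by positivity) (by positivity),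
          ← Real.mul_rpow (by positivity) (by positivity)]
        congr 1
        have := Nat.choose_mul_factorial_mul_factorial hj
        rw [Nat.add_sub_cancel_left] at this
        exact_mod_cast this
  have h2 : 1 / (((j : ℝ) + 1) ^ 2 * ((n : ℝ) + 1) ^ 2) ≤
      1 / (((j + n : ℕ) : ℝ) + 1) ^ 2 *
        (2 * (1 / ((j : ℝ) + 1) ^ 2 + 1 / ((n : ℝ) + 1) ^ 2)) := by
    push_cast
    have e : 1 / ((j : ℝ) + n + 1) ^ 2 * (2 * (1 / ((j : ℝ) + 1) ^ 2 + 1 / ((n : ℝ) + 1) ^ 2)) =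
      2 * (((j : ℝ) + 1) ^ 2 + ((n : ℝ) + 1) ^ 2) /
        (((j : ℝ) + n + 1) ^ 2 * (((j : ℝ) + 1) ^ 2 * ((n : ℝ) + 1) ^ 2)) := by
      field_simp
      ring
    rw [e, div_le_div_iff₀ (by positivity) (by positivity)]
    have : ((j : ℝ) + n + 1) ^ 2 ≤ 2 * (((j : ℝ) + 1) ^ 2 + ((n : ℝ) + 1) ^ 2) := by
      nlinarith [sq_nonneg ((j : ℝ) - n), Nat.cast_nonneg (α := ℝ) j, Nat.cast_nonneg (α := ℝ) n]
    nlinarith [show (0 : ℝ) < (((j : ℝ) + 1) ^ 2 * ((n : ℝ) + 1) ^ 2) by positivity]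
  calc _ = (((j + n).choose j : ℝ) * (j.factorial : ℝ) ^ (1 / s) * (n.factorial : ℝ) ^ (1 / s)) *
        (1 / (((j : ℝ) + 1) ^ 2 * ((n : ℝ) + 1) ^ 2)) := by
          field_simp
    _ ≤ ((j + n).factorial : ℝ) ^ (1 / s) * (1 / (((j + n : ℕ) : ℝ) + 1) ^ 2 *
        (2 * (1 / ((j : ℝ) + 1) ^ 2 + 1 / ((n : ℝ) + 1) ^ 2))) := by gcongr
    _ = _ := by ring

/-- This is what the factor (m+1)⁻² in the weight is for: it makes the Leibniz sum converge with a
constant independent of m, so products stay in the class with the same rate. -/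
lemma sum_choose_mul_gevreyWeight_le {s : ℝ} (hs : 0 < s ∧ s < 1) (m : ℕ) :
    ∑ j ∈ Finset.range (m + 1), (m.choose j : ℝ) * gevreyWeight s j * gevreyWeight s (m - j) ≤
      8 * gevreyWeight s m := by
  have hS := sum_inv_sq_le m
  have hp : 0 < 1 / ((m : ℝ) + 1) := by positivity
  have hrefl : ∑ j ∈ Finset.range (m + 1), 1 / (((m - j : ℕ) : ℝ) + 1) ^ 2 =
      ∑ j ∈ Finset.range (m + 1), 1 / ((j : ℝ) + 1) ^ 2 := by
    have := Finset.sum_range_reflect (fun j : ℕ => 1 / ((j : ℝ) + 1) ^ 2) (m + 1)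
    rw [← this]
    apply Finset.sum_congr rfl
    intro j hj
    simp
  calc _ ≤ ∑ j ∈ Finset.range (m + 1), gevreyWeight s m *
        (2 * (1 / ((j : ℝ) + 1) ^ 2 + 1 / (((m - j : ℕ) : ℝ) + 1) ^ 2)) := by
          apply Finset.sum_le_sum
          intro j hj
          exact choose_mul_gevreyWeight_le hs (Nat.lt_succ_iff.mp (Finset.mem_range.mp hj))
    _ = gevreyWeight s m * (2 * (∑ j ∈ Finset.range (m + 1), 1 / ((j : ℝ) + 1) ^ 2 +
          ∑ j ∈ Finset.range (m + 1), 1 / ((j : ℝ) + 1) ^ 2)) := by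
        rw [← Finset.mul_sum, ← Finset.mul_sum, Finset.sum_add_distrib, hrefl]
    _ ≤ gevreyWeight s m * (2 * (2 + 2)) := by
        have := gevreyWeight_pos s m
        gcongr <;> linarith
    _ = _ := by ring

/-! ### Binomial convolutions -/

/-- The binomial convolution of two sequences, as in Leibniz's rule. -/
noncomputable def binomConv (a b : ℕ → ℂ) (m : ℕ) : ℂ :=
  ∑ i ∈ Finset.range (m + 1), (m.choose i : ℂ) * a i * b (m - i)

/-- The sequence `a` with its zeroth term removed. -/
noncomputable def dropZero (a : ℕ → ℂ) (j : ℕ) : ℂ := if j = 0 then 0 else a j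

lemma norm_binomConv_le {s : ℝ} (hs : 0 < s ∧ s < 1) {a b : ℕ → ℂ} {A B M : ℝ} {m : ℕ}
    (hA : 0 ≤ A) (hM : 0 ≤ M)
    (ha : ∀ j ≤ m, ‖a j‖ ≤ A * M ^ j * gevreyWeight s j)
    (hb : ∀ j ≤ m, ‖b j‖ ≤ B * M ^ j * gevreyWeight s j) :
    ‖binomConv a b m‖ ≤ 8 * A * B * M ^ m * gevreyWeight s m := by
  have hB : 0 ≤ B := by
    have h0 := hb 0 (Nat.zero_le _)
    rw [gevreyWeight_zero, pow_zero, mul_one, mul_one] at h0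
    exact (norm_nonneg _).trans h0
  calc ‖binomConv a b m‖ ≤ ∑ i ∈ Finset.range (m + 1), ‖(m.choose i : ℂ) * a i * b (m - i)‖ :=
        norm_sum_le _ _
    _ ≤ ∑ i ∈ Finset.range (m + 1), (A * B * M ^ m) *
          ((m.choose i : ℝ) * gevreyWeight s i * gevreyWeight s (m - i)) := by
        apply Finset.sum_le_sum
        intro i hi
        have hi' : i ≤ m := Nat.lt_succ_iff.mp (Finset.mem_range.mp hi)
        rw [norm_mul, norm_mul, Complex.norm_natCast]
        have e : M ^ m = M ^ i * M ^ (m - i) := by rw [← pow_add, Nat.add_sub_cancel' hi']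
        have h1 := gevreyWeight_pos s i
        calc _ ≤ (m.choose i : ℝ) * (A * M ^ i * gevreyWeight s i) *
              (B * M ^ (m - i) * gevreyWeight s (m - i)) := by
                gcongr
                · exact ha i hi'
                · exact hb _ (Nat.sub_le _ _)
          _ = _ := by rw [e]; ring
    _ = (A * B * M ^ m) * ∑ i ∈ Finset.range (m + 1),
          ((m.choose i : ℝ) * gevreyWeight s i * gevreyWeight s (m - i)) := by
        rw [Finset.mul_sum]
    _ ≤ (A * B * M ^ m) * (8 * gevreyWeight s m) := by
        gcongr
        exact sum_choose_mul_gevreyWeight_le hs m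
    _ = _ := by ring

lemma binomConv_eq_add_dropZero (a b : ℕ → ℂ) (m : ℕ) :
    binomConv a b m = a 0 * b m + binomConv (dropZero a) b m := by
  unfold binomConv
  rw [Finset.sum_range_succ', Finset.sum_range_succ']
  simp [dropZero]
  ring

/-- If the zeroth term of `a` is dropped, the geometric rate of `a` can be worsened from `N` to `M`
at the benefit of a factor `N / M`. -/
lemma norm_dropZero_le {s : ℝ} {a : ℕ → ℂ} {A N M : ℝ} {m : ℕ}
    (hA : 0 ≤ A) (hN : 0 ≤ N) (hM : 0 < M) (hNM : N ≤ M)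
    (ha : ∀ j ≤ m, 1 ≤ j → ‖a j‖ ≤ A * N ^ j * gevreyWeight s j) :
    ∀ j ≤ m, ‖dropZero a j‖ ≤ (A * (N / M)) * M ^ j * gevreyWeight s j := by
  intro j hj
  have hw := gevreyWeight_pos s j
  rcases Nat.eq_zero_or_pos j with rfl | hj0
  · simp only [dropZero, if_true, norm_zero]; positivity
  · rw [dropZero, if_neg hj0.ne']
    refine (ha j hj hj0).trans ?_
    obtain ⟨i, rfl⟩ := Nat.exists_eq_succ_of_ne_zero hj0.ne'
    have : N ^ (i + 1) ≤ N / M * M ^ (i + 1) := by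
      rw [pow_succ, pow_succ]
      have : N ^ i ≤ M ^ i := by gcongr
      calc N ^ i * N ≤ M ^ i * N := by gcongr
        _ = N / M * (M ^ i * M) := by field_simp
    rw [Nat.succ_eq_add_one, mul_assoc A (N / M)]
    gcongr

/-- The commutator estimate behind every induction on the order of differentiation. At least one
derivative falls on `a`, so only terms of `b` of order below m occur, and the factor N / M is small
once the target rate M is large. -/
lemma norm_binomConv_dropZero_le {s : ℝ} (hs : 0 < s ∧ s < 1) {a b : ℕ → ℂ} {A B N M : ℝ} {m : ℕ}
    (hA : 0 ≤ A) (hB : 0 ≤ B) (hN : 0 ≤ N) (hM : 0 < M) (hNM : N ≤ M)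
    (ha : ∀ j ≤ m, 1 ≤ j → ‖a j‖ ≤ A * N ^ j * gevreyWeight s j)
    (hb : ∀ j < m, ‖b j‖ ≤ B * M ^ j * gevreyWeight s j) :
    ‖binomConv (dropZero a) b m‖ ≤ 8 * (A * (N / M)) * B * M ^ m * gevreyWeight s m := by
  -- The entry of `b` at index m is multiplied by zero, so it may be replaced by 0 to meet the
  -- hypotheses of `norm_binomConv_le`.
  have hcongr : binomConv (dropZero a) b m =
      binomConv (dropZero a) (fun j => if j < m then b j else 0) m := by
    unfold binomConv
    apply Finset.sum_congr rfl
    intro i hi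
    rcases Nat.eq_zero_or_pos i with rfl | hi0
    · simp [dropZero]
    · have hi' : m - i < m := by have := Finset.mem_range.mp hi; omega
      simp only [if_pos hi']
  rw [hcongr]
  refine norm_binomConv_le hs (by positivity) hM.le (norm_dropZero_le hA hN hM hNM ha) ?_
  intro j _
  have := gevreyWeight_pos s j
  split_ifs with hjm
  · exact hb j hjm
  · rw [norm_zero]; positivity

/-! ### Pointwise Gevrey bounds -/

/-- `f` is smooth at `x` and its derivatives there satisfy the Gevrey bounds with constants
`A`, `M`. -/
structure GevreyAt (s A M : ℝ) (f : ℝ → ℂ) (x : ℝ) : Prop where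
  smooth : ContDiffAt ℝ (⊤ : ℕ∞) f x
  bound : ∀ m, ‖iteratedDeriv m f x‖ ≤ A * M ^ m * gevreyWeight s m

namespace GevreyAt

variable {s A B M N x : ℝ} {f g : ℝ → ℂ}

lemma contDiffAt (h : GevreyAt s A M f x) (n : ℕ) : ContDiffAt ℝ n f x :=
  h.smooth.of_le (by exact_mod_cast le_top)

lemma norm_le (h : GevreyAt s A M f x) : ‖f x‖ ≤ A := by
  simpa [gevreyWeight_zero] using h.bound 0

lemma nonneg (h : GevreyAt s A M f x) : 0 ≤ A := (norm_nonneg _).trans h.norm_le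

lemma mono (h : GevreyAt s A M f x) (hAB : A ≤ B) (hM : 0 ≤ M) (hMN : M ≤ N) :
    GevreyAt s B N f x := by
  refine ⟨h.smooth, fun m => (h.bound m).trans ?_⟩
  have := gevreyWeight_pos s m
  have := h.nonneg
  have := this.trans hAB
  gcongr

lemma congr (h : GevreyAt s A M f x) (hfg : g =ᶠ[𝓝 x] f) : GevreyAt s A M g x :=
  ⟨h.smooth.congr_of_eventuallyEq hfg, fun m => by rw [hfg.iteratedDeriv_eq]; exact h.bound m⟩

lemma iteratedDeriv_mul_eq (hf : GevreyAt s A M f x) (hg : GevreyAt s B N g x) (m : ℕ) :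
    iteratedDeriv m (fun y => f y * g y) x =
      binomConv (fun j => iteratedDeriv j f x) (fun j => iteratedDeriv j g x) m :=
  iteratedDeriv_fun_mul (hf.contDiffAt m) (hg.contDiffAt m)

lemma mul (hs : 0 < s ∧ s < 1) (hM : 0 ≤ M) (hf : GevreyAt s A M f x) (hg : GevreyAt s B M g x) :
    GevreyAt s (8 * A * B) M (fun y => f y * g y) x := by
  refine ⟨hf.smooth.mul hg.smooth, fun m => ?_⟩
  rw [iteratedDeriv_mul_eq hf hg]
  exact norm_binomConv_le hs hf.nonneg hM (fun j _ => hf.bound j) (fun j _ => hg.bound j)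

lemma add (hf : GevreyAt s A M f x) (hg : GevreyAt s B M g x) :
    GevreyAt s (A + B) M (fun y => f y + g y) x := by
  refine ⟨hf.smooth.add hg.smooth, fun m => ?_⟩
  rw [iteratedDeriv_fun_add (hf.contDiffAt m) (hg.contDiffAt m)]
  refine (norm_add_le _ _).trans ((add_le_add (hf.bound m) (hg.bound m)).trans (le_of_eq ?_))
  ring

lemma neg (hf : GevreyAt s A M f x) : GevreyAt s A M (fun y => -f y) x := by
  refine ⟨hf.smooth.neg, fun m => ?_⟩
  rw [iteratedDeriv_fun_neg, norm_neg]
  exact hf.bound m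

lemma const (c : ℂ) (hc : ‖c‖ ≤ A) (hM : 0 ≤ M) : GevreyAt s A M (fun _ => c) x := by
  refine ⟨contDiffAt_const, fun m => ?_⟩
  have := gevreyWeight_pos s m
  have hA : 0 ≤ A := (norm_nonneg _).trans hc
  rw [iteratedDeriv_const]
  split_ifs with h
  · subst h; simpa [gevreyWeight_zero] using hc
  · rw [norm_zero]; positivity

lemma const_mul (c : ℂ) (hf : GevreyAt s A M f x) : GevreyAt s (‖c‖ * A) M (fun y => c * f y) x := by
  refine ⟨contDiffAt_const.mul hf.smooth, fun m => ?_⟩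
  rw [iteratedDeriv_const_mul_field, norm_mul]
  have := mul_le_mul_of_nonneg_left (hf.bound m) (norm_nonneg c)
  linarith

lemma deriv (hs : 0 < s ∧ s < 1) (hM : 0 ≤ M) (hf : GevreyAt s A M f x) :
    GevreyAt s (A * M) (M * 2 ^ (1 / s)) (deriv f) x := by
  refine ⟨?_, fun m => ?_⟩
  · have := hf.smooth.fderiv_right (m := (⊤ : ℕ∞)) (by norm_cast)
    have h2 := (ContinuousLinearMap.apply ℝ ℂ (1 : ℝ)).contDiff.contDiffAt.comp x this
    exact h2
  · rw [← iteratedDeriv_succ']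
    refine (hf.bound (m + 1)).trans ?_
    have h0 := hf.nonneg
    calc _ ≤ A * M ^ (m + 1) * (((2 : ℝ) ^ (1 / s)) ^ m * gevreyWeight s m) := by
          gcongr; exact gevreyWeight_succ_le hs m
      _ = _ := by rw [pow_succ, mul_pow]; ring

/-- Lowering the index costs a factor 4 by `gevreyWeight_le_succ`. This serves primitives, where
only the derivative is known to be Gevrey. -/
lemma of_deriv (hs : 0 < s ∧ s < 1) (hM : 1 ≤ M) (hfs : ContDiffAt ℝ (⊤ : ℕ∞) f x)
    (hf : ‖f x‖ ≤ A) (hd : ∀ m, ‖iteratedDeriv m (_root_.deriv f) x‖ ≤ B * M ^ m * gevreyWeight s m) :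
    GevreyAt s (A + 4 * B) M f x := by
  have hA : 0 ≤ A := (norm_nonneg _).trans hf
  have hB : 0 ≤ B := by
    have := hd 0
    rw [gevreyWeight_zero, pow_zero, mul_one, mul_one] at this
    exact (norm_nonneg _).trans this
  refine ⟨hfs, fun m => ?_⟩
  cases m with
  | zero => simp [gevreyWeight_zero]; linarith
  | succ m =>
    rw [iteratedDeriv_succ']
    refine (hd m).trans ?_
    have h1 := gevreyWeight_le_succ hs m
    have hw := gevreyWeight_pos s (m + 1)
    have hw' := gevreyWeight_pos s m
    have : M ^ m ≤ M ^ (m + 1) := pow_le_pow_right₀ hM (Nat.le_succ m)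
    calc _ ≤ B * M ^ (m + 1) * (4 * gevreyWeight s (m + 1)) := by gcongr
      _ = 0 + (4 * B) * M ^ (m + 1) * gevreyWeight s (m + 1) := by ring
      _ ≤ A * M ^ (m + 1) * gevreyWeight s (m + 1) + (4 * B) * M ^ (m + 1) * gevreyWeight s (m + 1) := by
        gcongr; positivity
      _ = _ := by ring

/-- Reciprocals: only the ratio of the size of `f` to its lower bound enters the new rate. -/
lemma inv (hs : 0 < s ∧ s < 1) {H a : ℝ} (ha : 0 < a) (hH : 0 ≤ H) (hN : 0 < N)
    (hf : GevreyAt s (H * a) N f x) (hfa : a ≤ ‖f x‖) :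
    GevreyAt s a⁻¹ (N * (1 + 8 * H)) (fun y => (f y)⁻¹) x := by
  have hfx : f x ≠ 0 := norm_pos_iff.mp (ha.trans_le hfa)
  have hsm : ContDiffAt ℝ (⊤ : ℕ∞) (fun y => (f y)⁻¹) x := hf.smooth.inv hfx
  set M := N * (1 + 8 * H) with hMdef
  have hM : 0 < M := by positivity
  have hNM : N ≤ M := by rw [hMdef]; nlinarith
  refine ⟨hsm, fun m => ?_⟩
  induction m using Nat.strong_induction_on with
  | _ m ih =>
    rcases Nat.eq_zero_or_pos m with rfl | hm
    · simp only [iteratedDeriv_zero, pow_zero, gevreyWeight_zero, mul_one, norm_inv]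
      exact inv_anti₀ ha hfa
    -- Leibniz applied to f · f⁻¹ = 1 expresses the m-th derivative of the reciprocal through lower
    -- ones. The choice of M makes the factor 8H·N/M at most 1, which closes the induction.
    · have hone : (fun y => f y * (f y)⁻¹) =ᶠ[𝓝 x] fun _ => (1 : ℂ) := by
        filter_upwards [hf.smooth.continuousAt.eventually_ne hfx] with y hy
        exact mul_inv_cancel₀ hy
      have h0 : binomConv (fun j => iteratedDeriv j f x)
          (fun j => iteratedDeriv j (fun y => (f y)⁻¹) x) m = 0 := by
        have := iteratedDeriv_fun_mul (hf.contDiffAt m)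
          (hsm.of_le (by exact_mod_cast le_top) : ContDiffAt ℝ m (fun y => (f y)⁻¹) x)
        rw [hone.iteratedDeriv_eq, iteratedDeriv_const, if_neg hm.ne'] at this
        exact this.symm
      rw [binomConv_eq_add_dropZero, iteratedDeriv_zero] at h0
      have hbound := norm_binomConv_dropZero_le hs (m := m) (by positivity) (inv_nonneg.mpr ha.le)
        hN.le hM hNM (fun j _ _ => hf.bound j) (fun j hj => ih j hj)
      have heq : f x * iteratedDeriv m (fun y => (f y)⁻¹) x =
          -binomConv (dropZero fun j => iteratedDeriv j f x)
          (fun j => iteratedDeriv j (fun y => (f y)⁻¹) x) m := eq_neg_of_add_eq_zero_left h0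
      have hnorm : a * ‖iteratedDeriv m (fun y => (f y)⁻¹) x‖ ≤
          8 * (H * a * (N / M)) * a⁻¹ * M ^ m * gevreyWeight s m := by
        calc _ ≤ ‖f x‖ * ‖iteratedDeriv m (fun y => (f y)⁻¹) x‖ := by gcongr
          _ = ‖f x * iteratedDeriv m (fun y => (f y)⁻¹) x‖ := (norm_mul _ _).symm
          _ ≤ _ := by rw [heq, norm_neg]; exact hbound
      have hw := gevreyWeight_pos s m
      have hfac : 8 * H * (N / M) ≤ 1 := by
        rw [hMdef]
        have : 8 * H * (N / (N * (1 + 8 * H))) = 8 * H / (1 + 8 * H) := by field_simp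
        rw [this, div_le_one (by positivity)]; linarith
      rw [← mul_le_mul_iff_right₀ ha]
      refine hnorm.trans ?_
      calc 8 * (H * a * (N / M)) * a⁻¹ * M ^ m * gevreyWeight s m
          = a * ((8 * H * (N / M)) * a⁻¹ * M ^ m * gevreyWeight s m) := by ring
        _ ≤ a * (1 * a⁻¹ * M ^ m * gevreyWeight s m) := by gcongr
        _ = _ := by ring

lemma comp_const_sub (c : ℝ) (hf : GevreyAt s A M f (c - x)) :
    GevreyAt s A M (fun y => f (c - y)) x := by
  refine ⟨?_, fun m => ?_⟩
  · exact ContDiffAt.comp x hf.smooth (contDiffAt_const.sub contDiffAt_id)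
  · rw [iteratedDeriv_comp_const_sub, norm_smul, norm_pow, norm_neg, norm_one, one_pow, one_mul]
    exact hf.bound m

lemma comp_sub_const (c : ℝ) (hf : GevreyAt s A M f (x - c)) :
    GevreyAt s A M (fun y => f (y - c)) x := by
  refine ⟨?_, fun m => ?_⟩
  · exact ContDiffAt.comp x hf.smooth (contDiffAt_id.sub contDiffAt_const)
  · rw [iteratedDeriv_comp_sub_const]
    exact hf.bound m

end GevreyAt

/-! ### Uniform Gevrey bounds for families -/

/-- The functions `f i`, `i ∈ P`, satisfy Gevrey bounds on `I` with a common rate and constants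
proportional to the weights `w i`. -/
def UniformGevrey {ι : Type*} (s : ℝ) (P : Set ι) (I : Set ℝ) (w : ι → ℝ) (f : ι → ℝ → ℂ) : Prop :=
  ∃ A M : ℝ, 0 < A ∧ 1 ≤ M ∧ ∀ i ∈ P, ∀ x ∈ I, GevreyAt s (A * w i) M (f i) x

namespace UniformGevrey

variable {ι : Type*} {s : ℝ} {P Q : Set ι} {I J : Set ℝ} {w w' : ι → ℝ} {f g : ι → ℝ → ℂ}

lemma contDiffAt (h : UniformGevrey s P I w f) {i : ι} (hi : i ∈ P) {x : ℝ} (hx : x ∈ I) :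
    ContDiffAt ℝ (⊤ : ℕ∞) (f i) x := by
  obtain ⟨A, M, _, _, h⟩ := h
  exact (h i hi x hx).smooth

lemma mono_set (h : UniformGevrey s P I w f) (hQ : Q ⊆ P) (hJ : J ⊆ I) :
    UniformGevrey s Q J w f := by
  obtain ⟨A, M, hA, hM, h⟩ := h
  exact ⟨A, M, hA, hM, fun i hi x hx => h i (hQ hi) x (hJ hx)⟩

lemma union (h : UniformGevrey s P I w f) (h' : UniformGevrey s P J w f) (hw : ∀ i ∈ P, 0 ≤ w i) :
    UniformGevrey s P (I ∪ J) w f := by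
  obtain ⟨A, M, hA, hM, h⟩ := h
  obtain ⟨A', M', hA', hM', h'⟩ := h'
  refine ⟨max A A', max M M', by positivity, le_max_of_le_left hM, fun i hi x hx => ?_⟩
  have := hw i hi
  rcases hx with hx | hx
  · exact (h i hi x hx).mono (by gcongr; exact le_max_left _ _) (by linarith) (le_max_left _ _)
  · exact (h' i hi x hx).mono (by gcongr; exact le_max_right _ _) (by linarith) (le_max_right _ _)

lemma union_index (h : UniformGevrey s P I w f) (h' : UniformGevrey s Q I w f)
    (hw : ∀ i ∈ P ∪ Q, 0 ≤ w i) : UniformGevrey s (P ∪ Q) I w f := by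
  obtain ⟨A, M, hA, hM, h⟩ := h
  obtain ⟨A', M', hA', hM', h'⟩ := h'
  refine ⟨max A A', max M M', by positivity, le_max_of_le_left hM, fun i hi x hx => ?_⟩
  have := hw i hi
  rcases hi with hi | hi
  · exact (h i hi x hx).mono (by gcongr; exact le_max_left _ _) (by linarith) (le_max_left _ _)
  · exact (h' i hi x hx).mono (by gcongr; exact le_max_right _ _) (by linarith) (le_max_right _ _)

lemma mono_weight (h : UniformGevrey s P I w f) (C : ℝ) (hC : 0 < C)
    (hw : ∀ i ∈ P, w i ≤ C * w' i) : UniformGevrey s P I w' f := by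
  obtain ⟨A, M, hA, hM, h⟩ := h
  refine ⟨A * C, M, by positivity, hM, fun i hi x hx => (h i hi x hx).mono ?_ (by linarith) le_rfl⟩
  rw [mul_assoc]
  exact mul_le_mul_of_nonneg_left (hw i hi) hA.le

lemma weight_nonneg (h : UniformGevrey s P I w f) (hI : I.Nonempty) {i : ι} (hi : i ∈ P) :
    0 ≤ w i := by
  obtain ⟨A, M, hA, hM, h⟩ := h
  obtain ⟨x, hx⟩ := hI
  exact nonneg_of_mul_nonneg_right (h i hi x hx).nonneg hA

lemma congr (h : UniformGevrey s P I w f) (hfg : ∀ i ∈ P, ∀ x ∈ I, g i =ᶠ[𝓝 x] f i) :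
    UniformGevrey s P I w g := by
  obtain ⟨A, M, hA, hM, h⟩ := h
  exact ⟨A, M, hA, hM, fun i hi x hx => (h i hi x hx).congr (hfg i hi x hx)⟩

lemma common (h : UniformGevrey s P I w f) (h' : UniformGevrey s Q J w' g)
    (hw : ∀ i ∈ P, ∀ x ∈ I, 0 ≤ w i) (hw' : ∀ i ∈ Q, ∀ x ∈ J, 0 ≤ w' i) :
    ∃ A M : ℝ, 1 ≤ A ∧ 1 ≤ M ∧ (∀ i ∈ P, ∀ x ∈ I, GevreyAt s (A * w i) M (f i) x) ∧
      ∀ i ∈ Q, ∀ x ∈ J, GevreyAt s (A * w' i) M (g i) x := by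
  obtain ⟨A, M, hA, hM, h⟩ := h
  obtain ⟨A', M', hA', hM', h'⟩ := h'
  refine ⟨1 + A + A', M + M', by linarith, by linarith, fun i hi x hx => ?_, fun i hi x hx => ?_⟩
  · have := hw i hi x hx
    exact (h i hi x hx).mono (by gcongr; linarith) (by linarith) (by linarith)
  · have := hw' i hi x hx
    exact (h' i hi x hx).mono (by gcongr; linarith) (by linarith) (by linarith)

lemma weight_nonneg' (h : UniformGevrey s P I w f) : ∀ i ∈ P, ∀ x ∈ I, 0 ≤ w i :=
  fun _ hi _ hx => h.weight_nonneg ⟨_, hx⟩ hi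

lemma mul (hs : 0 < s ∧ s < 1) (h : UniformGevrey s P I w f) (h' : UniformGevrey s P I w' g) :
    UniformGevrey s P I (fun i => w i * w' i) (fun i x => f i x * g i x) := by
  obtain ⟨A, M, hA, hM, h1, h2⟩ := h.common h' h.weight_nonneg' h'.weight_nonneg'
  refine ⟨8 * A * A, M, by positivity, hM, fun i hi x hx => ?_⟩
  refine ((h1 i hi x hx).mul hs (by linarith) (h2 i hi x hx)).mono (le_of_eq (by ring))
    (by linarith) le_rfl

lemma add (h : UniformGevrey s P I w f) (h' : UniformGevrey s P I w g) :
    UniformGevrey s P I w (fun i x => f i x + g i x) := by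
  obtain ⟨A, M, hA, hM, h1, h2⟩ := h.common h' h.weight_nonneg' h'.weight_nonneg'
  refine ⟨2 * A, M, by positivity, hM, fun i hi x hx => ?_⟩
  exact ((h1 i hi x hx).add (h2 i hi x hx)).mono (le_of_eq (by ring)) (by linarith) le_rfl

lemma neg (h : UniformGevrey s P I w f) : UniformGevrey s P I w (fun i x => -f i x) := by
  obtain ⟨A, M, hA, hM, h⟩ := h
  exact ⟨A, M, hA, hM, fun i hi x hx => (h i hi x hx).neg⟩

lemma sub (h : UniformGevrey s P I w f) (h' : UniformGevrey s P I w g) :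
    UniformGevrey s P I w (fun i x => f i x - g i x) := by
  simpa only [sub_eq_add_neg] using h.add h'.neg

lemma const_mul (h : UniformGevrey s P I w f) (c : ι → ℂ) :
    UniformGevrey s P I (fun i => ‖c i‖ * w i) (fun i x => c i * f i x) := by
  obtain ⟨A, M, hA, hM, h⟩ := h
  exact ⟨A, M, hA, hM, fun i hi x hx => ((h i hi x hx).const_mul (c i)).mono
    (le_of_eq (by ring)) (by linarith) le_rfl⟩

lemma const (c : ι → ℂ) (hc : ∀ i ∈ P, ‖c i‖ ≤ w i) : UniformGevrey s P I w (fun i _ => c i) :=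
  ⟨1, 1, one_pos, le_rfl, fun i hi _ _ => GevreyAt.const _ (by rw [one_mul]; exact hc i hi)
    zero_le_one⟩

lemma deriv (hs : 0 < s ∧ s < 1) (h : UniformGevrey s P I w f) :
    UniformGevrey s P I w (fun i => deriv (f i)) := by
  obtain ⟨A, M, hA, hM, h⟩ := h
  have h2 : (1 : ℝ) ≤ 2 ^ (1 / s) := Real.one_le_rpow (by norm_num) (by have := hs.1; positivity)
  refine ⟨A * M, M * 2 ^ (1 / s), by positivity, one_le_mul_of_one_le_of_one_le hM h2,
    fun i hi x hx => ?_⟩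
  exact ((h i hi x hx).deriv hs (by linarith)).mono (le_of_eq (by ring)) (by positivity) le_rfl

/-- In `GevreyAt.inv` the new rate depends only on the ratio of upper to lower bound. Here that
ratio is A / c, so the rate is uniform even when the weights are unbounded. -/
lemma inv (hs : 0 < s ∧ s < 1) (h : UniformGevrey s P I w f) (hw : ∀ i ∈ P, 0 < w i) {c : ℝ}
    (hc : 0 < c) (hf : ∀ i ∈ P, ∀ x ∈ I, c * w i ≤ ‖f i x‖) :
    UniformGevrey s P I (fun i => (w i)⁻¹) (fun i x => (f i x)⁻¹) := by
  obtain ⟨A, M, hA, hM, h⟩ := h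
  refine ⟨c⁻¹, M * (1 + 8 * (A / c)), by positivity,
    one_le_mul_of_one_le_of_one_le hM (by linarith [show 0 ≤ A / c by positivity]),
    fun i hi x hx => ?_⟩
  have hwi := hw i hi
  have := GevreyAt.inv hs (H := A / c) (a := c * w i) (N := M) (by positivity) (by positivity)
    (by linarith) ((h i hi x hx).mono (le_of_eq (by field_simp)) (by linarith) le_rfl)
    (hf i hi x hx)
  exact this.mono (le_of_eq (mul_inv _ _)) (by positivity) le_rfl

lemma comp_const_sub (c : ℝ) (h : UniformGevrey s P I w f) :
    UniformGevrey s P {x | c - x ∈ I} w (fun i x => f i (c - x)) := by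
  obtain ⟨A, M, hA, hM, h⟩ := h
  exact ⟨A, M, hA, hM, fun i hi x hx => (h i hi (c - x) hx).comp_const_sub c⟩

lemma comp_sub_const (c : ℝ) (h : UniformGevrey s P I w f) :
    UniformGevrey s P {x | x - c ∈ I} w (fun i x => f i (x - c)) := by
  obtain ⟨A, M, hA, hM, h⟩ := h
  exact ⟨A, M, hA, hM, fun i hi x hx => (h i hi (x - c) hx).comp_sub_const c⟩

lemma comp_index {κ : Type*} (σ : κ → ι) (h : UniformGevrey s P I w f) :
    UniformGevrey s (σ ⁻¹' P) I (fun j => w (σ j)) (fun j => f (σ j)) := by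
  obtain ⟨A, M, hA, hM, h⟩ := h
  exact ⟨A, M, hA, hM, fun i hi x hx => h (σ i) hi x hx⟩

end UniformGevrey

/-! ### Linear first order equations -/

lemma exists_primitive_on_Ioo {l r v₀ : ℝ} {a : ℝ → ℂ} (ha : ContinuousOn a (Ioo l r))
    (hv₀ : v₀ ∈ Ioo l r) : ∃ A : ℝ → ℂ, A v₀ = 0 ∧ ∀ v ∈ Ioo l r, HasDerivAt A (a v) v := by
  refine ⟨fun v => ∫ x in v₀..v, a x, by simp, fun v hv => ?_⟩
  have hsub : uIcc v₀ v ⊆ Ioo l r := (ordConnected_Ioo).uIcc_subset hv₀ hv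
  exact intervalIntegral.integral_hasDerivAt_right (ha.mono hsub).intervalIntegrable
    (ha.stronglyMeasurableAtFilter isOpen_Ioo v hv) (ha.continuousAt (isOpen_Ioo.mem_nhds hv))

lemma exists_linear_ode {l r v₀ : ℝ} {a f : ℝ → ℂ} (ha : ContinuousOn a (Ioo l r))
    (hf : ContinuousOn f (Ioo l r)) (hv₀ : v₀ ∈ Ioo l r) (y₀ : ℂ) :
    ∃ y : ℝ → ℂ, y v₀ = y₀ ∧ ∀ v ∈ Ioo l r, HasDerivAt y (-a v * y v + f v) v := by
  obtain ⟨A, hA0, hA⟩ := exists_primitive_on_Ioo ha hv₀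
  have hAc : ContinuousOn A (Ioo l r) := fun v hv => (hA v hv).continuousAt.continuousWithinAt
  obtain ⟨B, hB0, hB⟩ := exists_primitive_on_Ioo
    (a := fun v => Complex.exp (A v) * f v) ((hAc.cexp).mul hf) hv₀
  refine ⟨fun v => Complex.exp (-A v) * (y₀ + B v), by simp [hA0, hB0], fun v hv => ?_⟩
  have h := (hA v hv).neg.cexp.mul ((hB v hv).const_add y₀)
  refine h.congr_deriv ?_
  have : Complex.exp (-A v) * Complex.exp (A v) = 1 := by rw [← Complex.exp_add]; simp
  linear_combination f v * this

lemma linear_ode_unique {l r v₀ : ℝ} {a y : ℝ → ℂ} (ha : ContinuousOn a (Ioo l r))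
    (hv₀ : v₀ ∈ Ioo l r) (hy : ∀ v ∈ Ioo l r, HasDerivAt y (a v * y v) v) (hy₀ : y v₀ = 0) :
    ∀ v ∈ Ioo l r, y v = 0 := by
  intro v hv
  obtain ⟨A, hA0, hA⟩ := exists_primitive_on_Ioo ha hv₀
  have hd : ∀ x ∈ Ioo l r, HasDerivAt (fun x => Complex.exp (-A x) * y x) 0 x := by
    intro x hx
    refine ((hA x hx).neg.cexp.mul (hy x hx)).congr_deriv ?_
    simp
    ring
  have := isOpen_Ioo.is_const_of_deriv_eq_zero isPreconnected_Ioo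
    (fun x hx => (hd x hx).differentiableAt.differentiableWithinAt)
    (fun x hx => (hd x hx).deriv) hv hv₀
  simpa [hy₀, Complex.exp_ne_zero] using this

/-- Bootstrap: the right-hand side of the equation is as smooth as the solution, hence the solution
gains one order at a time. -/
lemma contDiffOn_of_ode {J : Set ℝ} (hJ : IsOpen J) {z z' : ℝ → ℂ}
    (hz : ∀ x ∈ J, HasDerivAt z (z' x) x)
    (hboot : ∀ n : ℕ, ContDiffOn ℝ n z J → ContDiffOn ℝ n z' J) :
    ContDiffOn ℝ (⊤ : ℕ∞) z J := by
  rw [contDiffOn_infty]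
  intro n
  induction n with
  | zero =>
    exact contDiffOn_zero.mpr fun x hx => (hz x hx).continuousAt.continuousWithinAt
  | succ n ih =>
    push_cast
    rw [contDiffOn_succ_iff_deriv_of_isOpen hJ]
    refine ⟨fun x hx => (hz x hx).differentiableAt.differentiableWithinAt, by simp, ?_⟩
    exact (hboot n ih).congr fun x hx => (hz x hx).deriv

lemma contDiffOn_of_linear_ode {J : Set ℝ} (hJ : IsOpen J) {y a f : ℝ → ℂ}
    (hy : ∀ x ∈ J, HasDerivAt y (-a x * y x + f x) x) (ha : ContDiffOn ℝ (⊤ : ℕ∞) a J)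
    (hf : ContDiffOn ℝ (⊤ : ℕ∞) f J) : ContDiffOn ℝ (⊤ : ℕ∞) y J := by
  refine contDiffOn_of_ode hJ hy fun n hn => ?_
  rw [contDiffOn_infty] at ha hf
  exact ((ha n).neg.mul hn).add (hf n)

/-- The sup bound for a damped linear equation `y' = -a y + f`. -/
lemma norm_le_of_damped {l r c F B : ℝ} {y a f : ℝ → ℂ} (hc : 0 < c)
    (hcont : ContinuousOn y (Icc l r))
    (hy : ∀ x ∈ Ico l r, HasDerivWithinAt y (-a x * y x + f x) (Ici x) x)
    (ha : ∀ x ∈ Ico l r, c ≤ (a x).re) (hf : ∀ x ∈ Ico l r, ‖f x‖ ≤ F)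
    (hl : ‖y l‖ ≤ B) (hFB : F ≤ c * B) : ∀ x ∈ Icc l r, ‖y x‖ ≤ B := by
  have hB : 0 ≤ B := (norm_nonneg _).trans hl
  intro x hx
  -- The slack ε makes the barrier strict. Where ‖y‖ = B + ε, half the derivative of ‖y‖² is at most
  -- (B + ε)(F - c(B + ε)), which is negative because F ≤ cB.
  refine le_of_forall_pos_le_add fun ε hε => ?_
  have key := image_le_of_deriv_right_lt_deriv_boundary (f := fun x => ‖y x‖ ^ 2)
    (f' := fun x => 2 * inner ℝ (y x) (-a x * y x + f x)) (a := l) (b := r)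
    (B := fun _ => (B + ε) ^ 2) (B' := fun _ => 0) (hcont.norm.pow 2)
    (fun x hx => (hy x hx).norm_sq) (by gcongr; linarith) (fun x => hasDerivAt_const _ _) ?_ hx
  · exact le_of_sq_le_sq key (by linarith)
  · intro x hx h
    have hyx : ‖y x‖ = B + ε :=
      (sq_eq_sq₀ (norm_nonneg (y x)) (by linarith)).mp h
    have h1 : inner ℝ (y x) (-a x * y x + f x) =
        -(a x).re * ‖y x‖ ^ 2 + inner ℝ (y x) (f x) := by
      rw [inner_add_right, Complex.inner, ← Complex.normSq_eq_norm_sq, Complex.normSq_apply]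
      simp
      ring
    have h2 : inner ℝ (y x) (f x) ≤ (B + ε) * F :=
      (real_inner_le_norm _ _).trans (by rw [hyx]; gcongr; exact hf x hx)
    have h3 : c * (B + ε) ^ 2 ≤ (a x).re * (B + ε) ^ 2 := by gcongr; exact ha x hx
    have h4 : (B + ε) * F ≤ (B + ε) * (c * B) := by gcongr
    rw [h1, hyx]
    nlinarith [mul_pos (mul_pos hc hε) (show 0 < B + ε by linarith)]

/-! ### Gevrey bounds for damped equations -/

lemma hasDerivAt_iteratedDeriv {y : ℝ → ℂ} {x : ℝ}
    (hy : ContDiffAt ℝ (⊤ : ℕ∞) y x) (m : ℕ) :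
    HasDerivAt (iteratedDeriv m y) (iteratedDeriv (m + 1) y x) x := by
  rw [iteratedDeriv_succ]
  apply DifferentiableAt.hasDerivAt
  have := hy.contDiffWithinAt (s := univ) |>.differentiableWithinAt_iteratedDerivWithin (m := m)
    (by exact_mod_cast WithTop.coe_lt_top _) (by simp)
  rwa [iteratedDerivWithin_univ, differentiableWithinAt_univ] at this

/-- The m-th derivative of y solves the same damped equation, with source f^{(m)} minus the
commutator terms in which `a` is differentiated at least once. Strong induction on m and the sup
bound `norm_le_of_damped` apply. Only derivatives of `a` of order at least one are measured, so a
large constant imaginary part of `a` costs nothing. -/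
lemma gevreyAt_of_damped {s c A G N κ F l r : ℝ} (hs : 0 < s ∧ s < 1) (hc : 0 < c) (hA : 0 ≤ A)
    (hG : 0 ≤ G) (hN : 0 < N) (hκ : 0 < κ) (hF : 0 ≤ F) {y a f : ℝ → ℂ}
    (hy : ∀ x ∈ Icc l r, ∀ᶠ x' in 𝓝 x, HasDerivAt y (-a x' * y x' + f x') x')
    (hys : ∀ x ∈ Icc l r, ContDiffAt ℝ (⊤ : ℕ∞) y x)
    (has : ∀ x ∈ Icc l r, ContDiffAt ℝ (⊤ : ℕ∞) a x)
    (ha : ∀ x ∈ Icc l r, ∀ j, 1 ≤ j → ‖iteratedDeriv j a x‖ ≤ A * κ * N ^ j * gevreyWeight s j)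
    (hre : ∀ x ∈ Icc l r, c * κ ≤ (a x).re)
    (hf : ∀ x ∈ Icc l r, GevreyAt s F N f x) (hl : GevreyAt s (G * (F / κ)) N y l) :
    ∀ x ∈ Icc l r, GevreyAt s ((2 / c + G) * (F / κ)) (N * (1 + 16 * A / c)) y x := by
  -- The term 2/c makes the source, and the factor 1 + 16A/c in M makes the commutator, each at most
  -- half of the damping cκ times the target bound. The term G accounts for the data at `l`.
  set B := (2 / c + G) * (F / κ) with hB
  set M := N * (1 + 16 * A / c) with hM
  have hM0 : 0 < M := by positivity
  have hNM : N ≤ M := by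
    rw [hM]; nlinarith [show 0 ≤ 16 * A / c by positivity]
  have hB0 : 0 ≤ B := by positivity
  suffices h : ∀ m, ∀ x ∈ Icc l r, ‖iteratedDeriv m y x‖ ≤ B * M ^ m * gevreyWeight s m from
    fun x hx => ⟨hys x hx, fun m => h m x hx⟩
  intro m
  induction m using Nat.strong_induction_on with
  | _ m ih =>
    have hw := gevreyWeight_pos s m
    set R : ℝ → ℂ := fun x => iteratedDeriv m f x -
      binomConv (dropZero fun j => iteratedDeriv j a x) (fun j => iteratedDeriv j y x) m with hR
    have hder : ∀ x ∈ Icc l r,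
        HasDerivAt (iteratedDeriv m y) (-a x * iteratedDeriv m y x + R x) x := by
      intro x hx
      refine (hasDerivAt_iteratedDeriv (hys x hx) m).congr_deriv ?_
      have hev : deriv y =ᶠ[𝓝 x] fun x' => -(a x' * y x') + f x' := by
        filter_upwards [hy x hx] with x' hx'
        rw [hx'.deriv]; ring
      have ha' : ContDiffAt ℝ m a x := (has x hx).of_le (by exact_mod_cast le_top)
      have hy' : ContDiffAt ℝ m y x := (hys x hx).of_le (by exact_mod_cast le_top)
      rw [iteratedDeriv_succ', hev.iteratedDeriv_eq,
        iteratedDeriv_fun_add (ha'.mul hy').neg ((hf x hx).contDiffAt m), iteratedDeriv_fun_neg,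
        iteratedDeriv_fun_mul ha' hy']
      have := binomConv_eq_add_dropZero (fun j => iteratedDeriv j a x)
        (fun j => iteratedDeriv j y x) m
      rw [binomConv] at this
      rw [this, hR, iteratedDeriv_zero]
      ring
    have hRb : ∀ x ∈ Icc l r, ‖R x‖ ≤ c * κ * (B * M ^ m * gevreyWeight s m) := by
      intro x hx
      have h1 : ‖iteratedDeriv m f x‖ ≤ F * M ^ m * gevreyWeight s m :=
        ((hf x hx).mono le_rfl hN.le hNM).bound m
      have h2 := norm_binomConv_dropZero_le hs (m := m) (A := A * κ) (by positivity) hB0 hN.le hM0 hNM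
        (fun j _ hj => ha x hx j hj) (fun j hj => ih j hj x hx)
      have h3 : F ≤ c * κ / 2 * B := by
        rw [hB]
        have : c * κ / 2 * ((2 / c + G) * (F / κ)) = F + c / 2 * G * F := by field_simp
        rw [this]
        have : 0 ≤ c / 2 * G * F := by positivity
        linarith
      have h4 : 8 * (A * κ * (N / M)) ≤ c * κ / 2 := by
        have : 8 * (A * (N / M)) ≤ c / 2 := by
          rw [hM]
          have e : 8 * (A * (N / (N * (1 + 16 * A / c)))) = 8 * A * c / (c + 16 * A) := by
            field_simp
          rw [e, div_le_div_iff₀ (by positivity) (by norm_num)]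
          nlinarith
        nlinarith
      calc ‖R x‖ ≤ F * M ^ m * gevreyWeight s m +
            8 * (A * κ * (N / M)) * B * M ^ m * gevreyWeight s m :=
            (norm_sub_le _ _).trans (add_le_add h1 h2)
        _ ≤ (c * κ / 2 * B) * M ^ m * gevreyWeight s m +
            (c * κ / 2) * B * M ^ m * gevreyWeight s m := by gcongr
        _ = _ := by ring
    refine norm_le_of_damped (c := c * κ) (by positivity)
      (fun x hx => (hder x hx).continuousAt.continuousWithinAt)
      (fun x hx => (hder x (Ico_subset_Icc_self hx)).hasDerivWithinAt)
      (fun x hx => hre x (Ico_subset_Icc_self hx))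
      (fun x hx => hRb x (Ico_subset_Icc_self hx)) ?_ le_rfl
    refine (hl.bound m).trans ?_
    have : G * (F / κ) ≤ B := by
      rw [hB]
      have : 0 ≤ F / κ := by positivity
      have : 0 ≤ 2 / c := by positivity
      nlinarith
    gcongr

/-- Two passes. Damping alone gives the gain 1/κ, so y' has weight w/κ ≤ w. The equation is then
read algebraically as y = (f - y') / (a - iω), and division by a - iω yields the full gain (κ +
|ω|)⁻¹, including the oscillation frequency. -/
lemma UniformGevrey.of_damped {ι : Type*} {s c l r : ℝ} (hs : 0 < s ∧ s < 1) (hc : 0 < c)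
    (hlr : l ≤ r) {P : Set ι} {κ w ω : ι → ℝ} {a : ι → ℝ → ℝ} {y f : ι → ℝ → ℂ}
    (h1κ : ∀ i ∈ P, 1 ≤ κ i)
    (ha : UniformGevrey s P (Icc l r) κ (fun i x => (a i x : ℂ)))
    (hac : ∀ i ∈ P, ∀ x ∈ Icc l r, c * κ i ≤ a i x)
    (hf : UniformGevrey s P (Icc l r) w f)
    (hy : ∀ i ∈ P, ∀ x ∈ Icc l r, ∀ᶠ x' in 𝓝 x,
      HasDerivAt (y i) (-((a i x' : ℂ) - Complex.I * ω i) * y i x' + f i x') x')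
    (hys : ∀ i ∈ P, ∀ x ∈ Icc l r, ContDiffAt ℝ (⊤ : ℕ∞) (y i) x)
    (hl : UniformGevrey s P {l} (fun i => w i / κ i) y) :
    UniformGevrey s P (Icc l r) (fun i => w i * (κ i + |ω i|)⁻¹) y := by
  have hκ : ∀ i ∈ P, 0 < κ i := fun i hi => one_pos.trans_le (h1κ i hi)
  have hne : (Icc l r).Nonempty := nonempty_Icc.mpr hlr
  have hw : ∀ i ∈ P, 0 ≤ w i := fun i hi => hf.weight_nonneg hne hi
  have hdamp : UniformGevrey s P (Icc l r) (fun i => w i / κ i) y := by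
    obtain ⟨A₁, N₁, hA₁, hN₁, ha'⟩ := ha
    obtain ⟨A₂, N₂, hA₂, hN₂, hf'⟩ := hf
    obtain ⟨A₃, N₃, hA₃, hN₃, hl'⟩ := hl
    set N := max N₁ (max N₂ N₃)
    have hN1 : N₁ ≤ N := le_max_left _ _
    have hN2 : N₂ ≤ N := (le_max_left _ _).trans (le_max_right _ _)
    have hN3 : N₃ ≤ N := (le_max_right _ _).trans (le_max_right _ _)
    refine ⟨(2 / c + A₃ / A₂) * A₂, N * (1 + 16 * A₁ / c), by positivity,
      one_le_mul_of_one_le_of_one_le (by linarith)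
        (by linarith [show 0 ≤ 16 * A₁ / c by positivity]), fun i hi x hx => ?_⟩
    have hκi := hκ i hi
    have hwi := hw i hi
    have := gevreyAt_of_damped hs hc (l := l) (r := r) (A := A₁) (G := A₃ / A₂) (N := N) (κ := κ i)
      (F := A₂ * w i) hA₁.le (by positivity) (by linarith) hκi (by positivity) (y := y i)
      (a := fun x => (a i x : ℂ) - Complex.I * ω i) (f := f i) (hy i hi) (hys i hi)
      (fun x hx => (ha' i hi x hx).smooth.sub contDiffAt_const)
      (fun x hx j hj => by
        have e : (fun x => (a i x : ℂ) - Complex.I * ω i) =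
          fun x => -(Complex.I * ω i) + (a i x : ℂ) := by funext x; ring
        rw [e, iteratedDeriv_const_add (by omega)]
        exact ((ha' i hi x hx).mono le_rfl (by linarith) hN1).bound j)
      (fun x hx => by simpa using hac i hi x hx)
      (fun x hx => (hf' i hi x hx).mono le_rfl (by linarith) hN2)
      ((hl' i hi l rfl).mono (le_of_eq (by field_simp)) (by linarith) hN3) x hx
    exact this.mono (le_of_eq (by ring))
      (mul_nonneg (by linarith) (by linarith [show 0 ≤ 16 * A₁ / c by positivity])) le_rfl
  have hcoef : UniformGevrey s P (Icc l r) (fun i => κ i + |ω i|)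
      (fun i x => (a i x : ℂ) - Complex.I * ω i) := by
    refine (ha.mono_weight 1 one_pos fun i hi => ?_).sub (UniformGevrey.const _ fun i hi => ?_)
    · linarith [abs_nonneg (ω i)]
    · rw [norm_mul, Complex.norm_I, Complex.norm_real, Real.norm_eq_abs]
      linarith [hκ i hi]
  -- The modulus dominates both the real part, at least cκ, and |ω|, hence half of their sum.
  have hinv := hcoef.inv hs (c := min c 1 / 2)
    (fun i hi => by have := hκ i hi; positivity) (by positivity) (fun i hi x hx => by
      have h1 : |a i x| ≤ ‖(a i x : ℂ) - Complex.I * ω i‖ := by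
        simpa using Complex.abs_re_le_norm ((a i x : ℂ) - Complex.I * ω i)
      have h2 : |ω i| ≤ ‖(a i x : ℂ) - Complex.I * ω i‖ := by
        simpa using Complex.abs_im_le_norm ((a i x : ℂ) - Complex.I * ω i)
      have h3 := hac i hi x hx
      have h4 := le_abs_self (a i x)
      have h5 : min c 1 * κ i ≤ c * κ i := by
        have := hκ i hi
        gcongr; exact min_le_left _ _
      have h6 : min c 1 * |ω i| ≤ 1 * |ω i| := by gcongr; exact min_le_right _ _
      nlinarith)
  have hdw : UniformGevrey s P (Icc l r) w (fun i x => f i x - _root_.deriv (y i) x) :=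
    hf.sub ((hdamp.deriv hs).mono_weight 1 one_pos fun i hi => by
      rw [one_mul]; exact div_le_self (hw i hi) (h1κ i hi))
  refine (hdw.mul hs hinv).congr fun i hi x hx => ?_
  have hne : (a i x : ℂ) - Complex.I * ω i ≠ 0 := fun h0 => by
    have h3 := hac i hi x hx
    have := congrArg Complex.re h0
    simp at this
    have := mul_pos hc (hκ i hi)
    linarith
  filter_upwards [hy i hi x hx, (hcoef.contDiffAt hi hx).continuousAt.eventually_ne hne]
    with x' hx' hne'
  rw [hx'.deriv]
  field_simp
  ring

/-- The reflection x ↦ l + r - x turns growth into damping, changes the signs of ω and f, and moves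
the data from the right end to the left end. -/
lemma UniformGevrey.of_damped_backward {ι : Type*} {s c l r : ℝ} (hs : 0 < s ∧ s < 1) (hc : 0 < c)
    (hlr : l ≤ r) {P : Set ι} {κ w ω : ι → ℝ} {a : ι → ℝ → ℝ} {y f : ι → ℝ → ℂ}
    (h1κ : ∀ i ∈ P, 1 ≤ κ i)
    (ha : UniformGevrey s P (Icc l r) κ (fun i x => (a i x : ℂ)))
    (hac : ∀ i ∈ P, ∀ x ∈ Icc l r, c * κ i ≤ a i x)
    (hf : UniformGevrey s P (Icc l r) w f)
    (hy : ∀ i ∈ P, ∀ x ∈ Icc l r, ∀ᶠ x' in 𝓝 x,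
      HasDerivAt (y i) (((a i x' : ℂ) + Complex.I * ω i) * y i x' + f i x') x')
    (hys : ∀ i ∈ P, ∀ x ∈ Icc l r, ContDiffAt ℝ (⊤ : ℕ∞) (y i) x)
    (hr : UniformGevrey s P {r} (fun i => w i / κ i) y) :
    UniformGevrey s P (Icc l r) (fun i => w i * (κ i + |ω i|)⁻¹) y := by
  have hmem : ∀ x ∈ Icc l r, l + r - x ∈ Icc l r := fun x hx =>
    ⟨by linarith [hx.2], by linarith [hx.1]⟩
  have hrefl : ∀ x ∈ Icc l r, Filter.Tendsto (fun y => l + r - y) (𝓝 x) (𝓝 (l + r - x)) :=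
    fun x _ => (continuous_const.sub continuous_id).continuousAt
  have key := UniformGevrey.of_damped hs hc hlr (P := P) (κ := κ) (w := w) (ω := fun i => -ω i)
    (a := fun i x => a i (l + r - x)) (y := fun i x => y i (l + r - x))
    (f := fun i x => -f i (l + r - x)) h1κ
    ((ha.comp_const_sub (l + r)).mono_set le_rfl hmem)
    (fun i hi x hx => hac i hi _ (hmem x hx))
    ((hf.comp_const_sub (l + r)).mono_set le_rfl hmem).neg
    (fun i hi x hx => by
      filter_upwards [(hrefl x hx).eventually (hy i hi _ (hmem x hx))] with x' hx'
      refine (hx'.scomp x' ((hasDerivAt_id x').const_sub (l + r))).congr_deriv ?_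
      simp
      ring)
    (fun i hi x hx => (hys i hi _ (hmem x hx)).comp x (contDiffAt_const.sub contDiffAt_id))
    ((hr.comp_const_sub (l + r)).mono_set le_rfl (by simp))
  have := (key.comp_const_sub (l + r)).mono_set le_rfl hmem
  simpa using this

/-- Gevrey bounds, uniform in the large parameters `k i`, for the Riccati equation
`ρ' = k (q - r ρ²)`. -/
lemma UniformGevrey.of_riccati {ι : Type*} {s c B l l' : ℝ} (hs : 0 < s ∧ s < 1) (hc : 0 < c)
    (hB : 0 ≤ B) {P : Set ι} {k : ι → ℝ} {ρ : ι → ℝ → ℂ} {q r : ℝ → ℂ}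
    (hk : ∀ i ∈ P, 0 < k i)
    (hq : UniformGevrey s P (Icc l l') (fun _ => 1) (fun _ => q))
    (hr : UniformGevrey s P (Icc l l') (fun _ => 1) (fun _ => r))
    (hρ : ∀ i ∈ P, ∀ x ∈ Icc l l', ∀ᶠ x' in 𝓝 x,
      HasDerivAt (ρ i) (k i * (q x' - r x' * ρ i x' ^ 2)) x')
    (hρs : ∀ i ∈ P, ∀ x ∈ Icc l l', ContDiffAt ℝ (⊤ : ℕ∞) (ρ i) x)
    (hρB : ∀ i ∈ P, ∀ x ∈ Icc l l', ‖ρ i x‖ ≤ B)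
    (hρc : ∀ i ∈ P, ∀ x ∈ Icc l l', c ≤ (r x * ρ i x).re)
    (hl : UniformGevrey s P {l} (fun _ => 1) ρ) :
    UniformGevrey s P (Icc l l') (fun _ => 1) ρ := by
  obtain ⟨A, N, hA, hN, hA1, hq', hr', hl'⟩ : ∃ A N : ℝ, 0 < A ∧ 1 ≤ N ∧ 1 ≤ A ∧
      (∀ i ∈ P, ∀ x ∈ Icc l l', GevreyAt s A N q x) ∧
      (∀ i ∈ P, ∀ x ∈ Icc l l', GevreyAt s A N r x) ∧ ∀ i ∈ P, GevreyAt s A N (ρ i) l := by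
    obtain ⟨A₁, N₁, hA₁, hN₁, h₁⟩ := hq
    obtain ⟨A₂, N₂, hA₂, hN₂, h₂⟩ := hr
    obtain ⟨A₃, N₃, hA₃, hN₃, h₃⟩ := hl
    refine ⟨1 + A₁ + A₂ + A₃, N₁ + N₂ + N₃, by positivity, by linarith, by linarith,
      fun i hi x hx => ?_, fun i hi x hx => ?_, fun i hi => ?_⟩
    · exact (h₁ i hi x hx).mono (by linarith) (by linarith) (by linarith)
    · exact (h₂ i hi x hx).mono (by linarith) (by linarith) (by linarith)
    · exact (h₃ i hi l rfl).mono (by linarith) (by linarith) (by linarith)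
  -- The equation is nonlinear, so derivatives of order at least one are bounded with a small
  -- constant ε. Terms with derivatives on both factors contribute 8Aε² = cε, half of the available
  -- damping 2cε.
  set ε := c / (8 * A) with hε
  have hε0 : 0 < ε := by positivity
  set D := A + (B + 8 * ε) * (8 * A * (B + ε)) with hD
  have hD0 : 0 < D := by positivity
  -- D collects the terms that carry a factor N / M. The summand D/(cε) makes them at most the other
  -- half cε, and A/ε makes the derivatives of the initial data at `l` at most ε in the new rate.
  set M := N * (1 + D / (c * ε) + A / ε) with hM
  have hM0 : 0 < M := by positivity
  have hNM : N ≤ M := by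
    rw [hM]
    nlinarith [show 0 ≤ D / (c * ε) by positivity, show 0 ≤ A / ε by positivity]
  have hNMD : N / M * D ≤ c * ε := by
    rw [div_mul_eq_mul_div, div_le_iff₀ hM0, hM]
    have e : c * ε * (N * (1 + D / (c * ε) + A / ε)) =
      N * D + c * ε * N + c * A * N := by field_simp; ring
    rw [e]
    have : 0 ≤ c * ε * N + c * A * N := by positivity
    linarith
  have hNMA : A * (N / M) ≤ ε := by
    rw [← mul_div_assoc, div_le_iff₀ hM0, hM]
    have e : ε * (N * (1 + D / (c * ε) + A / ε)) = A * N + ε * N + D * N / c := by field_simp; ring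
    rw [e]
    have : 0 ≤ ε * N + D * N / c := by positivity
    linarith
  set δ := 8 * (A * (N / M)) * (B + ε) with hδ
  have hδ0 : 0 ≤ δ := by positivity
  suffices h : ∀ i ∈ P, ∀ m, 1 ≤ m → ∀ x ∈ Icc l l',
      ‖iteratedDeriv m (ρ i) x‖ ≤ ε * M ^ m * gevreyWeight s m by
    refine ⟨B + ε, M, by positivity, hN.trans hNM, fun i hi x hx => ⟨hρs i hi x hx, fun m => ?_⟩⟩
    have hw := gevreyWeight_pos s m
    rcases Nat.eq_zero_or_pos m with rfl | hm
    · simp only [iteratedDeriv_zero, pow_zero, gevreyWeight_zero, mul_one]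
      linarith [hρB i hi x hx]
    · refine (h i hi m hm x hx).trans ?_
      gcongr
      linarith
  intro i hi m
  have hki := hk i hi
  induction m using Nat.strong_induction_on with
  | _ m ih =>
    intro hm
    have hw := gevreyWeight_pos s m
    set ρd : ℝ → ℕ → ℂ := fun x j => iteratedDeriv j (ρ i) x with hρd
    set rd : ℝ → ℕ → ℂ := fun x j => iteratedDeriv j r x with hrd
    set wd : ℝ → ℕ → ℂ := fun x j => binomConv (rd x) (ρd x) j with hwd
    have hdrop : ∀ x ∈ Icc l l', ∀ j ≤ m, 1 ≤ j →
        ‖binomConv (dropZero (rd x)) (ρd x) j‖ ≤ δ * M ^ j * gevreyWeight s j := by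
      intro x hx j hj hj1
      have := norm_binomConv_dropZero_le hs (m := j) (a := rd x) (b := ρd x) (A := A) (B := B + ε)
        (N := N) (M := M) hA.le (by positivity) (by linarith) hM0 hNM
        (fun n _ _ => (hr' i hi x hx).bound n) (fun n hn => by
          have hwn := gevreyWeight_pos s n
          rcases Nat.eq_zero_or_pos n with rfl | hn0
          · simp only [hρd, iteratedDeriv_zero, pow_zero, gevreyWeight_zero, mul_one]
            linarith [hρB i hi x hx]
          · refine (ih n (by omega) hn0 x hx).trans ?_
            gcongr
            linarith)
      exact this
    have hwb : ∀ x ∈ Icc l l', ∀ j < m, 1 ≤ j →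
        ‖wd x j‖ ≤ (A * ε + δ) * M ^ j * gevreyWeight s j := by
      intro x hx j hj hj1
      have hwj := gevreyWeight_pos s j
      simp only [hwd]
      rw [binomConv_eq_add_dropZero]
      refine (norm_add_le _ _).trans ?_
      have h1 : ‖rd x 0 * ρd x j‖ ≤ A * (ε * M ^ j * gevreyWeight s j) := by
        rw [norm_mul]
        have h0 : ‖rd x 0‖ ≤ A := by simpa [hrd] using (hr' i hi x hx).norm_le
        gcongr
        exact ih j hj hj1 x hx
      have h2 := hdrop x hx j hj.le hj1
      calc _ ≤ A * (ε * M ^ j * gevreyWeight s j) + δ * M ^ j * gevreyWeight s j := add_le_add h1 h2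
        _ = _ := by ring
    set R : ℝ → ℂ := fun x => k i * (iteratedDeriv m q x
      - ρ i x * binomConv (dropZero (rd x)) (ρd x) m
      - binomConv (dropZero fun j => if j < m then wd x j else 0) (dropZero fun j => if j < m then ρd x j else 0) m) with hR
    -- In the m-th derivative of (rρ)ρ the top derivative of ρ appears twice, which gives the
    -- linearized damping 2k rρ.
    have hder : ∀ x ∈ Icc l l', HasDerivAt (iteratedDeriv m (ρ i))
        (-((2 * k i : ℝ) * (r x * ρ i x)) * iteratedDeriv m (ρ i) x + R x) x := by
      intro x hx
      refine (hasDerivAt_iteratedDeriv (hρs i hi x hx) m).congr_deriv ?_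
      have hev : _root_.deriv (ρ i) =ᶠ[𝓝 x] fun x' => (k i : ℂ) * (q x' - (r x' * ρ i x') * ρ i x') := by
        filter_upwards [hρ i hi x hx] with x' hx'
        rw [hx'.deriv]; ring
      have hr0 : ContDiffAt ℝ m r x := (hr' i hi x hx).contDiffAt m
      have hq0 : ContDiffAt ℝ m q x := (hq' i hi x hx).contDiffAt m
      have hρ0 : ContDiffAt ℝ m (ρ i) x := (hρs i hi x hx).of_le (by exact_mod_cast le_top)
      have hwe : ∀ j ≤ m, iteratedDeriv j (fun x' => r x' * ρ i x') x = wd x j := by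
        intro j hj
        exact iteratedDeriv_fun_mul (hr0.of_le (by exact_mod_cast hj))
          (hρ0.of_le (by exact_mod_cast hj))
      rw [iteratedDeriv_succ', hev.iteratedDeriv_eq, iteratedDeriv_const_mul_field,
        iteratedDeriv_fun_sub hq0 ((hr0.mul hρ0).mul hρ0),
        iteratedDeriv_fun_mul (hr0.mul hρ0) hρ0]
      have hsum : ∑ j ∈ Finset.range (m + 1), (m.choose j : ℂ) *
          iteratedDeriv j (fun x' => r x' * ρ i x') x * iteratedDeriv (m - j) (ρ i) x =
          binomConv (wd x) (ρd x) m := by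
        unfold binomConv
        apply Finset.sum_congr rfl
        intro j hj
        rw [hwe j (Nat.lt_succ_iff.mp (Finset.mem_range.mp hj))]
      -- With the two extreme terms split off, every remaining product has between 1 and m - 1
      -- derivatives on each factor, where the induction hypothesis applies.
      have hsplit : binomConv (wd x) (ρd x) m = wd x 0 * ρd x m + ρd x 0 * wd x m +
          binomConv (dropZero fun j => if j < m then wd x j else 0)
            (dropZero fun j => if j < m then ρd x j else 0) m := by
        obtain ⟨n, rfl⟩ : ∃ n, m = n + 1 := ⟨m - 1, by omega⟩
        unfold binomConv
        rw [Finset.sum_range_succ', Finset.sum_range_succ, Finset.sum_range_succ',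
          Finset.sum_range_succ _ n]
        have : ∀ j ∈ Finset.range n, ((n + 1).choose (j + 1) : ℂ) * wd x (j + 1) *
            ρd x (n + 1 - (j + 1)) = ((n + 1).choose (j + 1) : ℂ) *
            dropZero (fun j => if j < n + 1 then wd x j else 0) (j + 1) *
            dropZero (fun j => if j < n + 1 then ρd x j else 0) (n + 1 - (j + 1)) := by
          intro j hj
          have hj := Finset.mem_range.mp hj
          have e1 : n + 1 - (j + 1) = n - j := by omega
          have e2 : n - j ≠ 0 := by omega
          have e3 : n - j < n + 1 := by omega
          simp [dropZero, e1, e2, e3, hj]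
        rw [Finset.sum_congr rfl this]
        simp [dropZero]
        ring
      have hwm : wd x m = rd x 0 * ρd x m + binomConv (dropZero (rd x)) (ρd x) m :=
        binomConv_eq_add_dropZero _ _ _
      have hw0 : wd x 0 = r x * ρ i x := by simp [hwd, binomConv, hrd, hρd]
      rw [hsum, hsplit, hwm, hw0, hR]
      simp only [hrd, hρd, iteratedDeriv_zero]
      push_cast
      ring
    have hRb : ∀ x ∈ Icc l l', ‖R x‖ ≤ 2 * k i * c * (ε * M ^ m * gevreyWeight s m) := by
      intro x hx
      have h1 : ‖iteratedDeriv m q x‖ ≤ (A * (N / M)) * M ^ m * gevreyWeight s m := by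
        have := norm_dropZero_le (s := s) (a := fun j => iteratedDeriv j q x) (A := A) (N := N)
          (M := M) (m := m) hA.le (by linarith) hM0 hNM (fun j _ _ => (hq' i hi x hx).bound j) m le_rfl
        rwa [dropZero, if_neg (by omega)] at this
      have h2 : ‖ρ i x * binomConv (dropZero (rd x)) (ρd x) m‖ ≤
          B * (δ * M ^ m * gevreyWeight s m) := by
        rw [norm_mul]
        gcongr
        · exact hρB i hi x hx
        · exact hdrop x hx m le_rfl hm
      have h3 : ‖binomConv (dropZero fun j => if j < m then wd x j else 0)
            (dropZero fun j => if j < m then ρd x j else 0) m‖ ≤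
          8 * (A * ε + δ) * ε * M ^ m * gevreyWeight s m := by
        refine norm_binomConv_le hs (by positivity) hM0.le (fun j hj => ?_) (fun j hj => ?_)
        · have hwj := gevreyWeight_pos s j
          by_cases hj0 : j = 0
          · rw [dropZero, if_pos hj0, norm_zero]; positivity
          by_cases hjm : j < m
          · simp only [dropZero, hj0, hjm, if_true, if_false]
            exact hwb x hx j hjm (by omega)
          · simp only [dropZero, hj0, hjm, if_false, norm_zero]; positivity
        · have hwj := gevreyWeight_pos s j
          by_cases hj0 : j = 0
          · rw [dropZero, if_pos hj0, norm_zero]; positivity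
          by_cases hjm : j < m
          · simp only [dropZero, hj0, hjm, if_true, if_false]
            exact ih j hjm (by omega) x hx
          · simp only [dropZero, hj0, hjm, if_false, norm_zero]; positivity
      have h4 : A * (N / M) + B * δ + 8 * (A * ε + δ) * ε ≤ 2 * c * ε := by
        have e1 : 8 * (A * ε) * ε = c * ε := by rw [hε]; field_simp
        have e2 : A * (N / M) + B * δ + 8 * δ * ε = N / M * D := by rw [hδ, hD]; ring
        nlinarith
      rw [hR]
      simp only
      rw [norm_mul, Complex.norm_real, Real.norm_of_nonneg hki.le]
      calc _ ≤ k i * ((A * (N / M)) * M ^ m * gevreyWeight s m + B * (δ * M ^ m * gevreyWeight s m)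
            + 8 * (A * ε + δ) * ε * M ^ m * gevreyWeight s m) := by
            gcongr
            exact (norm_sub_le _ _).trans
              (add_le_add ((norm_sub_le _ _).trans (add_le_add h1 h2)) h3)
        _ = k i * (A * (N / M) + B * δ + 8 * (A * ε + δ) * ε) * (M ^ m * gevreyWeight s m) := by ring
        _ ≤ k i * (2 * c * ε) * (M ^ m * gevreyWeight s m) := by gcongr
        _ = _ := by ring
    refine norm_le_of_damped (c := 2 * k i * c) (by positivity)
      (fun x hx => (hder x hx).continuousAt.continuousWithinAt)
      (fun x hx => (hder x (Ico_subset_Icc_self hx)).hasDerivWithinAt)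
      (fun x hx => ?_)
      (fun x hx => hRb x (Ico_subset_Icc_self hx)) ?_ le_rfl
    · rw [Complex.re_ofReal_mul]
      have := hρc i hi x (Ico_subset_Icc_self hx)
      gcongr
    · have := norm_dropZero_le (s := s) (a := fun j => iteratedDeriv j (ρ i) l) (A := A) (N := N)
          (M := M) (m := m) hA.le (by linarith) hM0 hNM (fun j _ _ => (hl' i hi).bound j) m le_rfl
      rw [dropZero, if_neg (by omega)] at this
      refine this.trans ?_
      gcongr

/-! ### Exponentials and hyperbolic profiles -/

lemma iteratedDeriv_exp_neg_mul (τ : ℝ) (m : ℕ) :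
    iteratedDeriv m (fun x : ℝ => (Real.exp (-(τ * x)) : ℂ)) =
      fun x => (-τ : ℂ) ^ m * (Real.exp (-(τ * x)) : ℂ) := by
  induction m with
  | zero => simp
  | succ m ih =>
    rw [iteratedDeriv_succ, ih]
    funext x
    have h : HasDerivAt (fun x : ℝ => Real.exp (-(τ * x))) (Real.exp (-(τ * x)) * (-(τ * 1))) x :=
      (((hasDerivAt_id x).const_mul τ).neg).exp
    rw [(h.ofReal_comp.const_mul _).deriv]
    push_cast
    ring

/-- From (τd)^m / m! ≤ e^{τd}. The powers of τ produced by differentiating e^{-τx} are paid for by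
giving up a distance d in the exponent. -/
lemma pow_mul_exp_neg_le {τ d : ℝ} (hτ : 0 ≤ τ) (hd : 0 < d) (m : ℕ) :
    τ ^ m * Real.exp (-(τ * d)) ≤ m.factorial * (1 / d) ^ m := by
  have h := Real.pow_div_factorial_le_exp (τ * d) (by positivity) m
  rw [div_le_iff₀ (by positivity)] at h
  rw [Real.exp_neg, one_div, inv_pow, ← div_eq_mul_inv, ← div_eq_mul_inv,
    div_le_div_iff₀ (Real.exp_pos _) (by positivity)]
  rw [← mul_pow]
  linarith

lemma UniformGevrey.exp_neg {ι : Type*} {s : ℝ} (hs : 0 < s ∧ s < 1) {P : Set ι} {τ : ι → ℝ}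
    (hτ : ∀ i ∈ P, 0 ≤ τ i) (a : ℝ) {d : ℝ} (hd : 0 < d) :
    UniformGevrey s P (Ici (a + d)) (fun i => Real.exp (-(τ i * a)))
      (fun i x => (Real.exp (-(τ i * x)) : ℂ)) := by
  refine ⟨1, 1 + 4 / d, one_pos, by linarith [show 0 < 4 / d by positivity],
    fun i hi x hx => ⟨?_, fun m => ?_⟩⟩
  · have : ContDiff ℝ (⊤ : ℕ∞) (fun x : ℝ => Real.exp (-(τ i * x))) := by fun_prop
    exact (Complex.ofRealCLM.contDiff.comp this).contDiffAt
  · rw [iteratedDeriv_exp_neg_mul]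
    simp only
    have hτi := hτ i hi
    have hx' : a + d ≤ x := hx
    rw [norm_mul, norm_pow, norm_neg, Complex.norm_real, Complex.norm_real,
      Real.norm_of_nonneg hτi, Real.norm_of_nonneg (Real.exp_pos _).le]
    have h1 : Real.exp (-(τ i * x)) ≤ Real.exp (-(τ i * a)) * Real.exp (-(τ i * d)) := by
      rw [← Real.exp_add]
      apply Real.exp_le_exp.mpr
      nlinarith
    have hw := gevreyWeight_pos s m
    calc _ ≤ τ i ^ m * (Real.exp (-(τ i * a)) * Real.exp (-(τ i * d))) := by gcongr
      _ = Real.exp (-(τ i * a)) * (τ i ^ m * Real.exp (-(τ i * d))) := by ring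
      _ ≤ Real.exp (-(τ i * a)) * (m.factorial * (1 / d) ^ m) := by
        exact mul_le_mul_of_nonneg_left (pow_mul_exp_neg_le hτi hd m) (Real.exp_pos _).le
      _ ≤ Real.exp (-(τ i * a)) * ((4 ^ m * gevreyWeight s m) * (1 / d) ^ m) := by
        gcongr; exact factorial_le_gevreyWeight hs m
      _ = 1 * Real.exp (-(τ i * a)) * (4 / d) ^ m * gevreyWeight s m := by
        rw [div_pow, div_pow, one_pow]; ring
      _ ≤ _ := by
        gcongr
        linarith

lemma UniformGevrey.id {ι : Type*} {s : ℝ} (hs : 0 < s ∧ s < 1) {P : Set ι} (D : ℝ) :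
    UniformGevrey s P (Icc (-D) D) (fun _ => 1) (fun _ x => (x : ℂ)) := by
  refine ⟨|D| + 4 * 1, 1, by positivity, le_rfl, fun i _ x hx => ?_⟩
  rw [mul_one]
  refine GevreyAt.of_deriv hs le_rfl Complex.ofRealCLM.contDiff.contDiffAt ?_ fun m => ?_
  · rw [Complex.norm_real, Real.norm_eq_abs]
    exact (abs_le.mpr hx).trans (le_abs_self D)
  · have : _root_.deriv (fun x : ℝ => (x : ℂ)) = fun _ => 1 := by
      funext x
      exact (hasDerivAt_id x).ofReal_comp.deriv
    rw [this]
    exact (GevreyAt.const (x := x) (s := s) (M := 1) (1 : ℂ) (by simp) zero_le_one).bound m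

/-- The solution `sinh (τ x)` (or `x` if `τ = 0`) of `y'' = τ² y`, `y 0 = 0`. -/
noncomputable def hypProfile (τ x : ℝ) : ℝ := if τ = 0 then x else Real.sinh (τ * x)

/-- The derivative of `hypProfile τ`. -/
noncomputable def hypProfileDeriv (τ x : ℝ) : ℝ := if τ = 0 then 1 else τ * Real.cosh (τ * x)

lemma hasDerivAt_hypProfile (τ x : ℝ) : HasDerivAt (hypProfile τ) (hypProfileDeriv τ x) x := by
  unfold hypProfile hypProfileDeriv
  split_ifs with h
  · exact hasDerivAt_id x
  · refine (((hasDerivAt_id x).const_mul τ).sinh).congr_deriv ?_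
    simp; ring

lemma hasDerivAt_hypProfileDeriv (τ x : ℝ) :
    HasDerivAt (hypProfileDeriv τ) (τ ^ 2 * hypProfile τ x) x := by
  unfold hypProfile hypProfileDeriv
  split_ifs with h
  · rw [h]; simpa using hasDerivAt_const x (1 : ℝ)
  · refine ((((hasDerivAt_id x).const_mul τ).cosh).const_mul τ).congr_deriv ?_
    simp; ring

lemma hypProfile_zero (τ : ℝ) : hypProfile τ 0 = 0 := by
  unfold hypProfile; split_ifs <;> simp

lemma hypProfile_pos {τ x : ℝ} (hτ : 0 ≤ τ) (hx : 0 < x) : 0 < hypProfile τ x := by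
  unfold hypProfile
  split_ifs with h
  · exact hx
  · exact Real.sinh_pos_iff.mpr (mul_pos (lt_of_le_of_ne hτ (Ne.symm h)) hx)

lemma hypProfileDeriv_pos {τ : ℝ} (x : ℝ) (hτ : 0 ≤ τ) : 0 < hypProfileDeriv τ x := by
  unfold hypProfileDeriv
  split_ifs with h
  · exact one_pos
  · exact mul_pos (lt_of_le_of_ne hτ (Ne.symm h)) (Real.cosh_pos _)

lemma contDiff_hypProfile (τ : ℝ) : ContDiff ℝ (⊤ : ℕ∞) (hypProfile τ) := by
  unfold hypProfile
  split_ifs with h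
  · exact contDiff_id
  · fun_prop

lemma hypProfile_eq_exp {τ x : ℝ} (hτ : τ ≠ 0) :
    hypProfile τ x = (Real.exp (τ * x) - Real.exp (-(τ * x))) / 2 := by
  rw [hypProfile, if_neg hτ, Real.sinh_eq]

lemma one_sub_exp_pos {τ x : ℝ} (hτ : 0 < τ) (hx : 0 < x) : 0 < 1 - Real.exp (-(2 * τ * x)) := by
  have : Real.exp (-(2 * τ * x)) < 1 := by
    rw [← Real.exp_zero]
    apply Real.exp_lt_exp.mpr
    have : 0 < 2 * τ * x := by positivity
    linarith
  linarith

/-- Isolates the exponential decay from a factor that stays bounded uniformly in τ once τ and x are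
bounded below. -/
lemma hypProfile_inv {τ x : ℝ} (hτ : 0 < τ) (hx : 0 < x) :
    (hypProfile τ x)⁻¹ = 2 * Real.exp (-(τ * x)) * (1 - Real.exp (-(2 * τ * x)))⁻¹ := by
  have h1 := one_sub_exp_pos hτ hx
  have h2 := hypProfile_pos hτ.le hx
  rw [← div_eq_mul_inv, eq_div_iff h1.ne', ← div_eq_inv_mul, div_eq_iff h2.ne',
    hypProfile_eq_exp hτ.ne']
  have e1 : Real.exp (-(2 * τ * x)) = Real.exp (-(τ * x)) * Real.exp (-(τ * x)) := by
    rw [← Real.exp_add]; ring_nf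
  have e2 : Real.exp (-(τ * x)) * Real.exp (τ * x) = 1 := by rw [← Real.exp_add]; simp
  rw [e1]
  linear_combination -e2

lemma hypProfile_logDeriv {τ x : ℝ} (hτ : 0 < τ) (hx : 0 < x) :
    hypProfileDeriv τ x / hypProfile τ x =
      τ * ((1 + Real.exp (-(2 * τ * x))) * (1 - Real.exp (-(2 * τ * x)))⁻¹) := by
  rw [div_eq_mul_inv, hypProfile_inv hτ hx, hypProfileDeriv, if_neg hτ.ne', Real.cosh_eq]
  have e1 : Real.exp (-(2 * τ * x)) = Real.exp (-(τ * x)) * Real.exp (-(τ * x)) := by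
    rw [← Real.exp_add]; ring_nf
  have e2 : Real.exp (-(τ * x)) * Real.exp (τ * x) = 1 := by rw [← Real.exp_add]; simp
  rw [e1]
  linear_combination τ * (1 - Real.exp (-(τ * x)) * Real.exp (-(τ * x)))⁻¹ * e2

section

variable {ι : Type*} {s τ₀ d : ℝ} {P : Set ι} {τ : ι → ℝ}

lemma uniformGevrey_inv_one_sub_exp (hs : 0 < s ∧ s < 1) (hτ₀ : 0 < τ₀) (hd : 0 < d)
    (hτ : ∀ i ∈ P, τ₀ ≤ τ i) :
    UniformGevrey s P (Ici d) (fun _ => 1)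
      (fun i x => ((1 - Real.exp (-(2 * τ i * x)) : ℝ) : ℂ)⁻¹) := by
  have hpos : ∀ i ∈ P, 0 ≤ 2 * τ i := fun i hi => by linarith [hτ i hi]
  have h1 : UniformGevrey s P (Ici d) (fun _ => 1)
      (fun i x => ((1 - Real.exp (-(2 * τ i * x)) : ℝ) : ℂ)) := by
    have := UniformGevrey.exp_neg hs hpos 0 hd
    simp only [mul_zero, neg_zero, Real.exp_zero, zero_add] at this
    have h2 := (UniformGevrey.const (s := s) (P := P) (I := Ici d) (w := fun _ => 1)
      (fun _ => (1 : ℂ)) (by simp)).sub this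
    simpa only [Complex.ofReal_sub, Complex.ofReal_one] using h2
  have := h1.inv hs (c := 1 - Real.exp (-(2 * τ₀ * d))) (by simp) (one_sub_exp_pos hτ₀ hd)
    (fun i hi x hx => by
      have hx' : d ≤ x := hx
      have hi' := hτ i hi
      rw [Complex.norm_real, mul_one]
      refine le_trans ?_ (le_abs_self _)
      have : Real.exp (-(2 * τ i * x)) ≤ Real.exp (-(2 * τ₀ * d)) := by
        apply Real.exp_le_exp.mpr
        have : τ₀ * d ≤ τ i * x := by gcongr; linarith
        linarith
      linarith)
  simpa using this

/-- On |x| ≤ 3d the profile has size at most of order e^{3dτ}; the fourth d pays for derivatives.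
The alternative τ = 0 or τ ≥ τ₀ reflects integer frequencies: the zero mode is linear, the others
have a spectral gap. -/
lemma uniformGevrey_hypProfile (hs : 0 < s ∧ s < 1) (hτ₀ : 0 < τ₀) (hd : 0 < d)
    (hτ : ∀ i ∈ P, τ i = 0 ∨ τ₀ ≤ τ i) :
    UniformGevrey s P (Icc (-(3 * d)) (3 * d)) (fun i => Real.exp (4 * d * τ i))
      (fun i x => (hypProfile (τ i) x : ℂ)) := by
  have h0 : UniformGevrey s (P ∩ {i | τ i = 0}) (Icc (-(3 * d)) (3 * d))
      (fun i => Real.exp (4 * d * τ i)) (fun i x => (hypProfile (τ i) x : ℂ)) := by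
    refine ((UniformGevrey.id hs (3 * d)).mono_weight 1 one_pos ?_).congr ?_
    · intro i hi
      have : τ i = 0 := hi.2
      simp [this]
    · intro i hi x hx
      have : τ i = 0 := hi.2
      exact Filter.Eventually.of_forall fun y => by simp [hypProfile, this]
  have h1 : UniformGevrey s (P ∩ {i | τ₀ ≤ τ i}) (Icc (-(3 * d)) (3 * d))
      (fun i => Real.exp (4 * d * τ i)) (fun i x => (hypProfile (τ i) x : ℂ)) := by
    have hpos : ∀ i ∈ P ∩ {i | τ₀ ≤ τ i}, 0 ≤ τ i := fun i hi => hτ₀.le.trans hi.2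
    have hE := UniformGevrey.exp_neg hs hpos (-(4 * d)) hd
    have hE1 := hE.mono_set (J := Icc (-(3 * d)) (3 * d)) le_rfl
      (fun x hx => by simp only [mem_Ici]; linarith [hx.1])
    have hE2 := (hE.comp_const_sub 0).mono_set (J := Icc (-(3 * d)) (3 * d)) le_rfl
      (fun x hx => by simp only [mem_ofPred_eq, mem_Ici]; linarith [hx.2])
    refine (((hE2.sub hE1).const_mul fun _ => (1 / 2 : ℂ)).mono_weight 1 one_pos ?_).congr ?_
    · intro i hi
      have : Real.exp (-(τ i * -(4 * d))) = Real.exp (4 * d * τ i) := by ring_nf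
      rw [this]
      simp only [norm_div, norm_one, Complex.norm_ofNat]
      linarith [Real.exp_pos (4 * d * τ i)]
    · intro i hi x hx
      have : τ i ≠ 0 := (hτ₀.trans_le hi.2).ne'
      refine Filter.Eventually.of_forall fun y => ?_
      simp only [hypProfile_eq_exp this, zero_sub, mul_neg, neg_neg]
      push_cast
      ring
  refine (h0.union_index h1 fun i _ => (Real.exp_pos _).le).mono_set ?_ le_rfl
  intro i hi
  rcases hτ i hi with h | h
  · exact Or.inl ⟨hi, h⟩
  · exact Or.inr ⟨hi, h⟩

lemma uniformGevrey_id_inv (hs : 0 < s ∧ s < 1) (hd : 0 < d) :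
    UniformGevrey s P (Icc d (8 * d)) (fun _ => 1) (fun _ x => ((x : ℂ))⁻¹) := by
  have := ((UniformGevrey.id (P := P) hs (8 * d)).mono_set (J := Icc d (8 * d)) le_rfl
    (Icc_subset_Icc_left (by linarith))).inv hs (c := d) (by simp) hd (fun i _ x hx => by
      rw [Complex.norm_real, mul_one]
      exact hx.1.trans (le_abs_self x))
  simpa using this

/-- At distance 7d the reciprocal decays like e^{-7dτ}, and one d pays for derivatives. The
remaining e^{-6dτ} beats the growth e^{4dτ} of `uniformGevrey_hypProfile`. -/
lemma uniformGevrey_hypProfile_inv (hs : 0 < s ∧ s < 1) (hτ₀ : 0 < τ₀) (hd : 0 < d)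
    (hτ : ∀ i ∈ P, τ i = 0 ∨ τ₀ ≤ τ i) :
    UniformGevrey s P {7 * d} (fun i => Real.exp (-(6 * d * τ i)))
      (fun i x => ((hypProfile (τ i) x : ℂ))⁻¹) := by
  have h0 : UniformGevrey s (P ∩ {i | τ i = 0}) {7 * d}
      (fun i => Real.exp (-(6 * d * τ i))) (fun i x => ((hypProfile (τ i) x : ℂ))⁻¹) := by
    refine (((uniformGevrey_id_inv hs hd).mono_weight 1 one_pos ?_).mono_set le_rfl ?_).congr ?_
    · intro i hi
      have : τ i = 0 := hi.2
      simp [this]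
    · intro x hx
      rw [hx]
      constructor <;> linarith
    · intro i hi x hx
      have : τ i = 0 := hi.2
      exact Filter.Eventually.of_forall fun y => by simp [hypProfile, this]
  have h1 : UniformGevrey s (P ∩ {i | τ₀ ≤ τ i}) {7 * d}
      (fun i => Real.exp (-(6 * d * τ i))) (fun i x => ((hypProfile (τ i) x : ℂ))⁻¹) := by
    have hpos : ∀ i ∈ P ∩ {i | τ₀ ≤ τ i}, 0 ≤ τ i := fun i hi => hτ₀.le.trans hi.2
    have hE := (UniformGevrey.exp_neg hs hpos (6 * d) hd).mono_set (J := {7 * d}) le_rfl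
      (fun x hx => by rw [hx]; simp only [mem_Ici]; linarith)
    have hI := (uniformGevrey_inv_one_sub_exp (P := P ∩ {i | τ₀ ≤ τ i}) hs hτ₀ hd
      fun i hi => hi.2).mono_set (J := {7 * d}) le_rfl
      (fun x hx => by rw [hx]; simp only [mem_Ici]; linarith)
    refine (((hE.mul hs hI).const_mul fun _ => (2 : ℂ)).mono_weight 2 two_pos ?_).congr ?_
    · intro i hi
      simp only [Complex.norm_ofNat, mul_one]
      rw [show τ i * (6 * d) = 6 * d * τ i by ring]
    · intro i hi x hx
      have hx' : 0 < x := by rw [hx]; positivity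
      filter_upwards [lt_mem_nhds hx'] with y hy
      rw [← Complex.ofReal_inv, hypProfile_inv (hτ₀.trans_le hi.2) hy]
      push_cast
      ring
  refine (h0.union_index h1 fun i _ => (Real.exp_pos _).le).mono_set ?_ le_rfl
  intro i hi
  rcases hτ i hi with h | h
  · exact Or.inl ⟨hi, h⟩
  · exact Or.inr ⟨hi, h⟩

lemma uniformGevrey_hypProfile_logDeriv (hs : 0 < s ∧ s < 1) (hτ₀ : 0 < τ₀) (hd : 0 < d)
    (hτ : ∀ i ∈ P, τ i = 0 ∨ τ₀ ≤ τ i) :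
    UniformGevrey s P (Icc d (8 * d)) (fun i => 1 + τ i)
      (fun i x => ((hypProfileDeriv (τ i) x / hypProfile (τ i) x : ℝ) : ℂ)) := by
  have h0 : UniformGevrey s (P ∩ {i | τ i = 0}) (Icc d (8 * d)) (fun i => 1 + τ i)
      (fun i x => ((hypProfileDeriv (τ i) x / hypProfile (τ i) x : ℝ) : ℂ)) := by
    refine ((uniformGevrey_id_inv hs hd).mono_weight 1 one_pos ?_).congr ?_
    · intro i hi
      have : τ i = 0 := hi.2
      simp [this]
    · intro i hi x hx
      have : τ i = 0 := hi.2
      exact Filter.Eventually.of_forall fun y => by simp [hypProfile, hypProfileDeriv, this]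
  have h1 : UniformGevrey s (P ∩ {i | τ₀ ≤ τ i}) (Icc d (8 * d)) (fun i => 1 + τ i)
      (fun i x => ((hypProfileDeriv (τ i) x / hypProfile (τ i) x : ℝ) : ℂ)) := by
    have hpos : ∀ i ∈ P ∩ {i | τ₀ ≤ τ i}, 0 ≤ 2 * τ i := fun i hi => by
      have : τ₀ ≤ τ i := hi.2
      linarith
    have hE := UniformGevrey.exp_neg hs hpos 0 hd
    simp only [mul_zero, neg_zero, Real.exp_zero, zero_add] at hE
    have hE' := (UniformGevrey.const (s := s) (P := P ∩ {i | τ₀ ≤ τ i}) (I := Ici d)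
      (w := fun _ => 1) (fun _ => (1 : ℂ)) (by simp)).add hE
    have hI := uniformGevrey_inv_one_sub_exp (P := P ∩ {i | τ₀ ≤ τ i}) hs hτ₀ hd fun i hi => hi.2
    refine ((((hE'.mul hs hI).const_mul fun i => (τ i : ℂ)).mono_weight 1 one_pos ?_).mono_set
      le_rfl Icc_subset_Ici_self).congr ?_
    · intro i hi
      have : 0 ≤ τ i := hτ₀.le.trans hi.2
      rw [Complex.norm_real, Real.norm_of_nonneg this]
      linarith
    · intro i hi x hx
      have hx' : 0 < x := hd.trans_le hx.1
      filter_upwards [lt_mem_nhds hx'] with y hy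
      rw [hypProfile_logDeriv (hτ₀.trans_le hi.2) hy]
      push_cast
      ring
  refine (h0.union_index h1 fun i hi => ?_).mono_set ?_ le_rfl
  · rcases hi with ⟨_, hi⟩ | ⟨_, hi⟩
    · have : τ i = 0 := hi
      linarith
    · have : τ₀ ≤ τ i := hi
      linarith
  · intro i hi
    rcases hτ i hi with h | h
    · exact Or.inl ⟨hi, h⟩
    · exact Or.inr ⟨hi, h⟩

lemma exists_le_hypProfile_logDeriv (hτ₀ : 0 < τ₀) (hd : 0 < d) :
    ∃ c > 0, ∀ τ, (τ = 0 ∨ τ₀ ≤ τ) → ∀ x ∈ Icc d (8 * d),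
      c * (1 + τ) ≤ hypProfileDeriv τ x / hypProfile τ x := by
  refine ⟨min (1 / (8 * d)) (τ₀ / (1 + τ₀)), by positivity, fun τ hτ x hx => ?_⟩
  have hx0 : 0 < x := hd.trans_le hx.1
  rcases hτ with rfl | hτ
  · simp only [hypProfileDeriv, hypProfile, if_true, add_zero, mul_one]
    exact (min_le_left _ _).trans (one_div_le_one_div_of_le hx0 hx.2)
  · have hτ0 : 0 < τ := hτ₀.trans_le hτ
    have h1 : min (1 / (8 * d)) (τ₀ / (1 + τ₀)) * (1 + τ) ≤ τ := by
      calc _ ≤ τ₀ / (1 + τ₀) * (1 + τ) := by gcongr; exact min_le_right _ _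
        _ ≤ τ := by
          rw [div_mul_eq_mul_div, div_le_iff₀ (by positivity)]
          nlinarith
    refine h1.trans ?_
    rw [le_div_iff₀ (hypProfile_pos hτ0.le hx0), hypProfile, if_neg hτ0.ne', hypProfileDeriv,
      if_neg hτ0.ne']
    gcongr
    exact (Real.sinh_lt_cosh _).le

end

/-! ### The Riccati equation -/

/-- Truncating ρ to [lo, hi] makes the vector field bounded and Lipschitz, so a solution exists on
the whole interval. The strict inequalities make lo and hi barriers, so the truncation is never
active. -/
lemma exists_riccati {t₀ t₁ k lo hi ρ₀ : ℝ} {q r : ℝ → ℝ} (ht : t₀ ≤ t₁) (hk : 0 < k)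
    (hlo : 0 < lo) (hq : Continuous q) (hr : Continuous r)
    (hqlo : ∀ t, r t * lo ^ 2 < q t) (hqhi : ∀ t, q t < r t * hi ^ 2) (hρ₀ : ρ₀ ∈ Icc lo hi) :
    ∃ ρ : ℝ → ℝ, ρ t₀ = ρ₀ ∧
      (∀ t ∈ Icc t₀ t₁, HasDerivWithinAt ρ (k * (q t - r t * ρ t ^ 2)) (Icc t₀ t₁) t) ∧
      ∀ t ∈ Icc t₀ t₁, ρ t ∈ Icc lo hi := by
  have hlohi : lo ≤ hi := hρ₀.1.trans hρ₀.2
  set cl : ℝ → ℝ := fun x => max lo (min hi x) with hcl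
  have hclm : ∀ x, cl x ∈ Icc lo hi := fun x => ⟨le_max_left _ _, max_le hlohi (min_le_left _ _)⟩
  have hcl_lip : ∀ x y, |cl x - cl y| ≤ |x - y| := by
    intro x y
    have h1 := abs_max_sub_max_le_max lo (min hi x) lo (min hi y)
    have h2 := abs_min_sub_min_le_max hi x hi y
    simp only [sub_self, abs_zero] at h1 h2
    exact h1.trans (max_le (abs_nonneg _) (h2.trans (max_le (abs_nonneg _) le_rfl)))
  set F : ℝ → ℝ → ℝ := fun t x => k * (q t - r t * cl x ^ 2) with hF
  obtain ⟨Q, hQ⟩ := isCompact_Icc.exists_bound_of_continuousOn (s := Icc t₀ t₁) hq.continuousOn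
  obtain ⟨Rm, hRm⟩ := isCompact_Icc.exists_bound_of_continuousOn (s := Icc t₀ t₁) hr.continuousOn
  have hQ0 : 0 ≤ Q := (norm_nonneg _).trans (hQ t₀ (left_mem_Icc.mpr ht))
  have hRm0 : 0 ≤ Rm := (norm_nonneg _).trans (hRm t₀ (left_mem_Icc.mpr ht))
  have hhi : 0 < hi := hlo.trans_le hlohi
  have hPL : IsPicardLindelof F (tmin := t₀) (tmax := t₁) ⟨t₀, left_mem_Icc.mpr ht⟩ ρ₀
      (Real.toNNReal (k * (Q + Rm * hi ^ 2) * (t₁ - t₀))) 0 (Real.toNNReal (k * (Q + Rm * hi ^ 2)))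
      (Real.toNNReal (k * (Rm * (2 * hi)))) := by
    refine ⟨fun t ht' => ?_, fun x _ => ?_, fun t ht' x _ => ?_, ?_⟩
    · apply LipschitzWith.lipschitzOnWith
      apply LipschitzWith.of_dist_le_mul
      intro x y
      rw [Real.dist_eq, Real.dist_eq, Real.coe_toNNReal _ (by positivity)]
      have e : F t x - F t y = k * (r t * ((cl y + cl x) * (cl y - cl x))) := by
        simp only [hF]; ring
      have h1 := hclm x
      have h2 := hclm y
      have h3 : |r t| ≤ Rm := hRm t ht'
      rw [e, abs_mul, abs_mul, abs_mul, abs_of_pos hk,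
        abs_of_nonneg (show 0 ≤ cl y + cl x by linarith [h1.1, h2.1]), abs_sub_comm (cl y)]
      have h4 := hcl_lip x y
      have h5 : cl y + cl x ≤ 2 * hi := by linarith [h1.2, h2.2]
      have h6 : 0 ≤ cl y + cl x := by linarith [h1.1, h2.1]
      calc k * (|r t| * ((cl y + cl x) * |cl x - cl y|))
          ≤ k * (Rm * ((2 * hi) * |x - y|)) := by gcongr
        _ = _ := by ring
    · exact Continuous.continuousOn (by fun_prop)
    · rw [Real.coe_toNNReal _ (by positivity), Real.norm_eq_abs]
      have h1 := hclm x
      have h3 : |r t| ≤ Rm := hRm t ht'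
      have h4 : |q t| ≤ Q := hQ t ht'
      simp only [hF]
      rw [abs_mul, abs_of_pos hk]
      gcongr
      refine (abs_sub _ _).trans ?_
      rw [abs_mul, abs_of_nonneg (sq_nonneg (cl x))]
      have : 0 ≤ cl x := hlo.le.trans h1.1
      gcongr
      exact h1.2
    · have h0 : 0 ≤ t₁ - t₀ := by linarith
      rw [Real.coe_toNNReal _ (by positivity), Real.coe_toNNReal _ (by positivity)]
      simp [h0]
  obtain ⟨ρ, hρ0, hρ⟩ := hPL.exists_eq_forall_mem_Icc_hasDerivWithinAt₀
  have hcont : ContinuousOn ρ (Icc t₀ t₁) := fun t ht' => (hρ t ht').continuousWithinAt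
  have hρ' : ∀ t ∈ Ico t₀ t₁, HasDerivWithinAt ρ (F t (ρ t)) (Ici t) t := fun t ht' =>
    (hρ t (Ico_subset_Icc_self ht')).mono_of_mem_nhdsWithin (Icc_mem_nhdsGE_of_mem ht')
  have hup : ∀ t ∈ Icc t₀ t₁, ρ t ≤ hi := by
    intro t ht'
    refine image_le_of_deriv_right_lt_deriv_boundary (B := fun _ => hi) (B' := fun _ => 0) hcont hρ'
      (hρ0.le.trans hρ₀.2) (fun x => hasDerivAt_const _ _) (fun x _ hx => ?_) ht'
    have : cl (ρ x) = hi := by simp [hcl, hx, hlohi]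
    simp only [hF, this]
    exact mul_neg_of_pos_of_neg hk (by linarith [hqhi x])
  have hdown : ∀ t ∈ Icc t₀ t₁, lo ≤ ρ t := by
    intro t ht'
    have := image_le_of_deriv_right_lt_deriv_boundary (f := fun t => -ρ t) (B := fun _ => -lo)
      (B' := fun _ => 0) hcont.neg (fun x hx => (hρ' x hx).neg)
      (by simpa [hρ0] using hρ₀.1) (fun x => hasDerivAt_const _ _) (fun x _ hx => ?_) ht'
    · simpa using this
    · have hx : ρ x = lo := by simpa using hx
      have : cl (ρ x) = lo := by simp [hcl, hx, hlohi]
      simp only [hF, this]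
      have := mul_pos hk (show 0 < q x - r x * lo ^ 2 by linarith [hqlo x])
      linarith
  refine ⟨ρ, hρ0, fun t ht' => ?_, fun t ht' => ⟨hdown t ht', hup t ht'⟩⟩
  have : cl (ρ t) = ρ t := by simp [hcl, hdown t ht', hup t ht']
  have h := hρ t ht'
  simp only [hF, this] at h
  exact h

/-- The difference of two solutions satisfies (ρ - σ)' = -k r (ρ + σ)(ρ - σ), a damped linear
equation without source and with zero initial value. -/
lemma riccati_unique {t₀ t₁ k : ℝ} {q r ρ σ : ℝ → ℝ} {m : ℝ} (hm : 0 < m)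
    (hk : 0 < k) (hr : ∀ t, m ≤ r t) {lo : ℝ} (hlo : 0 < lo) (h0 : ρ t₀ = σ t₀)
    (hρ : ∀ t ∈ Icc t₀ t₁, HasDerivWithinAt ρ (k * (q t - r t * ρ t ^ 2)) (Icc t₀ t₁) t)
    (hσ : ∀ t ∈ Icc t₀ t₁, HasDerivWithinAt σ (k * (q t - r t * σ t ^ 2)) (Icc t₀ t₁) t)
    (hρlo : ∀ t ∈ Icc t₀ t₁, lo ≤ ρ t) (hσlo : ∀ t ∈ Icc t₀ t₁, 0 ≤ σ t) :
    ∀ t ∈ Icc t₀ t₁, ρ t = σ t := by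
  intro t ht
  have hd : ∀ t ∈ Icc t₀ t₁, HasDerivWithinAt (fun t => ((ρ t - σ t : ℝ) : ℂ))
      (-((k * r t * (ρ t + σ t) : ℝ) : ℂ) * ((ρ t - σ t : ℝ) : ℂ) + 0) (Icc t₀ t₁) t := by
    intro t ht
    refine ((hρ t ht).sub (hσ t ht)).ofReal_comp.congr_deriv ?_
    push_cast
    ring
  have := norm_le_of_damped (c := k * m * lo) (F := 0) (B := 0) (by positivity)
    (fun t ht => (hd t ht).continuousWithinAt)
    (fun t ht' => (hd t (Ico_subset_Icc_self ht')).mono_of_mem_nhdsWithin (Icc_mem_nhdsGE_of_mem ht'))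
    (fun t ht' => by
      have h1 := hρlo t (Ico_subset_Icc_self ht')
      have h2 := hσlo t (Ico_subset_Icc_self ht')
      have h3 := hr t
      rw [Complex.ofReal_re]
      have : 0 ≤ r t := hm.le.trans h3
      gcongr
      linarith)
    (fun t _ => by simp) (by simp [h0]) (by simp) t ht
  rw [Complex.norm_real, Real.norm_eq_abs] at this
  have := abs_nonpos_iff.mp this
  linarith

/-- Coefficients that are positive, Gevrey, and constant near and beyond the end points `α`, `β`. -/
structure GevreyCoeff (s α β d : ℝ) (p : ℝ → ℝ) : Prop where
  smooth : ContDiff ℝ (⊤ : ℕ∞) p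
  lower : ∃ c > 0, ∀ x, c ≤ p x
  gevrey : ∃ A M : ℝ, 0 < A ∧ 1 ≤ M ∧ ∀ x, GevreyAt s A M (fun x => (p x : ℂ)) x
  left : ∀ x ≤ α + 8 * d, p x = p α
  right : ∀ x, β - 8 * d ≤ x → p x = p β

namespace GevreyCoeff

variable {s α β d : ℝ} {p : ℝ → ℝ}

lemma pos (h : GevreyCoeff s α β d p) (x : ℝ) : 0 < p x := by
  obtain ⟨c, hc, h⟩ := h.lower
  exact hc.trans_le (h x)

lemma uniform {ι : Type*} (h : GevreyCoeff s α β d p) (P : Set ι) (I : Set ℝ) :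
    UniformGevrey s P I (fun _ => 1) (fun _ x => (p x : ℂ)) := by
  obtain ⟨A, M, hA, hM, h⟩ := h.gevrey
  exact ⟨A, M, hA, hM, fun _ _ x _ => by rw [mul_one]; exact h x⟩

lemma upper (h : GevreyCoeff s α β d p) : ∃ C > 0, ∀ x, p x ≤ C := by
  obtain ⟨A, M, hA, hM, h⟩ := h.gevrey
  refine ⟨A, hA, fun x => ?_⟩
  have := (h x).norm_le
  rw [Complex.norm_real] at this
  exact (le_abs_self _).trans this

lemma inv (hs : 0 < s ∧ s < 1) (h : GevreyCoeff s α β d p) :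
    GevreyCoeff s α β d (fun x => (p x)⁻¹) := by
  obtain ⟨c, hc, hl⟩ := h.lower
  obtain ⟨C, hC, hu⟩ := h.upper
  refine ⟨h.smooth.inv fun x => (h.pos x).ne', ⟨C⁻¹, by positivity, fun x =>
    inv_anti₀ (h.pos x) (hu x)⟩, ?_, fun x hx => by rw [h.left x hx], fun x hx => by rw [h.right x hx]⟩
  have := (h.uniform (univ : Set Unit) univ).inv hs (by simp) hc (fun _ _ x _ => by
    rw [mul_one, Complex.norm_real]
    exact (hl x).trans (le_abs_self _))
  obtain ⟨A, M, hA, hM, h⟩ := this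
  refine ⟨A, M, hA, hM, fun x => ?_⟩
  have := h () trivial x trivial
  simpa using this

lemma mul (hs : 0 < s ∧ s < 1) {q : ℝ → ℝ} (h : GevreyCoeff s α β d p) (h' : GevreyCoeff s α β d q) :
    GevreyCoeff s α β d (fun x => p x * q x) := by
  obtain ⟨c, hc, hl⟩ := h.lower
  obtain ⟨c', hc', hl'⟩ := h'.lower
  refine ⟨h.smooth.mul h'.smooth, ⟨c * c', by positivity, fun x =>
    mul_le_mul (hl x) (hl' x) hc'.le (h.pos x).le⟩, ?_, fun x hx => by rw [h.left x hx, h'.left x hx],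
    fun x hx => by rw [h.right x hx, h'.right x hx]⟩
  obtain ⟨A, M, hA, hM, h⟩ := (h.uniform (univ : Set Unit) univ).mul hs (h'.uniform (univ : Set Unit) univ)
  refine ⟨A, M, hA, hM, fun x => ?_⟩
  have := h () trivial x trivial
  simpa using this

end GevreyCoeff

lemma hasDerivAt_hypProfile_logDeriv {τ x : ℝ} (hτ : 0 ≤ τ) (hx : 0 < x) :
    HasDerivAt (fun x => hypProfileDeriv τ x / hypProfile τ x)
      (τ ^ 2 - (hypProfileDeriv τ x / hypProfile τ x) ^ 2) x := by
  have h0 := (hypProfile_pos hτ hx).ne'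
  refine ((hasDerivAt_hypProfileDeriv τ x).div (hasDerivAt_hypProfile τ x) h0).congr_deriv ?_
  field_simp

/-- For large frequency, the logarithmic derivative (divided by the frequency) of the solution that
vanishes at `α`, with uniform bounds. -/
lemma exists_riccati_high {s α β d : ℝ} (hs : 0 < s ∧ s < 1) (hd : 0 < d) (hαβ : α + 16 * d ≤ β)
    {p q : ℝ → ℝ} (hp : GevreyCoeff s α β d p) (hq : GevreyCoeff s α β d q) :
    ∃ (ρ : ℕ → ℝ → ℝ) (c : ℝ), 0 < c ∧
      (∀ k, 1 ≤ k → ∀ x ∈ Ioo (α + d) (β - d),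
        HasDerivAt (ρ k) (k * (q x - (p x)⁻¹ * ρ k x ^ 2)) x) ∧
      (∀ k, 1 ≤ k → ∀ x ∈ Ioo (α + d) (β - d), c ≤ ρ k x) ∧
      UniformGevrey s {k | 1 ≤ k} (Icc (α + 2 * d) (β - 2 * d)) (fun _ => 1)
        (fun k x => (ρ k x : ℂ)) ∧
      ∀ k : ℕ, 1 ≤ k → ∀ x ∈ Ioo (α + d) (α + 8 * d), ρ k x = (k : ℝ)⁻¹ * (p α *
        (hypProfileDeriv (k * √(q α / p α)) (x - α) / hypProfile (k * √(q α / p α)) (x - α))) := by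
  set ν := √(q α / p α) with hν
  have hp0 := hp.pos α
  have hq0 := hq.pos α
  have hν0 : 0 < ν := Real.sqrt_pos.mpr (div_pos hq0 hp0)
  have hν2 : p α * ν ^ 2 = q α := by
    rw [hν, Real.sq_sqrt (by positivity)]; field_simp
  have hτ : ∀ k ∈ {k : ℕ | 1 ≤ k}, (k : ℝ) * ν = 0 ∨ ν ≤ k * ν := by
    intro k hk
    right
    have : (1 : ℝ) ≤ k := by exact_mod_cast hk
    nlinarith
  set L : ℕ → ℝ → ℝ := fun k x => hypProfileDeriv (k * ν) x / hypProfile (k * ν) x with hL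
  have hLG := uniformGevrey_hypProfile_logDeriv (P := {k : ℕ | 1 ≤ k}) hs hν0 hd hτ
  obtain ⟨c₁, hc₁, hLlo⟩ := exists_le_hypProfile_logDeriv hν0 hd
  obtain ⟨C₁, hC₁, hLhi⟩ : ∃ C > 0, ∀ k : ℕ, 1 ≤ k → ∀ x ∈ Icc d (8 * d),
      L k x ≤ C * (1 + k * ν) := by
    obtain ⟨A, M, hA, hM, h⟩ := hLG
    refine ⟨A, hA, fun k hk x hx => ?_⟩
    have := (h k hk x hx).norm_le
    rw [Complex.norm_real] at this
    exact (le_abs_self _).trans this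
  obtain ⟨m₁, hm₁, hpm⟩ := hp.lower
  obtain ⟨m₂, hm₂, hqm⟩ := hq.lower
  obtain ⟨M₁, hM₁, hpM⟩ := hp.upper
  obtain ⟨M₂, hM₂, hqM⟩ := hq.upper
  -- The exact solution of the rescaled Riccati equation where the coefficients are constant.
  -- Starting from it at α + d avoids the singularity at α.
  set σ : ℕ → ℝ → ℝ := fun k x => (k : ℝ)⁻¹ * (p α * L k (x - α)) with hσ
  -- The barriers must satisfy lo² < pq < hi² everywhere and also enclose the explicit solution σ
  -- near the left end.
  set lo := min (min m₁ m₂ / 2) (p α * (c₁ * ν)) with hlo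
  set hi := max (2 * max M₁ M₂) (p α * (C₁ * (1 + ν))) with hhi
  have hlo0 : 0 < lo := by positivity
  have hσb : ∀ k : ℕ, 1 ≤ k → ∀ x ∈ Icc (α + d) (α + 8 * d), σ k x ∈ Icc lo hi := by
    intro k hk x hx
    have hk' : (1 : ℝ) ≤ k := by exact_mod_cast hk
    have hx' : x - α ∈ Icc d (8 * d) := ⟨by linarith [hx.1], by linarith [hx.2]⟩
    have h1 : c₁ * (1 + k * ν) ≤ L k (x - α) := hLlo (k * ν) (hτ k hk) _ hx'
    have h2 := hLhi k hk _ hx'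
    have e : ∀ y : ℝ, (k : ℝ)⁻¹ * (p α * (y * (1 + k * ν))) = p α * (y * ((k : ℝ)⁻¹ + ν)) := by
      intro y; field_simp
    constructor
    · calc lo ≤ p α * (c₁ * (0 + ν)) := by rw [zero_add]; exact min_le_right _ _
        _ ≤ p α * (c₁ * ((k : ℝ)⁻¹ + ν)) := by gcongr; positivity
        _ = (k : ℝ)⁻¹ * (p α * (c₁ * (1 + k * ν))) := (e _).symm
        _ ≤ σ k x := by simp only [hσ]; gcongr
    · calc σ k x ≤ (k : ℝ)⁻¹ * (p α * (C₁ * (1 + k * ν))) := by simp only [hσ]; gcongr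
        _ = p α * (C₁ * ((k : ℝ)⁻¹ + ν)) := e _
        _ ≤ p α * (C₁ * (1 + ν)) := by gcongr; exact inv_le_one_of_one_le₀ hk'
        _ ≤ hi := le_max_right _ _
  have hqlo : ∀ t, (p t)⁻¹ * lo ^ 2 < q t := by
    intro t
    have hpt := hp.pos t
    rw [inv_mul_lt_iff₀ hpt]
    have h1 : lo ≤ min m₁ m₂ / 2 := min_le_left _ _
    have h2 : min m₁ m₂ ≤ m₁ := min_le_left _ _
    have h3 : min m₁ m₂ ≤ m₂ := min_le_right _ _
    have h4 : 0 < min m₁ m₂ := by positivity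
    calc lo ^ 2 ≤ (min m₁ m₂ / 2) ^ 2 := by gcongr
      _ < min m₁ m₂ * min m₁ m₂ := by nlinarith
      _ ≤ p t * q t := by
        apply mul_le_mul (h2.trans (hpm t)) (h3.trans (hqm t)) h4.le hpt.le
  have hqhi : ∀ t, q t < (p t)⁻¹ * hi ^ 2 := by
    intro t
    have hpt := hp.pos t
    rw [lt_inv_mul_iff₀ hpt]
    have h1 : 2 * max M₁ M₂ ≤ hi := le_max_left _ _
    have h2 : M₁ ≤ max M₁ M₂ := le_max_left _ _
    have h3 : M₂ ≤ max M₁ M₂ := le_max_right _ _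
    have h4 : 0 < max M₁ M₂ := by positivity
    calc p t * q t ≤ max M₁ M₂ * max M₁ M₂ :=
          mul_le_mul ((hpM t).trans h2) ((hqM t).trans h3) (hq.pos t).le h4.le
      _ < (2 * max M₁ M₂) ^ 2 := by nlinarith
      _ ≤ hi ^ 2 := by gcongr
  have hpi := hp.inv hs
  have hex : ∀ k : ℕ, ∃ ρ : ℝ → ℝ, 1 ≤ k → ρ (α + d) = σ k (α + d) ∧
      (∀ t ∈ Icc (α + d) β, HasDerivWithinAt ρ (k * (q t - (p t)⁻¹ * ρ t ^ 2)) (Icc (α + d) β) t) ∧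
      ∀ t ∈ Icc (α + d) β, ρ t ∈ Icc lo hi := by
    intro k
    by_cases hk : 1 ≤ k
    · obtain ⟨ρ, hρ⟩ := exists_riccati (t₀ := α + d) (t₁ := β) (k := k) (q := q)
        (r := fun t => (p t)⁻¹) (by linarith) (by exact_mod_cast hk) hlo0 hq.smooth.continuous
        hpi.smooth.continuous hqlo hqhi (hσb k hk (α + d) ⟨le_rfl, by linarith⟩)
      exact ⟨ρ, fun _ => hρ⟩
    · exact ⟨fun _ => 0, fun h => absurd h hk⟩
  choose ρ hρ using hex
  have hsub : Ioo (α + d) (β - d) ⊆ Ioo (α + d) β := Ioo_subset_Ioo_right (by linarith)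
  have hder : ∀ k, 1 ≤ k → ∀ x ∈ Ioo (α + d) (β - d),
      HasDerivAt (ρ k) (k * (q x - (p x)⁻¹ * ρ k x ^ 2)) x := fun k hk x hx =>
    ((hρ k hk).2.1 x (Ioo_subset_Icc_self (hsub hx))).hasDerivAt (Icc_mem_nhds (hsub hx).1 (hsub hx).2)
  have hbd : ∀ k, 1 ≤ k → ∀ x ∈ Ioo (α + d) (β - d), ρ k x ∈ Icc lo hi := fun k hk x hx =>
    (hρ k hk).2.2 x (Ioo_subset_Icc_self (hsub hx))
  -- Identifying ρ with σ on the constant-coefficient interval provides all derivatives of the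
  -- initial data at α + 2d.
  have hleft : ∀ k, 1 ≤ k → ∀ x ∈ Icc (α + d) (α + 8 * d), ρ k x = σ k x := by
    intro k hk
    have hk' : (1 : ℝ) ≤ k := by exact_mod_cast hk
    have hk0 : (0 : ℝ) < k := by linarith
    have hIcc : Icc (α + d) (α + 8 * d) ⊆ Icc (α + d) β := Icc_subset_Icc_right (by linarith)
    obtain ⟨c', hc', hc''⟩ := hpi.lower
    refine riccati_unique (k := k) (q := q) (r := fun t => (p t)⁻¹) (m := c') (lo := lo) hc'
      (by linarith) hc'' hlo0 (hρ k hk).1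
      (fun t ht => ((hρ k hk).2.1 t (hIcc ht)).mono hIcc) (fun t ht => ?_)
      (fun t ht => ((hρ k hk).2.2 t (hIcc ht)).1) (fun t ht => hlo0.le.trans (hσb k hk t ht).1)
    have ht0 : 0 < t - α := by linarith [ht.1]
    have h := (hasDerivAt_hypProfile_logDeriv (τ := k * ν) (by positivity) ht0)
    have h' := ((h.comp_sub_const t α).const_mul (p α)).const_mul (k : ℝ)⁻¹
    refine (h'.congr_deriv ?_).hasDerivWithinAt
    rw [hq.left t ht.2, hp.left t ht.2, ← hν2]
    simp only [hσ, hL]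
    field_simp
  have hsmooth : ∀ k, 1 ≤ k → ContDiffOn ℝ (⊤ : ℕ∞) (fun x => (ρ k x : ℂ)) (Ioo (α + d) (β - d)) := by
    intro k hk
    refine contDiffOn_of_ode isOpen_Ioo (fun x hx => (hder k hk x hx).ofReal_comp) fun n hn => ?_
    have h1 : ContDiffOn ℝ n (fun x => (q x : ℂ)) (Ioo (α + d) (β - d)) :=
      (Complex.ofRealCLM.contDiff.comp (hq.smooth.of_le (by exact_mod_cast le_top))).contDiffOn
    have h2 : ContDiffOn ℝ n (fun x => (((p x)⁻¹ : ℝ) : ℂ)) (Ioo (α + d) (β - d)) :=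
      (Complex.ofRealCLM.contDiff.comp (hpi.smooth.of_le (by exact_mod_cast le_top))).contDiffOn
    simp only [Complex.ofReal_mul, Complex.ofReal_sub, Complex.ofReal_pow]
    exact contDiffOn_const.mul (h1.sub (h2.mul (hn.pow 2)))
  have hI : Icc (α + 2 * d) (β - 2 * d) ⊆ Ioo (α + d) (β - d) := fun x hx =>
    ⟨by linarith [hx.1], by linarith [hx.2]⟩
  obtain ⟨c', hc', hc''⟩ := hpi.lower
  refine ⟨ρ, lo, hlo0, hder, fun k hk x hx => (hbd k hk x hx).1, ?_,
    fun k hk x hx => hleft k hk x (Ioo_subset_Icc_self hx)⟩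
  refine UniformGevrey.of_riccati (c := c' * lo) (B := hi) (k := fun k : ℕ => (k : ℝ))
    (q := fun x => (q x : ℂ)) (r := fun x => (((p x)⁻¹ : ℝ) : ℂ)) hs (by positivity) (by positivity)
    (fun k hk => by exact_mod_cast hk) (hq.uniform _ _) (hpi.uniform _ _) ?_ ?_ ?_ ?_ ?_
  · intro k hk x hx
    filter_upwards [isOpen_Ioo.mem_nhds (hI hx)] with x' hx'
    refine (hder k hk x' hx').ofReal_comp.congr_deriv ?_
    push_cast
    ring
  · intro k hk x hx
    exact (hsmooth k hk).contDiffAt (isOpen_Ioo.mem_nhds (hI hx))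
  · intro k hk x hx
    have := hbd k hk x (hI hx)
    rw [Complex.norm_real, Real.norm_of_nonneg (hlo0.le.trans this.1)]
    exact this.2
  · intro k hk x hx
    have := hbd k hk x (hI hx)
    rw [← Complex.ofReal_mul, Complex.ofReal_re]
    exact mul_le_mul (hc'' x) this.1 hlo0.le (hpi.pos x).le
  · have h1 := ((hLG.comp_sub_const α).mono_set (J := {α + 2 * d}) le_rfl (fun x hx => by
      rw [hx]; constructor <;> linarith)).const_mul (fun k => ((k : ℝ)⁻¹ * p α : ℂ))
    refine (h1.mono_weight (p α * (1 + ν)) (by positivity) fun k hk => ?_).congr fun k hk x hx => ?_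
    · have hk' : (1 : ℝ) ≤ k := by exact_mod_cast hk
      rw [← Complex.ofReal_mul, Complex.norm_real,
        Real.norm_of_nonneg (by positivity), mul_one]
      have e : (k : ℝ)⁻¹ * p α * (1 + k * ν) = p α * ((k : ℝ)⁻¹ + ν) := by field_simp
      rw [e]
      gcongr
      exact inv_le_one_of_one_le₀ hk'
    · have hx' : x ∈ Ioo (α + d) (α + 8 * d) := by rw [hx]; constructor <;> linarith
      filter_upwards [isOpen_Ioo.mem_nhds hx'] with y hy
      rw [hleft k hk y (Ioo_subset_Icc_self hy)]
      simp only [hσ, hL]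
      push_cast
      ring

/-- The zero frequency analogue of `exists_riccati_high`. -/
lemma exists_riccati_zero {s α β d : ℝ} (hs : 0 < s ∧ s < 1) (hd : 0 < d) (hαβ : α + 16 * d ≤ β)
    {p : ℝ → ℝ} (hp : GevreyCoeff s α β d p) :
    ∃ (ρ : ℝ → ℝ) (c : ℝ), 0 < c ∧
      (∀ x ∈ Ioo (α + d) (β - d), HasDerivAt ρ (-((p x)⁻¹ * ρ x ^ 2)) x) ∧
      (∀ x ∈ Ioo (α + d) (β - d), c ≤ ρ x) ∧
      UniformGevrey s (univ : Set ℕ) (Icc (α + 2 * d) (β - 2 * d)) (fun _ => 1)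
        (fun _ x => (ρ x : ℂ)) ∧
      ∀ x ∈ Ioo (α + d) (α + 8 * d), ρ x = p α *
        (hypProfileDeriv 0 (x - α) / hypProfile 0 (x - α)) := by
  have hpi := hp.inv hs
  have hcont : Continuous fun x => (p x)⁻¹ := hpi.smooth.continuous
  -- For k = 0 the Riccati equation integrates to (1/R)' = 1/p, and vanishing of the homogeneous
  -- solution at α means 1/R = 0 there.
  set Q : ℝ → ℝ := fun x => ∫ t in α..x, (p t)⁻¹ with hQ
  have hQd : ∀ x, HasDerivAt Q (p x)⁻¹ x := fun x =>
    intervalIntegral.integral_hasDerivAt_right (hcont.intervalIntegrable _ _)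
      (hcont.stronglyMeasurableAtFilter _ _) hcont.continuousAt
  obtain ⟨c, hc, hcl⟩ := hpi.lower
  obtain ⟨C, hC, hCu⟩ := hpi.upper
  have hQlo : ∀ x, α ≤ x → c * (x - α) ≤ Q x := by
    intro x hx
    have := intervalIntegral.integral_mono_on hx (_root_.intervalIntegrable_const (c := c) (μ := volume))
      (hcont.intervalIntegrable α x) (fun t _ => hcl t)
    rw [intervalIntegral.integral_const, smul_eq_mul] at this
    linarith
  have hQhi : ∀ x, α ≤ x → Q x ≤ C * (x - α) := by
    intro x hx
    have := intervalIntegral.integral_mono_on hx (hcont.intervalIntegrable α x)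
      (_root_.intervalIntegrable_const (c := C) (μ := volume)) (fun t _ => hCu t)
    rw [intervalIntegral.integral_const, smul_eq_mul] at this
    linarith
  have hQpos : ∀ x, α < x → 0 < Q x := fun x hx =>
    (mul_pos hc (sub_pos.mpr hx)).trans_le (hQlo x hx.le)
  have hQs : ContDiff ℝ (⊤ : ℕ∞) Q := by
    rw [contDiff_infty_iff_deriv]
    refine ⟨fun x => (hQd x).differentiableAt, ?_⟩
    have : deriv Q = fun x => (p x)⁻¹ := funext fun x => (hQd x).deriv
    rw [this]
    exact hpi.smooth
  have hβα : 0 < β - α := by linarith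
  have hQG : UniformGevrey s (univ : Set ℕ) (Icc (α + 2 * d) (β - 2 * d)) (fun _ => 1)
      (fun _ x => (Q x : ℂ)) := by
    obtain ⟨A, M, hA, hM, h⟩ := hpi.gevrey
    refine ⟨C * (β - α) + 4 * A, M, by positivity, hM, fun _ _ x hx => ?_⟩
    rw [mul_one]
    refine GevreyAt.of_deriv hs hM (Complex.ofRealCLM.contDiff.comp hQs).contDiffAt ?_ fun m => ?_
    · have hx1 : α ≤ x := by linarith [hx.1]
      rw [Complex.norm_real, Real.norm_of_nonneg (hQpos x (by linarith [hx.1])).le]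
      refine (hQhi x hx1).trans ?_
      gcongr
      linarith [hx.2]
    · have : _root_.deriv (fun x => (Q x : ℂ)) = fun x => (((p x)⁻¹ : ℝ) : ℂ) :=
        funext fun x => (hQd x).ofReal_comp.deriv
      rw [this]
      exact (h x).bound m
  refine ⟨fun x => (Q x)⁻¹, (C * (β - α))⁻¹, by positivity, fun x hx => ?_, fun x hx => ?_, ?_,
    fun x hx => ?_⟩
  · have := hQpos x (by linarith [hx.1])
    refine ((hQd x).inv this.ne').congr_deriv ?_
    field_simp
  · refine inv_anti₀ (hQpos x (by linarith [hx.1])) ((hQhi x (by linarith [hx.1])).trans ?_)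
    gcongr
    linarith [hx.2]
  · have := hQG.inv hs (c := c * d) (by simp) (by positivity) (fun _ _ x hx => by
      rw [Complex.norm_real, mul_one]
      refine le_trans ?_ ((hQlo x (by linarith [hx.1])).trans (le_abs_self _))
      gcongr
      linarith [hx.1])
    simpa using this
  · have hQx : Q x = (p α)⁻¹ * (x - α) := by
      have : ∀ t ∈ uIcc α x, (p t)⁻¹ = (p α)⁻¹ := by
        intro t ht
        rw [uIcc_of_le (by linarith [hx.1])] at ht
        rw [hp.left t (by linarith [ht.2, hx.2])]
      simp only [hQ]
      rw [intervalIntegral.integral_congr this, intervalIntegral.integral_const, smul_eq_mul]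
      ring
    simp only [hQx, hypProfileDeriv, hypProfile, if_true]
    rw [mul_inv, inv_inv, one_div]

/-- The logarithmic derivative of the solution of `(p ψ')' = k² q ψ` that vanishes at `α`. -/
lemma exists_riccati_family {s α β d : ℝ} (hs : 0 < s ∧ s < 1) (hd : 0 < d) (hαβ : α + 16 * d ≤ β)
    {p q : ℝ → ℝ} (hp : GevreyCoeff s α β d p) (hq : GevreyCoeff s α β d q) :
    ∃ (R : ℕ → ℝ → ℝ) (c : ℝ), 0 < c ∧
      (∀ k : ℕ, ∀ x ∈ Ioo (α + d) (β - d),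
        HasDerivAt (R k) ((k : ℝ) ^ 2 * q x - (p x)⁻¹ * R k x ^ 2) x) ∧
      (∀ k : ℕ, ∀ x ∈ Ioo (α + d) (β - d), c * (1 + k) ≤ R k x) ∧
      (∀ k, ContDiffOn ℝ (⊤ : ℕ∞) (fun x => (R k x : ℂ)) (Ioo (α + d) (β - d))) ∧
      UniformGevrey s univ (Icc (α + 2 * d) (β - 2 * d)) (fun k : ℕ => 1 + (k : ℝ))
        (fun k x => (R k x : ℂ)) ∧
      ∀ k : ℕ, ∀ x ∈ Ioo (α + d) (α + 8 * d), R k x = p α *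
        (hypProfileDeriv (k * √(q α / p α)) (x - α) / hypProfile (k * √(q α / p α)) (x - α)) := by
  obtain ⟨ρ₀, c₀, hc₀, hder₀, hlo₀, hG₀, hleft₀⟩ := exists_riccati_zero hs hd hαβ hp
  obtain ⟨ρ, c, hc, hder, hlo, hG, hleft⟩ := exists_riccati_high hs hd hαβ hp hq
  have hpi := hp.inv hs
  set R : ℕ → ℝ → ℝ := fun k => if k = 0 then ρ₀ else fun x => k * ρ k x with hR
  have hR0 : R 0 = ρ₀ := by simp [hR]
  have hR1 : ∀ k, 1 ≤ k → R k = fun x => k * ρ k x := fun k hk => by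
    simp only [hR, if_neg (show k ≠ 0 by omega)]
  have hRder : ∀ k : ℕ, ∀ x ∈ Ioo (α + d) (β - d),
        HasDerivAt (R k) ((k : ℝ) ^ 2 * q x - (p x)⁻¹ * R k x ^ 2) x := by
    intro k x hx
    rcases Nat.eq_zero_or_pos k with rfl | hk
    · rw [hR0]
      exact (hder₀ x hx).congr_deriv (by push_cast; ring)
    · rw [hR1 k hk]
      refine ((hder k hk x hx).const_mul (k : ℝ)).congr_deriv ?_
      ring
  -- The factor 1/2 comes from 1 + k ≤ 2k for k ≥ 1.
  refine ⟨R, min c₀ (c / 2), by positivity, hRder, fun k x hx => ?_, fun k => ?_, ?_,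
    fun k x hx => ?_⟩
  · rcases Nat.eq_zero_or_pos k with rfl | hk
    · rw [hR0]
      simpa using Or.inl (hlo₀ x hx)
    · rw [hR1 k hk]
      have hk' : (1 : ℝ) ≤ k := by exact_mod_cast hk
      have := hlo k hk x hx
      calc min c₀ (c / 2) * (1 + k) ≤ c / 2 * (k + k) := by
            gcongr; exact min_le_right _ _
        _ = k * c := by ring
        _ ≤ k * ρ k x := by gcongr
  · refine contDiffOn_of_ode isOpen_Ioo (fun x hx => (hRder k x hx).ofReal_comp) fun n hn => ?_
    have h1 : ContDiffOn ℝ n (fun x => (q x : ℂ)) (Ioo (α + d) (β - d)) :=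
      (Complex.ofRealCLM.contDiff.comp (hq.smooth.of_le (by exact_mod_cast le_top))).contDiffOn
    have h2 : ContDiffOn ℝ n (fun x => (((p x)⁻¹ : ℝ) : ℂ)) (Ioo (α + d) (β - d)) :=
      (Complex.ofRealCLM.contDiff.comp (hpi.smooth.of_le (by exact_mod_cast le_top))).contDiffOn
    simp only [Complex.ofReal_mul, Complex.ofReal_sub, Complex.ofReal_pow]
    exact (contDiffOn_const.mul h1).sub (h2.mul (hn.pow 2))
  · have h0 : UniformGevrey s ({0} : Set ℕ) (Icc (α + 2 * d) (β - 2 * d)) (fun k : ℕ => 1 + (k : ℝ))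
        (fun k x => (R k x : ℂ)) := by
      refine ((hG₀.mono_set (subset_univ _) le_rfl).mono_weight 1 one_pos ?_).congr ?_
      · intro k _
        linarith [Nat.cast_nonneg (α := ℝ) k]
      · intro k hk x _
        rw [show k = 0 from hk, hR0]
    have h1 : UniformGevrey s {k : ℕ | 1 ≤ k} (Icc (α + 2 * d) (β - 2 * d))
        (fun k : ℕ => 1 + (k : ℝ)) (fun k x => (R k x : ℂ)) := by
      refine ((hG.const_mul fun k => (k : ℂ)).mono_weight 1 one_pos ?_).congr ?_
      · intro k _
        rw [Complex.norm_natCast]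
        linarith
      · intro k hk x _
        rw [hR1 k hk]
        exact Filter.Eventually.of_forall fun y => by push_cast; rfl
    refine (h0.union_index h1 fun k _ => by positivity).mono_set ?_ le_rfl
    intro k _
    rcases Nat.eq_zero_or_pos k with rfl | hk
    · exact Or.inl rfl
    · exact Or.inr hk
  · rcases Nat.eq_zero_or_pos k with rfl | hk
    · rw [hR0, hleft₀ x hx]
      simp
    · have hk' : (k : ℝ) ≠ 0 := by exact_mod_cast hk.ne'
      rw [hR1 k hk]
      simp only
      rw [hleft k hk x hx]
      field_simp

/-! ### The Dirichlet solutions with modulated right-hand side -/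

lemma hasDerivAt_cexp_I_mul (ξ x : ℝ) :
    HasDerivAt (fun x : ℝ => Complex.exp (Complex.I * ξ * x))
      (Complex.I * ξ * Complex.exp (Complex.I * ξ * x)) x := by
  have := ((hasDerivAt_id x).ofReal_comp.const_mul (Complex.I * ξ)).cexp
  refine this.congr_deriv ?_
  simp; ring

lemma iteratedDeriv_const_mul_cexp (c : ℂ) (ξ : ℝ) (m : ℕ) :
    iteratedDeriv m (fun x : ℝ => c * Complex.exp (Complex.I * ξ * x)) =
      fun x : ℝ => (Complex.I * ξ) ^ m * (c * Complex.exp (Complex.I * ξ * x)) := by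
  induction m with
  | zero => simp
  | succ m ih =>
    rw [iteratedDeriv_succ, ih]
    funext x
    rw [(((hasDerivAt_cexp_I_mul ξ x).const_mul c).const_mul _).deriv]
    ring

lemma norm_cexp_I_mul (ξ x : ℝ) : ‖Complex.exp (Complex.I * ξ * x)‖ = 1 := by
  rw [show Complex.I * ξ * x = ((ξ * x : ℝ) : ℂ) * Complex.I by push_cast; ring]
  exact Complex.norm_exp_ofReal_mul_I _

/-- The derivatives of a pure oscillation have constant absolute value. -/
lemma UniformGevrey.oscillation {ι : Type*} {s : ℝ} {P : Set ι} {w : ι → ℝ} {c : ι → ℂ} {ξ : ι → ℝ}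
    {x₀ : ℝ} (h : UniformGevrey s P {x₀} w
      (fun i (x : ℝ) => c i * Complex.exp (Complex.I * ξ i * x))) (I : Set ℝ) :
    UniformGevrey s P I w (fun i (x : ℝ) => c i * Complex.exp (Complex.I * ξ i * x)) := by
  obtain ⟨A, M, hA, hM, h⟩ := h
  refine ⟨A, M, hA, hM, fun i hi x _ => ⟨?_, fun m => ?_⟩⟩
  · have : ContDiff ℝ (⊤ : ℕ∞) fun x : ℝ => c i * Complex.exp (Complex.I * ξ i * x) :=
      contDiff_const.mul ((contDiff_const.mul Complex.ofRealCLM.contDiff).cexp)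
    exact this.contDiffAt
  · have := (h i hi x₀ rfl).bound m
    rw [iteratedDeriv_const_mul_cexp] at this ⊢
    simp only [norm_mul, norm_cexp_I_mul] at this ⊢
    exact this

lemma eqOn_of_linear_ode {l r v₀ : ℝ} {a f y z : ℝ → ℂ} (ha : ContinuousOn a (Ioo l r))
    (hv₀ : v₀ ∈ Ioo l r) (hy : ∀ v ∈ Ioo l r, HasDerivAt y (a v * y v + f v) v)
    (hz : ∀ v ∈ Ioo l r, HasDerivAt z (a v * z v + f v) v) (h₀ : y v₀ = z v₀) :
    ∀ v ∈ Ioo l r, y v = z v := fun v hv =>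
  sub_eq_zero.mp (linear_ode_unique (y := fun v => y v - z v) ha hv₀
    (fun v hv => ((hy v hv).sub (hz v hv)).congr_deriv (by ring)) (sub_eq_zero.mpr h₀) v hv)

/-- The second order equation obtained from the two first order equations of the factorization. -/
lemma factorization_hasDerivAt {J : Set ℝ} (hJ : IsOpen J) {k ξ : ℝ} {p q R : ℝ → ℝ}
    {Υ ζ g : ℝ → ℂ} (hp : ∀ x, p x ≠ 0)
    (hR : ∀ x ∈ J, HasDerivAt R (k ^ 2 * q x - (p x)⁻¹ * R x ^ 2) x)
    (hζ : ∀ x ∈ J, HasDerivAt ζ (-((((p x)⁻¹ * R x : ℝ) : ℂ) - Complex.I * ξ) * ζ x + Υ x) x)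
    (hg : ∀ x ∈ J, HasDerivAt g
      (((((p x)⁻¹ * R x : ℝ) : ℂ) + Complex.I * ξ) * g x + ((p x)⁻¹ : ℝ) * ζ x) x)
    {h : ℝ → ℂ} (hh : ∀ x ∈ J, h x = Complex.exp (Complex.I * (-ξ : ℝ) * x) * g x) :
    ∀ x ∈ J, (HasDerivAt (fun v => (p v : ℂ) * deriv h v)
      (k ^ 2 * q x * h x + Υ x * Complex.exp (Complex.I * (-ξ : ℝ) * x)) x) := by
  -- The flux is ph' = e^{-iξx}(Rg + ζ). When it is differentiated, the Riccati equation cancels the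
  -- terms in R², and the ζ equation cancels the terms in Rζ.
  have h1 : ∀ x ∈ J, (p x : ℂ) * deriv h x =
      Complex.exp (Complex.I * (-ξ : ℝ) * x) * (R x * g x + ζ x) := by
    intro x hx
    have hev : h =ᶠ[𝓝 x] fun x : ℝ => Complex.exp (Complex.I * (-ξ : ℝ) * x) * g x := by
      filter_upwards [hJ.mem_nhds hx] with y hy using hh y hy
    have hd : HasDerivAt (fun x : ℝ => Complex.exp (Complex.I * (-ξ : ℝ) * x) * g x) _ x :=
      (hasDerivAt_cexp_I_mul (-ξ) x).mul (hg x hx)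
    rw [hev.deriv_eq, hd.deriv]
    have : (p x : ℂ) ≠ 0 := by exact_mod_cast hp x
    push_cast
    field_simp
    ring
  intro x hx
  have hev : (fun v => (p v : ℂ) * deriv h v) =ᶠ[𝓝 x]
      fun x : ℝ => Complex.exp (Complex.I * (-ξ : ℝ) * x) * (R x * g x + ζ x) := by
    filter_upwards [hJ.mem_nhds hx] with y hy using h1 y hy
  rw [hev.hasDerivAt_iff]
  refine ((hasDerivAt_cexp_I_mul (-ξ) x).mul
    (((hR x hx).ofReal_comp.mul (hg x hx)).add (hζ x hx))).congr_deriv ?_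
  rw [hh x hx]
  simp only [Pi.add_apply, Pi.mul_apply]
  push_cast
  ring

lemma hasDerivAt_hypProfile_comp_affine (τ e x₀ x : ℝ) :
    HasDerivAt (fun x : ℝ => (hypProfile τ (e * (x - x₀)) : ℂ))
      ((hypProfileDeriv τ (e * (x - x₀)) * e : ℝ) : ℂ) x := by
  have hlin : HasDerivAt (fun x => e * (x - x₀)) e x := by
    simpa using ((hasDerivAt_id x).sub_const x₀).const_mul e
  have h := (hasDerivAt_hypProfile τ (e * (x - x₀))).comp x hlin
  exact h.ofReal_comp

/-- The second order equation for the explicit solutions in a region of constant coefficients. -/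
lemma hypProfile_hasDerivAt {J : Set ℝ} (hJ : IsOpen J) {k ξ σ x₀ e : ℝ} {c : ℂ} {p q : ℝ → ℝ}
    {Υ g : ℝ → ℂ} (he : e ^ 2 = 1) (hσ : p x₀ * σ ^ 2 = q x₀)
    (hp : ∀ x ∈ J, p x = p x₀) (hq : ∀ x ∈ J, q x = q x₀) (hΥ : ∀ x ∈ J, Υ x = 0)
    (hg : ∀ x ∈ J, g x = c * Complex.exp (Complex.I * ξ * x) *
      (hypProfile (k * σ) (e * (x - x₀)) : ℂ))
    {h : ℝ → ℂ} (hh : ∀ x ∈ J, h x = Complex.exp (Complex.I * (-ξ : ℝ) * x) * g x) :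
    ∀ x ∈ J, (HasDerivAt (fun v => (p v : ℂ) * deriv h v)
      (k ^ 2 * q x * h x + Υ x * Complex.exp (Complex.I * (-ξ : ℝ) * x)) x) := by
  have hh' : ∀ x ∈ J, h x = c * (hypProfile (k * σ) (e * (x - x₀)) : ℂ) := by
    intro x hx
    rw [hh x hx, hg x hx]
    have : Complex.exp (Complex.I * (-ξ : ℝ) * x) * Complex.exp (Complex.I * ξ * x) = 1 := by
      rw [← Complex.exp_add]; simp
    linear_combination (c * (hypProfile (k * σ) (e * (x - x₀)) : ℂ)) * this
  have hlin : ∀ x : ℝ, HasDerivAt (fun x => e * (x - x₀)) e x := fun x => by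
    simpa using ((hasDerivAt_id x).sub_const x₀).const_mul e
  have h1 : ∀ x ∈ J, (p x : ℂ) * deriv h x =
      p x₀ * (c * ((hypProfileDeriv (k * σ) (e * (x - x₀)) * e : ℝ) : ℂ)) := by
    intro x hx
    have hev : h =ᶠ[𝓝 x] fun x : ℝ => c * (hypProfile (k * σ) (e * (x - x₀)) : ℂ) := by
      filter_upwards [hJ.mem_nhds hx] with y hy using hh' y hy
    have hd := (hasDerivAt_hypProfile_comp_affine (k * σ) e x₀ x).const_mul c
    rw [hev.deriv_eq, hd.deriv, hp x hx]
  intro x hx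
  have hev : (fun v => (p v : ℂ) * deriv h v) =ᶠ[𝓝 x]
      fun x : ℝ => p x₀ * (c * ((hypProfileDeriv (k * σ) (e * (x - x₀)) * e : ℝ) : ℂ)) := by
    filter_upwards [hJ.mem_nhds hx] with y hy using h1 y hy
  rw [hev.hasDerivAt_iff]
  have hd := ((((hasDerivAt_hypProfileDeriv (k * σ) (e * (x - x₀))).comp x
    (hlin x)).mul_const e).ofReal_comp.const_mul c).const_mul (p x₀ : ℂ)
  refine HasDerivAt.congr_deriv hd ?_
  rw [hΥ x hx, hh' x hx, hq x hx, ← hσ]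
  have he' : (e : ℂ) ^ 2 = 1 := by exact_mod_cast he
  push_cast
  linear_combination (p x₀ * c * k ^ 2 * σ ^ 2 * (hypProfile (k * σ) (e * (x - x₀)) : ℂ)) * he'

/-- The solutions `h` of the Dirichlet problem `(p h')' - k² q h = Υ e^{-iξx}`, extended past the
end points: `F = e^{iξx} h` satisfies Gevrey bounds uniformly in the frequencies, with the elliptic
gain `(1 + k + |ξ|)⁻²`. -/
theorem exists_dirichlet_family {s α β d : ℝ} (hs : 0 < s ∧ s < 1) (hd : 0 < d)
    (hαβ : α + 16 * d ≤ β) {p q : ℝ → ℝ} (hp : GevreyCoeff s α β d p) (hq : GevreyCoeff s α β d q)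
    {Υ : ℝ → ℂ} (hΥ : UniformGevrey s (univ : Set (ℕ × ℝ)) univ (fun _ => 1) (fun _ => Υ))
    (hΥs : ∀ x, x ∉ Icc (α + 8 * d) (β - 8 * d) → Υ x = 0) :
    ∃ F : ℕ × ℝ → ℝ → ℂ,
      UniformGevrey s univ (Icc (α - 3 * d) (β + 3 * d))
        (fun i => (1 + (i.1 : ℝ) + |i.2|)⁻¹ * (1 + (i.1 : ℝ) + |i.2|)⁻¹) F ∧
      ∀ i : ℕ × ℝ, F i α = 0 ∧ F i β = 0 ∧ ContDiff ℝ (⊤ : ℕ∞) (F i) ∧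
        ∀ h : ℝ → ℂ, (∀ x, h x = Complex.exp (Complex.I * (-i.2 : ℝ) * x) * F i x) →
          ∀ x, HasDerivAt (fun v => (p v : ℂ) * deriv h v)
            ((i.1 : ℝ) ^ 2 * q x * h x + Υ x * Complex.exp (Complex.I * (-i.2 : ℝ) * x)) x := by
  obtain ⟨R, c, hc, hRder, hRlo, hRs, hRG, hRleft⟩ := exists_riccati_family hs hd hαβ hp hq
  have hpi := hp.inv hs
  set J := Ioo (α + d) (β - d) with hJ
  set J₁ := Ioo (α + d) (α + 8 * d) with hJ₁
  set J₂ := Ioo (β - 8 * d) (β - d) with hJ₂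
  have hJ₁J : J₁ ⊆ J := Ioo_subset_Ioo_right (by linarith)
  have hJ₂J : J₂ ⊆ J := Ioo_subset_Ioo_left (by linarith)
  have hIJ : Icc (α + 2 * d) (β - 2 * d) ⊆ J := fun x hx => ⟨by linarith [hx.1], by linarith [hx.2]⟩
  have hΥsm : ContDiff ℝ (⊤ : ℕ∞) Υ := contDiff_iff_contDiffAt.mpr fun x =>
    hΥ.contDiffAt (i := (0, 0)) trivial (x := x) trivial
  have hpic : ContDiff ℝ (⊤ : ℕ∞) fun x => (((p x)⁻¹ : ℝ) : ℂ) :=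
    Complex.ofRealCLM.contDiff.comp hpi.smooth
  set a : ℕ × ℝ → ℝ → ℝ := fun i x => (p x)⁻¹ * R i.1 x with ha
  have has : ∀ i, ContDiffOn ℝ (⊤ : ℕ∞) (fun x => (a i x : ℂ)) J := fun i => by
    simp only [ha, Complex.ofReal_mul]
    exact hpic.contDiffOn.mul (hRs i.1)
  -- the first order factors
  have hζex : ∀ i : ℕ × ℝ, ∃ ζ : ℝ → ℂ, ζ (α + 2 * d) = 0 ∧ ∀ x ∈ J,
      HasDerivAt ζ (-((a i x : ℂ) - Complex.I * i.2) * ζ x + Υ x) x := fun i =>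
    exists_linear_ode ((has i).continuousOn.sub continuousOn_const) hΥsm.continuous.continuousOn
      ⟨by linarith, by linarith⟩ 0
  choose ζ hζ0 hζ using hζex
  have hζs : ∀ i, ContDiffOn ℝ (⊤ : ℕ∞) (ζ i) J := fun i =>
    contDiffOn_of_linear_ode isOpen_Ioo (hζ i) ((has i).sub contDiffOn_const) hΥsm.contDiffOn
  -- Zero data at α + 2d and the vanishing of Υ near α force ζ = 0 there. Thus h has the logarithmic
  -- derivative R/p and is a multiple of the solution vanishing at α.
  have hζleft : ∀ i, ∀ x ∈ J₁, ζ i x = 0 := fun i => by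
    refine linear_ode_unique (a := fun x => -((a i x : ℂ) - Complex.I * i.2)) (v₀ := α + 2 * d)
      (((has i).continuousOn.mono hJ₁J).sub continuousOn_const).neg
      ⟨by linarith, by linarith⟩ (fun x hx => ?_) (hζ0 i)
    have := hζ i x (hJ₁J hx)
    rwa [hΥs x (fun h => by linarith [hx.2, h.1]), add_zero] at this
  set ν := √(q α / p α) with hν
  set μ := √(q β / p β) with hμ
  have hν0 : 0 < ν := Real.sqrt_pos.mpr (div_pos (hq.pos α) (hp.pos α))
  have hμ0 : 0 < μ := Real.sqrt_pos.mpr (div_pos (hq.pos β) (hp.pos β))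
  have hν2 : p α * ν ^ 2 = q α := by
    have := hp.pos α
    rw [hν, Real.sq_sqrt (div_pos (hq.pos α) (hp.pos α)).le]; field_simp
  have hμ2 : p β * μ ^ 2 = q β := by
    have := hp.pos β
    rw [hμ, Real.sq_sqrt (div_pos (hq.pos β) (hp.pos β)).le]; field_simp
  have htau : ∀ σ : ℝ, 0 < σ → ∀ i ∈ (univ : Set (ℕ × ℝ)), (i.1 : ℝ) * σ = 0 ∨ σ ≤ (i.1 : ℝ) * σ := by
    intro σ hσ i _
    rcases Nat.eq_zero_or_pos i.1 with h | h
    · left; rw [h]; simp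
    · right
      have : (1 : ℝ) ≤ i.1 := by exact_mod_cast h
      nlinarith
  set L : ℕ × ℝ → ℝ → ℝ := fun i x =>
    hypProfileDeriv (i.1 * μ) (β - x) / hypProfile (i.1 * μ) (β - x) with hL
  have hLpos : ∀ i, ∀ x < β, 0 < L i x := fun i x hx =>
    div_pos (hypProfileDeriv_pos _ (by positivity)) (hypProfile_pos (by positivity) (by linarith))
  -- The solution that vanishes at β satisfies ph' = -pLh, while the factorization gives ph' = Rh +
  -- e^{-iωx}ζ. Both hold exactly when g = -ζ/S, which is the condition imposed at β - 2d.
  -- Positivity of R and L keeps S away from zero.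
  set S : ℕ × ℝ → ℝ → ℝ := fun i x => R i.1 x + p x * L i x with hS
  have hSlo : ∀ i, ∀ x ∈ J, c * (1 + i.1) ≤ S i x := fun i x hx => by
    have := hRlo i.1 x hx
    have := mul_pos (hp.pos x) (hLpos i x (by linarith [hx.2]))
    simp only [hS]
    linarith
  have hSpos : ∀ i, ∀ x ∈ J, 0 < S i x := fun i x hx =>
    lt_of_lt_of_le (by positivity) (hSlo i x hx)
  have hgex : ∀ i : ℕ × ℝ, ∃ g : ℝ → ℂ,
      g (β - 2 * d) = -(ζ i (β - 2 * d) * ((S i (β - 2 * d) : ℝ) : ℂ)⁻¹) ∧ ∀ x ∈ J,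
      HasDerivAt g (((a i x : ℂ) + Complex.I * i.2) * g x + ((p x)⁻¹ : ℝ) * ζ i x) x := fun i => by
    obtain ⟨g, hg0, hg⟩ := exists_linear_ode (a := fun x => -((a i x : ℂ) + Complex.I * i.2))
      (f := fun x => ((p x)⁻¹ : ℝ) * ζ i x)
      ((has i).continuousOn.add continuousOn_const).neg
      (hpic.continuous.continuousOn.mul (hζs i).continuousOn)
      (v₀ := β - 2 * d) ⟨by linarith, by linarith⟩
      (-(ζ i (β - 2 * d) * ((S i (β - 2 * d) : ℝ) : ℂ)⁻¹))
    exact ⟨g, hg0, fun x hx => by simpa using hg x hx⟩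
  choose g hg0 hg using hgex
  have hgs : ∀ i, ContDiffOn ℝ (⊤ : ℕ∞) (g i) J := fun i =>
    contDiffOn_of_linear_ode (a := fun x => -((a i x : ℂ) + Complex.I * i.2)) isOpen_Ioo
      (fun x hx => by simpa using hg i x hx) ((has i).add contDiffOn_const).neg
      (hpic.contDiffOn.mul (hζs i))
  -- explicit form near the left end point
  set cL : ℕ × ℝ → ℂ := fun i => g i (α + 2 * d) *
    (Complex.exp (Complex.I * i.2 * (α + 2 * d : ℝ)) * (hypProfile (i.1 * ν) (2 * d) : ℂ))⁻¹ with hcL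
  have hgleft : ∀ i, ∀ x ∈ J₁, g i x = cL i * Complex.exp (Complex.I * i.2 * x) *
      (hypProfile (i.1 * ν) (1 * (x - α)) : ℂ) := fun i => by
    have hpos : 0 < hypProfile (i.1 * ν) (2 * d) := hypProfile_pos (by positivity) (by positivity)
    refine eqOn_of_linear_ode (a := fun x => (a i x : ℂ) + Complex.I * i.2) (f := fun _ => 0)
      (v₀ := α + 2 * d) (((has i).continuousOn.mono hJ₁J).add continuousOn_const)
      ⟨by linarith, by linarith⟩ (fun x hx => ?_) (fun x hx => ?_) ?_
    · have := hg i x (hJ₁J hx)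
      rwa [hζleft i x hx, mul_zero] at this
    · have hx0 : 0 < x - α := by linarith [hx.1]
      have hne := (hypProfile_pos (τ := i.1 * ν) (by positivity) hx0).ne'
      have hd := hasDerivAt_hypProfile_comp_affine (i.1 * ν) 1 α x
      refine HasDerivAt.congr_deriv (((hasDerivAt_cexp_I_mul i.2 x).const_mul (cL i)).mul hd) ?_
      have hne' : (hypProfile (i.1 * ν) (x - α) : ℂ) ≠ 0 := by exact_mod_cast hne
      have hpα : (p α : ℂ) ≠ 0 := by exact_mod_cast (hp.pos α).ne'
      simp only [ha, hRleft i.1 x hx, hp.left x hx.2.le, one_mul]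
      push_cast
      field_simp
      ring
    · simp only [hcL]
      have e : 1 * (α + 2 * d - α) = 2 * d := by ring
      have hne' : (hypProfile (i.1 * ν) (2 * d) : ℂ) ≠ 0 := by exact_mod_cast hpos.ne'
      rw [e, mul_assoc, inv_mul_cancel_right₀ (mul_ne_zero (Complex.exp_ne_zero _) hne')]
  -- explicit form near the right end point
  have hLder : ∀ i, ∀ x ∈ J₂, HasDerivAt (L i) (L i x ^ 2 - (i.1 * μ) ^ 2) x := fun i x hx => by
    have hx0 : 0 < β - x := by linarith [hx.2]
    refine ((hasDerivAt_hypProfile_logDeriv (τ := i.1 * μ) (by positivity) hx0).comp x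
      ((hasDerivAt_id x).const_sub β)).congr_deriv ?_
    simp only [hL]
    ring
  -- By the Riccati equations for R and L, -ζ/S solves the same first order equation as g on the
  -- region near β, so agreement at β - 2d propagates.
  have hgS : ∀ i, ∀ x ∈ J₂, g i x = -(ζ i x * ((S i x : ℝ) : ℂ)⁻¹) := fun i => by
    refine eqOn_of_linear_ode (a := fun x => (a i x : ℂ) + Complex.I * i.2)
      (f := fun x => ((p x)⁻¹ : ℝ) * ζ i x)
      (v₀ := β - 2 * d) (((has i).continuousOn.mono hJ₂J).add continuousOn_const)
      ⟨by linarith, by linarith⟩ (fun x hx => hg i x (hJ₂J hx)) (fun x hx => ?_) (hg0 i)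
    have hSx : (S i x : ℂ) ≠ 0 := by exact_mod_cast (hSpos i x (hJ₂J hx)).ne'
    have hSd : HasDerivAt (S i) (((i.1 : ℝ) ^ 2 * q x - (p x)⁻¹ * R i.1 x ^ 2) +
        p β * (L i x ^ 2 - (i.1 * μ) ^ 2)) x := by
      have hev : S i =ᶠ[𝓝 x] fun x => R i.1 x + p β * L i x := by
        filter_upwards [isOpen_Ioo.mem_nhds hx] with y hy
        simp only [hS, hp.right y hy.1.le]
      rw [hev.hasDerivAt_iff]
      exact (hRder i.1 x (hJ₂J hx)).add ((hLder i x hx).const_mul (p β))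
    have hζd := hζ i x (hJ₂J hx)
    rw [hΥs x (fun h => by linarith [hx.1, h.2]), add_zero] at hζd
    refine ((hζd.mul (hSd.ofReal_comp.inv hSx)).neg).congr_deriv ?_
    have hpβ : (p β : ℂ) ≠ 0 := by exact_mod_cast (hp.pos β).ne'
    have hS' : S i x = R i.1 x + p β * L i x := by simp only [hS, hp.right x hx.1.le]
    simp only [Pi.inv_apply]
    rw [hS'] at hSx ⊢
    simp only [ha, hp.right x hx.1.le, hq.right x hx.1.le, ← hμ2]
    push_cast at hSx ⊢
    field_simp
    ring
  set cR : ℕ × ℝ → ℂ := fun i => g i (β - 2 * d) *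
    (Complex.exp (Complex.I * i.2 * (β - 2 * d : ℝ)) * (hypProfile (i.1 * μ) (2 * d) : ℂ))⁻¹ with hcR
  have hgright : ∀ i, ∀ x ∈ J₂, g i x = cR i * Complex.exp (Complex.I * i.2 * x) *
      (hypProfile (i.1 * μ) (-1 * (x - β)) : ℂ) := fun i => by
    have hpos : 0 < hypProfile (i.1 * μ) (2 * d) := hypProfile_pos (by positivity) (by positivity)
    refine eqOn_of_linear_ode (a := fun x => -(L i x : ℂ) + Complex.I * i.2) (f := fun _ => 0)
      (v₀ := β - 2 * d) (ContinuousOn.add (fun x hx =>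
        (hLder i x hx).ofReal_comp.continuousAt.neg.continuousWithinAt) continuousOn_const)
      ⟨by linarith, by linarith⟩ (fun x hx => ?_) (fun x hx => ?_) ?_
    · have hgx := hg i x (hJ₂J hx)
      have hSx : (S i x : ℂ) ≠ 0 := by exact_mod_cast (hSpos i x (hJ₂J hx)).ne'
      have hζx : ζ i x = -(g i x * S i x) := by rw [hgS i x hx]; field_simp
      refine hgx.congr_deriv ?_
      have hpx : (p x : ℂ) ≠ 0 := by exact_mod_cast (hp.pos x).ne'
      rw [hζx]
      simp only [ha, hS]
      push_cast
      field_simp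
      ring
    · have hx0 : 0 < β - x := by linarith [hx.2]
      have hne := (hypProfile_pos (τ := i.1 * μ) (by positivity) hx0).ne'
      have e : -1 * (x - β) = β - x := by ring
      have hd := hasDerivAt_hypProfile_comp_affine (i.1 * μ) (-1) β x
      refine HasDerivAt.congr_deriv (((hasDerivAt_cexp_I_mul i.2 x).const_mul (cR i)).mul hd) ?_
      have hne' : (hypProfile (i.1 * μ) (β - x) : ℂ) ≠ 0 := by exact_mod_cast hne
      simp only [hL, e]
      push_cast
      field_simp
      ring
    · simp only [hcR]
      have e : -1 * (β - 2 * d - β) = 2 * d := by ring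
      have hne' : (hypProfile (i.1 * μ) (2 * d) : ℂ) ≠ 0 := by exact_mod_cast hpos.ne'
      rw [e, mul_assoc, inv_mul_cancel_right₀ (mul_ne_zero (Complex.exp_ne_zero _) hne')]
  -- Gevrey bounds in the interior
  set N : ℕ × ℝ → ℝ := fun i => 1 + (i.1 : ℝ) + |i.2| with hN
  have hN0 : ∀ i, 0 < N i := fun i => by
    have := abs_nonneg i.2
    simp only [hN]; positivity
  have hlr : α + 2 * d ≤ β - 2 * d := by linarith
  have h1κ : ∀ i ∈ (univ : Set (ℕ × ℝ)), (1 : ℝ) ≤ 1 + (i.1 : ℝ) := fun i _ => by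
    have : (0 : ℝ) ≤ i.1 := by positivity
    linarith
  have hRG' : UniformGevrey s (univ : Set (ℕ × ℝ)) (Icc (α + 2 * d) (β - 2 * d))
      (fun i => 1 + (i.1 : ℝ)) (fun i x => (R i.1 x : ℂ)) := hRG.comp_index Prod.fst
  have haG : UniformGevrey s (univ : Set (ℕ × ℝ)) (Icc (α + 2 * d) (β - 2 * d))
      (fun i => 1 + (i.1 : ℝ)) (fun i x => (a i x : ℂ)) := by
    have := (hpi.uniform (univ : Set (ℕ × ℝ)) (Icc (α + 2 * d) (β - 2 * d))).mul hs hRG'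
    simpa only [one_mul, ha, Complex.ofReal_mul] using this
  obtain ⟨c', hc', hpilo⟩ := hpi.lower
  have hac : ∀ i ∈ (univ : Set (ℕ × ℝ)), ∀ x ∈ Icc (α + 2 * d) (β - 2 * d),
      c' * c * (1 + (i.1 : ℝ)) ≤ a i x := fun i _ x hx => by
    have h1 := hRlo i.1 x (hIJ hx)
    have h2 := hpilo x
    simp only [ha]
    rw [mul_assoc]
    exact mul_le_mul h2 h1 (by positivity) (hc'.le.trans h2)
  have hζG : UniformGevrey s (univ : Set (ℕ × ℝ)) (Icc (α + 2 * d) (β - 2 * d))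
      (fun i => (N i)⁻¹) ζ := by
    have h0 : UniformGevrey s (univ : Set (ℕ × ℝ)) {α + 2 * d}
        (fun i => 1 / (1 + (i.1 : ℝ))) ζ := by
      refine (UniformGevrey.const (fun _ => 0) (fun i _ => ?_)).congr fun i _ x hx => ?_
      · rw [norm_zero]; positivity
      · rw [mem_singleton_iff] at hx
        subst hx
        filter_upwards [isOpen_Ioo.mem_nhds (show α + 2 * d ∈ J₁ from
          ⟨by linarith, by linarith⟩)] with y hy using hζleft i y hy
    have := UniformGevrey.of_damped hs (mul_pos hc' hc) hlr (ω := fun i : ℕ × ℝ => i.2)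
      h1κ haG hac (hΥ.mono_set le_rfl (subset_univ _))
      (fun i _ x hx => by
        filter_upwards [isOpen_Ioo.mem_nhds (hIJ hx)] with y hy using hζ i y hy)
      (fun i _ x hx => (hζs i).contDiffAt (isOpen_Ioo.mem_nhds (hIJ hx))) h0
    simpa only [one_mul] using this
  have hSG : UniformGevrey s (univ : Set (ℕ × ℝ)) {β - 2 * d}
      (fun i => 1 + (i.1 : ℝ)) (fun i x => (S i x : ℂ)) := by
    have hLG : UniformGevrey s (univ : Set (ℕ × ℝ)) {β - 2 * d}
        (fun i => 1 + (i.1 : ℝ)) (fun i x => (L i x : ℂ)) := by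
      refine (((uniformGevrey_hypProfile_logDeriv hs hμ0 hd (htau μ hμ0)).comp_const_sub β).mono_set
        le_rfl ?_).mono_weight (1 + μ) (by positivity) fun i _ => ?_
      · intro x hx
        rw [mem_singleton_iff] at hx
        subst hx
        exact ⟨by linarith, by linarith⟩
      · have : (0 : ℝ) ≤ i.1 := by positivity
        nlinarith
    have := (hRG'.mono_set le_rfl (singleton_subset_iff.mpr (right_mem_Icc.mpr hlr))).add
      (((hp.uniform (univ : Set (ℕ × ℝ)) {β - 2 * d}).mul hs hLG).mono_weight
        (w' := fun i => 1 + (i.1 : ℝ)) 1 one_pos (fun i _ => by simp))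
    simpa only [hS, Complex.ofReal_add, Complex.ofReal_mul] using this
  have hgG : UniformGevrey s (univ : Set (ℕ × ℝ)) (Icc (α + 2 * d) (β - 2 * d))
      (fun i => (N i)⁻¹ * (N i)⁻¹) g := by
    have hSinv := hSG.inv hs (fun i hi => one_pos.trans_le (h1κ i hi)) hc (fun i _ x hx => by
      rw [mem_singleton_iff] at hx
      subst hx
      rw [Complex.norm_real]
      exact (hSlo i _ ⟨by linarith, by linarith⟩).trans (le_abs_self _))
    -- The terminal data -ζ/S have exactly the size w/κ required by the backward estimate, since ζ
    -- has weight 1/N and S is at least c(1 + k).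
    have h0 : UniformGevrey s (univ : Set (ℕ × ℝ)) {β - 2 * d}
        (fun i => (N i)⁻¹ / (1 + (i.1 : ℝ))) g := by
      refine (((hζG.mono_set le_rfl (singleton_subset_iff.mpr (right_mem_Icc.mpr hlr))).mul hs
        hSinv).neg).congr fun i _ x hx => ?_
      rw [mem_singleton_iff] at hx
      subst hx
      filter_upwards [isOpen_Ioo.mem_nhds (show β - 2 * d ∈ J₂ from
        ⟨by linarith, by linarith⟩)] with y hy using hgS i y hy
    have hfG : UniformGevrey s (univ : Set (ℕ × ℝ)) (Icc (α + 2 * d) (β - 2 * d))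
        (fun i => (N i)⁻¹) (fun i x => (((p x)⁻¹ : ℝ) : ℂ) * ζ i x) := by
      have := (hpi.uniform (univ : Set (ℕ × ℝ)) (Icc (α + 2 * d) (β - 2 * d))).mul hs hζG
      simpa only [one_mul] using this
    exact UniformGevrey.of_damped_backward hs (mul_pos hc' hc) hlr (ω := fun i : ℕ × ℝ => i.2)
      h1κ haG hac hfG
      (fun i _ x hx => by
        filter_upwards [isOpen_Ioo.mem_nhds (hIJ hx)] with y hy using hg i y hy)
      (fun i _ x hx => (hgs i).contDiffAt (isOpen_Ioo.mem_nhds (hIJ hx))) h0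
  -- Gevrey bounds near the end points
  have hexp : ∀ σ : ℝ, 0 < σ → ∀ i : ℕ × ℝ, (N i)⁻¹ * (N i)⁻¹ * Real.exp (-(6 * d * (i.1 * σ))) *
      Real.exp (4 * d * (i.1 * σ)) ≤ 1 * ((N i)⁻¹ * (N i)⁻¹) := fun σ hσ i => by
    have := hN0 i
    rw [mul_assoc, ← Real.exp_add, one_mul]
    refine mul_le_of_le_one_right (by positivity) (Real.exp_le_one_iff.mpr ?_)
    have : 0 ≤ d * (i.1 * σ) := by positivity
    linarith
  set FL : ℕ × ℝ → ℝ → ℂ := fun i x => cL i * Complex.exp (Complex.I * i.2 * x) *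
      (hypProfile (i.1 * ν) (1 * (x - α)) : ℂ) with hFL
  set FR : ℕ × ℝ → ℝ → ℂ := fun i x => cR i * Complex.exp (Complex.I * i.2 * x) *
      (hypProfile (i.1 * μ) (-1 * (x - β)) : ℂ) with hFR
  have hFLG : UniformGevrey s (univ : Set (ℕ × ℝ)) (Icc (α - 3 * d) (α + 3 * d))
      (fun i => (N i)⁻¹ * (N i)⁻¹) FL := by
    -- Dividing g by the profile at the interior point α + 7d bounds all derivatives of the pure
    -- oscillation. Their moduli do not depend on x, so the bound transfers to the end point and
    -- beyond it.
    have h1 : UniformGevrey s (univ : Set (ℕ × ℝ)) {α + 7 * d}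
        (fun i => (N i)⁻¹ * (N i)⁻¹ * Real.exp (-(6 * d * (i.1 * ν))))
        (fun i (x : ℝ) => cL i * Complex.exp (Complex.I * i.2 * x)) := by
      refine ((hgG.mono_set le_rfl ?_).mul hs (((uniformGevrey_hypProfile_inv hs hν0 hd
        (htau ν hν0)).comp_sub_const α).mono_set le_rfl ?_)).congr fun i _ x hx => ?_
      · rintro x rfl
        exact ⟨by linarith, by linarith⟩
      · rintro x rfl
        simp
      · rw [mem_singleton_iff] at hx
        subst hx
        filter_upwards [isOpen_Ioo.mem_nhds (show α + 7 * d ∈ J₁ from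
          ⟨by linarith, by linarith⟩)] with y hy
        have hne : (hypProfile (i.1 * ν) (y - α) : ℂ) ≠ 0 := by
          exact_mod_cast (hypProfile_pos (τ := i.1 * ν) (by positivity) (by linarith [hy.1])).ne'
        rw [hgleft i y hy, one_mul, mul_inv_cancel_right₀ hne]
    have h2 := (h1.oscillation (Icc (α - 3 * d) (α + 3 * d))).mul hs
      (((uniformGevrey_hypProfile hs hν0 hd (htau ν hν0)).comp_sub_const α).mono_set le_rfl
        (fun x hx => ⟨by linarith [hx.1], by linarith [hx.2]⟩))
    have h3 := h2.mono_weight 1 one_pos (fun i _ => hexp ν hν0 i)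
    simpa only [hFL, one_mul] using h3
  have hFRG : UniformGevrey s (univ : Set (ℕ × ℝ)) (Icc (β - 3 * d) (β + 3 * d))
      (fun i => (N i)⁻¹ * (N i)⁻¹) FR := by
    have e : ∀ x, -1 * (x - β) = β - x := fun x => by ring
    have h1 : UniformGevrey s (univ : Set (ℕ × ℝ)) {β - 7 * d}
        (fun i => (N i)⁻¹ * (N i)⁻¹ * Real.exp (-(6 * d * (i.1 * μ))))
        (fun i (x : ℝ) => cR i * Complex.exp (Complex.I * i.2 * x)) := by
      refine ((hgG.mono_set le_rfl ?_).mul hs (((uniformGevrey_hypProfile_inv hs hμ0 hd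
        (htau μ hμ0)).comp_const_sub β).mono_set le_rfl ?_)).congr fun i _ x hx => ?_
      · rintro x rfl
        exact ⟨by linarith, by linarith⟩
      · rintro x rfl
        simp
      · rw [mem_singleton_iff] at hx
        subst hx
        filter_upwards [isOpen_Ioo.mem_nhds (show β - 7 * d ∈ J₂ from
          ⟨by linarith, by linarith⟩)] with y hy
        have hne : (hypProfile (i.1 * μ) (β - y) : ℂ) ≠ 0 := by
          exact_mod_cast (hypProfile_pos (τ := i.1 * μ) (by positivity) (by linarith [hy.2])).ne'
        rw [hgright i y hy, e, mul_inv_cancel_right₀ hne]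
    have h2 := (h1.oscillation (Icc (β - 3 * d) (β + 3 * d))).mul hs
      (((uniformGevrey_hypProfile hs hμ0 hd (htau μ hμ0)).comp_const_sub β).mono_set le_rfl
        (fun x hx => ⟨by linarith [hx.2], by linarith [hx.1]⟩))
    have h3 := h2.mono_weight 1 one_pos (fun i _ => hexp μ hμ0 i)
    simpa only [hFR, e] using h3
  -- gluing
  set F : ℕ × ℝ → ℝ → ℂ := fun i x =>
    if x < α + 5 * d then FL i x else if x < β - 5 * d then g i x else FR i x with hF
  have hFl : ∀ i, ∀ x ∈ Iio (α + 8 * d), F i x = FL i x := fun i x hx => by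
    have hx' : x < α + 8 * d := hx
    simp only [hF]
    split_ifs with h1 h2
    · rfl
    · exact hgleft i x ⟨by linarith, hx'⟩
    · linarith
  have hFr : ∀ i, ∀ x ∈ Ioi (β - 8 * d), F i x = FR i x := fun i x hx => by
    have hx' : β - 8 * d < x := hx
    simp only [hF]
    split_ifs with h1 h2
    · linarith
    · exact hgright i x ⟨hx', by linarith⟩
    · rfl
  have hFm : ∀ i, ∀ x ∈ J, F i x = g i x := fun i x hx => by
    simp only [hF]
    split_ifs with h1 h2
    · exact (hgleft i x ⟨hx.1, by linarith⟩).symm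
    · rfl
    · exact (hgright i x ⟨by linarith, hx.2⟩).symm
  have hcases : ∀ x : ℝ, x ∈ Iio (α + 8 * d) ∨ x ∈ J ∨ x ∈ Ioi (β - 8 * d) := fun x => by
    rcases lt_or_ge x (α + 8 * d) with h | h
    · exact Or.inl h
    · rcases lt_or_ge (β - 8 * d) x with h' | h'
      · exact Or.inr (Or.inr h')
      · exact Or.inr (Or.inl ⟨by linarith, by linarith⟩)
  have hsm : ∀ (c : ℂ) (ξ τ e x₀ : ℝ), ContDiff ℝ (⊤ : ℕ∞) fun x : ℝ =>
      c * Complex.exp (Complex.I * ξ * x) * (hypProfile τ (e * (x - x₀)) : ℂ) := fun c ξ τ e x₀ =>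
    (contDiff_const.mul ((contDiff_const.mul Complex.ofRealCLM.contDiff).cexp)).mul
      (Complex.ofRealCLM.contDiff.comp ((contDiff_hypProfile τ).comp
        (contDiff_const.mul (contDiff_id.sub contDiff_const))))
  refine ⟨F, ?_, fun i => ⟨?_, ?_, ?_, fun h hh x => ?_⟩⟩
  · have hNN : ∀ i ∈ (univ : Set (ℕ × ℝ)), 0 ≤ (N i)⁻¹ * (N i)⁻¹ := fun i _ => by
      have := hN0 i
      positivity
    have h1 : UniformGevrey s univ (Icc (α - 3 * d) (α + 3 * d))
        (fun i => (N i)⁻¹ * (N i)⁻¹) F := hFLG.congr fun i _ x hx => by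
      filter_upwards [isOpen_Iio.mem_nhds (show x ∈ Iio (α + 8 * d) from
        hx.2.trans_lt (by linarith))] with y hy using hFl i y hy
    have h2 : UniformGevrey s univ (Icc (α + 2 * d) (β - 2 * d))
        (fun i => (N i)⁻¹ * (N i)⁻¹) F := hgG.congr fun i _ x hx => by
      filter_upwards [isOpen_Ioo.mem_nhds (hIJ hx)] with y hy using hFm i y hy
    have h3 : UniformGevrey s univ (Icc (β - 3 * d) (β + 3 * d))
        (fun i => (N i)⁻¹ * (N i)⁻¹) F := hFRG.congr fun i _ x hx => by
      filter_upwards [isOpen_Ioi.mem_nhds (show x ∈ Ioi (β - 8 * d) from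
        lt_of_lt_of_le (by linarith) hx.1)] with y hy using hFr i y hy
    refine ((h1.union h2 hNN).union h3 hNN).mono_set le_rfl fun x hx => ?_
    rcases le_total x (α + 3 * d) with h | h
    · exact Or.inl (Or.inl ⟨hx.1, h⟩)
    · rcases le_total x (β - 3 * d) with h' | h'
      · exact Or.inl (Or.inr ⟨by linarith, by linarith⟩)
      · exact Or.inr ⟨h', hx.2⟩
  · rw [hFl i α (show α < α + 8 * d by linarith)]
    simp [hFL, hypProfile_zero]
  · rw [hFr i β (show β - 8 * d < β by linarith)]
    simp [hFR, hypProfile_zero]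
  · refine contDiff_iff_contDiffAt.mpr fun x => ?_
    rcases hcases x with hx | hx | hx
    · refine (hsm _ _ _ _ _).contDiffAt.congr_of_eventuallyEq (f := FL i) ?_
      filter_upwards [isOpen_Iio.mem_nhds hx] with y hy using hFl i y hy
    · refine ((hgs i).contDiffAt (isOpen_Ioo.mem_nhds hx)).congr_of_eventuallyEq ?_
      filter_upwards [isOpen_Ioo.mem_nhds hx] with y hy using hFm i y hy
    · refine (hsm _ _ _ _ _).contDiffAt.congr_of_eventuallyEq (f := FR i) ?_
      filter_upwards [isOpen_Ioi.mem_nhds hx] with y hy using hFr i y hy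
  · rcases hcases x with hx | hx | hx
    · have := hypProfile_hasDerivAt isOpen_Iio (k := (i.1 : ℝ)) (ξ := i.2) (σ := ν) (x₀ := α) (e := 1)
        (c := cL i) (p := p) (q := q) (Υ := Υ) (g := F i) (by norm_num) hν2
        (fun y (hy : y < α + 8 * d) => hp.left y hy.le) (fun y (hy : y < α + 8 * d) => hq.left y hy.le)
        (fun y (hy : y < α + 8 * d) => hΥs y fun h => by linarith [h.1]) (fun y hy => hFl i y hy)
        (h := h) (fun y _ => hh y) x hx
      simpa using this
    · have := factorization_hasDerivAt isOpen_Ioo (k := (i.1 : ℝ)) (ξ := i.2) (p := p) (q := q)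
        (fun y => (hp.pos y).ne') (hRder i.1) (hζ i) (hg i) (h := h)
        (fun y hy => by rw [hh y, hFm i y hy]) x hx
      simpa using this
    · have := hypProfile_hasDerivAt isOpen_Ioi (k := (i.1 : ℝ)) (ξ := i.2) (σ := μ) (x₀ := β) (e := -1)
        (c := cR i) (p := p) (q := q) (Υ := Υ) (g := F i) (by norm_num) hμ2
        (fun y (hy : β - 8 * d < y) => hp.right y hy.le)
        (fun y (hy : β - 8 * d < y) => hq.right y hy.le)
        (fun y (hy : β - 8 * d < y) => hΥs y fun h => by linarith [h.2]) (fun y hy => hFr i y hy)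
        (h := h) (fun y _ => hh y) x hx
      simpa using this

/-! ### The change of variables -/

lemma iteratedDeriv_ofReal_comp {f : ℝ → ℝ} (hf : ContDiff ℝ (⊤ : ℕ∞) f) (m : ℕ) (x : ℝ) :
    iteratedDeriv m (fun x => (f x : ℂ)) x = ((iteratedDeriv m f x : ℝ) : ℂ) := by
  induction m generalizing f with
  | zero => simp
  | succ m ih =>
    rw [iteratedDeriv_succ', iteratedDeriv_succ', ← ih (contDiff_infty_iff_deriv.mp hf).2]
    congr 1
    funext y
    exact ((hf.differentiable (by simp)) y).hasDerivAt.ofReal_comp.deriv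

lemma IsGevreyOn.exists_bound {s : ℝ} {S : Set ℝ} {f : ℝ → ℝ} (h : IsGevreyOn s S f) :
    ∃ A M : ℝ, 0 < A ∧ 1 ≤ M ∧ ∀ m, ∀ x ∈ S, |iteratedDeriv m f x| ≤ A * M ^ m * gevreyWeight s m := by
  obtain ⟨L, M, hM, h⟩ := h
  refine ⟨|L| + 1, max M 1, by positivity, le_max_right _ _, fun m x hx => (h m x hx).trans ?_⟩
  have := gevreyWeight_pos s m
  gcongr
  · linarith [le_abs_self L]
  · exact le_max_left _ _

/-- The derivation `a ∂` satisfies Gevrey estimates with the index shifted by its order. -/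
lemma norm_iteratedDeriv_derivation_le {s A B Λ : ℝ} (hs : 0 < s ∧ s < 1) (hB : 0 ≤ B)
    {a f : ℝ → ℂ} (ha : ∀ x, GevreyAt s A B a x) (hf : ∀ x, GevreyAt s Λ B f x) (m : ℕ) :
    ContDiff ℝ (⊤ : ℕ∞) ((fun g : ℝ → ℂ => fun x => a x * deriv g x)^[m] f) ∧ ∀ j x,
      ‖iteratedDeriv j ((fun g : ℝ → ℂ => fun x => a x * deriv g x)^[m] f) x‖ ≤
        Λ * (8 * A * B) ^ m * B ^ j * gevreyWeight s (j + m) := by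
  have has : ContDiff ℝ (⊤ : ℕ∞) a := contDiff_iff_contDiffAt.mpr fun x => (ha x).smooth
  have hA : 0 ≤ A := (ha 0).nonneg
  have hΛ : 0 ≤ Λ := (hf 0).nonneg
  induction m with
  | zero => exact ⟨contDiff_iff_contDiffAt.mpr fun x => (hf x).smooth,
      fun j x => by simpa using (hf x).bound j⟩
  | succ m ih =>
    obtain ⟨hsm, hb⟩ := ih
    rw [Function.iterate_succ_apply']
    set g := (fun g : ℝ → ℂ => fun x => a x * deriv g x)^[m] f
    have hg' := (contDiff_infty_iff_deriv.mp hsm).2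
    refine ⟨has.mul hg', fun j x => ?_⟩
    rw [iteratedDeriv_fun_mul (has.contDiffAt.of_le (by exact_mod_cast le_top))
      (hg'.contDiffAt.of_le (by exact_mod_cast le_top))]
    refine (norm_sum_le _ _).trans ?_
    -- Enlarging the upper index of the binomial coefficient from j to j + m + 1 makes this part of
    -- the full Leibniz sum for the weight of index j + m + 1, so each application of the derivation
    -- costs the fixed factor 8AB.
    calc _ ≤ ∑ i ∈ Finset.range (j + 1), (A * Λ * (8 * A * B) ^ m * B ^ (j + 1)) *
          (((j + (m + 1)).choose i : ℝ) * gevreyWeight s i * gevreyWeight s (j + (m + 1) - i)) := by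
          refine Finset.sum_le_sum fun i hi => ?_
          have hi' : i ≤ j := Nat.lt_succ_iff.mp (Finset.mem_range.mp hi)
          rw [norm_mul, norm_mul, Complex.norm_natCast, ← iteratedDeriv_succ']
          have h1 := (ha x).bound i
          have h2 := hb (j - i + 1) x
          have h3 : (j.choose i : ℝ) ≤ ((j + (m + 1)).choose i : ℝ) := by
            exact_mod_cast Nat.choose_le_choose i (Nat.le_add_right _ _)
          have e : j - i + 1 + m = j + (m + 1) - i := by omega
          have e' : B ^ (j + 1) = B ^ i * B ^ (j - i + 1) := by rw [← pow_add]; congr 1; omega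
          rw [e] at h2
          have := gevreyWeight_pos s i
          have := gevreyWeight_pos s (j + (m + 1) - i)
          calc _ ≤ ((j + (m + 1)).choose i : ℝ) * (A * B ^ i * gevreyWeight s i) *
                (Λ * (8 * A * B) ^ m * B ^ (j - i + 1) * gevreyWeight s (j + (m + 1) - i)) := by
                gcongr
            _ = _ := by rw [e']; ring
      _ ≤ (A * Λ * (8 * A * B) ^ m * B ^ (j + 1)) * (8 * gevreyWeight s (j + (m + 1))) := by
          rw [← Finset.mul_sum]
          gcongr
          refine le_trans (Finset.sum_le_sum_of_subset_of_nonneg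
            (Finset.range_mono (show j + 1 ≤ j + (m + 1) + 1 by omega)) fun i _ _ => ?_)
            (sum_choose_mul_gevreyWeight_le hs (j + (m + 1)))
          have := gevreyWeight_pos s i
          have := gevreyWeight_pos s (j + (m + 1) - i)
          positivity
      _ = _ := by ring

/-- Along the flow, d/dv acts as the derivation a∂, so no Faà di Bruno formula is needed. -/
lemma iteratedDeriv_comp_flow {a f : ℝ → ℂ} {Y : ℝ → ℝ} {Y' : ℝ → ℝ}
    (hY : ∀ v, HasDerivAt Y (Y' v) v) (haY : ∀ v, a (Y v) = Y' v)
    (hsm : ∀ m, ContDiff ℝ (⊤ : ℕ∞) ((fun g : ℝ → ℂ => fun x => a x * deriv g x)^[m] f)) (m : ℕ) :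
    iteratedDeriv m (fun v => f (Y v)) =
      fun v => ((fun g : ℝ → ℂ => fun x => a x * deriv g x)^[m] f) (Y v) := by
  induction m with
  | zero => simp
  | succ m ih =>
    rw [iteratedDeriv_succ, ih, Function.iterate_succ']
    funext v
    have h := (((hsm m).differentiable (by simp)) (Y v)).hasDerivAt.scomp v (hY v)
    have h' := h.deriv
    simp only [Function.comp_def, Complex.real_smul] at h' ⊢
    rw [h', haY]

/-- Gevrey regularity is preserved by composition with the flow `Y' = a(Y)` of a Gevrey vector
field. -/
lemma exists_gevreyAt_comp_flow {s A B Λ : ℝ} (hs : 0 < s ∧ s < 1) (hB : 0 ≤ B)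
    {a f : ℝ → ℂ} (ha : ∀ x, GevreyAt s A B a x) (hf : ∀ x, GevreyAt s Λ B f x)
    {Y : ℝ → ℝ} {Y' : ℝ → ℝ} (hYs : ContDiff ℝ (⊤ : ℕ∞) Y)
    (hY : ∀ v, HasDerivAt Y (Y' v) v) (haY : ∀ v, a (Y v) = Y' v) (v : ℝ) :
    GevreyAt s Λ (8 * A * B) (fun v => f (Y v)) v := by
  have key := norm_iteratedDeriv_derivation_le hs hB ha hf
  refine ⟨((contDiff_iff_contDiffAt.mpr fun x => (hf x).smooth).comp hYs).contDiffAt, fun m => ?_⟩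
  rw [iteratedDeriv_comp_flow hY haY (fun m => (key m).1) m]
  have := (key m).2 0 (Y v)
  simpa using this

/-- The extension of `φ|_[0,1]` by constants. -/
noncomputable def clampExtend (φ : ℝ → ℝ) (y : ℝ) : ℝ := φ (max 0 (min 1 y))

lemma clampExtend_eq (φ : ℝ → ℝ) {y : ℝ} (hy : y ∈ Icc (0 : ℝ) 1) : clampExtend φ y = φ y := by
  rw [clampExtend, min_eq_right hy.2, max_eq_right hy.1]

lemma max_min_mem (y : ℝ) : max 0 (min 1 y) ∈ Icc (0 : ℝ) 1 :=
  ⟨le_max_left _ _, max_le zero_le_one (min_le_left _ _)⟩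

section clamp

variable {φ : ℝ → ℝ} {κ : ℝ}

lemma clampExtend_left (hκ : 0 < κ ∧ κ < 1 / 2) (hφ : ContDiff ℝ (⊤ : ℕ∞) φ)
    (h : ∀ y ∈ Icc (0 : ℝ) 1, y ∉ Icc κ (1 - κ) → deriv φ y = 0) {y : ℝ} (hy : y < κ) :
    clampExtend φ y = φ 0 := by
  have hd := hφ.differentiable (by simp)
  rcases le_or_gt y 0 with h0 | h0
  · rw [clampExtend, max_eq_left ((min_le_right _ _).trans h0)]
  · rw [clampExtend_eq φ ⟨h0.le, by linarith [hκ.2]⟩]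
    refine constant_of_derivWithin_zero (a := 0) (b := y) hd.differentiableOn (fun x hx => ?_) y
      (right_mem_Icc.mpr h0.le)
    rw [(hd x).derivWithin (uniqueDiffOn_Icc h0 x (Ico_subset_Icc_self hx))]
    exact h x ⟨hx.1, by linarith [hx.2, hκ.2]⟩ fun hx' => by linarith [hx'.1, hx.2]

lemma clampExtend_right (hκ : 0 < κ ∧ κ < 1 / 2) (hφ : ContDiff ℝ (⊤ : ℕ∞) φ)
    (h : ∀ y ∈ Icc (0 : ℝ) 1, y ∉ Icc κ (1 - κ) → deriv φ y = 0) {y : ℝ} (hy : 1 - κ < y) :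
    clampExtend φ y = φ 1 := by
  have hrefl : clampExtend (fun y => φ (1 - y)) (1 - y) = φ (1 - 0) := by
    refine clampExtend_left (φ := fun y => φ (1 - y)) hκ (hφ.comp (contDiff_const.sub contDiff_id))
      (fun y hy hy' => ?_) (by linarith)
    rw [deriv_comp_const_sub, h (1 - y) ⟨by linarith [hy.2], by linarith [hy.1]⟩
      (fun h' => hy' ⟨by linarith [h'.2], by linarith [h'.1]⟩), neg_zero]
  rw [sub_zero] at hrefl
  rw [← hrefl, clampExtend, clampExtend]
  congr 1
  rcases le_total y 1 with h1 | h1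
  · rw [min_eq_right h1, max_eq_right (by linarith [hκ.2]), min_eq_right (by linarith [hκ.2]),
      max_eq_right (by linarith)]
    ring
  · rw [min_eq_left h1, min_eq_right (by linarith), max_eq_right zero_le_one,
      max_eq_left (by linarith)]
    ring

/-- Any point has a neighbourhood in which `clampExtend φ` is constant or equal to `φ`. -/
lemma clampExtend_eventuallyEq (hκ : 0 < κ ∧ κ < 1 / 2) (hφ : ContDiff ℝ (⊤ : ℕ∞) φ)
    (h : ∀ y ∈ Icc (0 : ℝ) 1, y ∉ Icc κ (1 - κ) → deriv φ y = 0) (y : ℝ) :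
    (clampExtend φ =ᶠ[𝓝 y] fun _ => φ 0) ∨ (clampExtend φ =ᶠ[𝓝 y] fun _ => φ 1) ∨
      (y ∈ Icc (0 : ℝ) 1 ∧ clampExtend φ =ᶠ[𝓝 y] φ) := by
  rcases lt_or_ge y κ with hy | hy
  · left
    filter_upwards [isOpen_Iio.mem_nhds hy] with x hx using clampExtend_left hκ hφ h hx
  rcases lt_or_ge (1 - κ) y with hy' | hy'
  · right; left
    filter_upwards [isOpen_Ioi.mem_nhds hy'] with x hx using clampExtend_right hκ hφ h hx
  right; right
  have hm : y ∈ Ioo (0 : ℝ) 1 := ⟨by linarith [hκ.1], by linarith [hκ.1]⟩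
  refine ⟨Ioo_subset_Icc_self hm, ?_⟩
  filter_upwards [isOpen_Ioo.mem_nhds hm] with x hx using clampExtend_eq φ (Ioo_subset_Icc_self hx)

lemma contDiff_clampExtend (hκ : 0 < κ ∧ κ < 1 / 2) (hφ : ContDiff ℝ (⊤ : ℕ∞) φ)
    (h : ∀ y ∈ Icc (0 : ℝ) 1, y ∉ Icc κ (1 - κ) → deriv φ y = 0) :
    ContDiff ℝ (⊤ : ℕ∞) (clampExtend φ) :=
  contDiff_iff_contDiffAt.mpr fun y => by
    rcases clampExtend_eventuallyEq hκ hφ h y with h | h | ⟨-, h⟩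
    · exact contDiffAt_const.congr_of_eventuallyEq h
    · exact contDiffAt_const.congr_of_eventuallyEq h
    · exact hφ.contDiffAt.congr_of_eventuallyEq h

/-- Locally the extension is either constant or φ itself. Size is controlled by compactness of [0,
1] and all derivatives by the assumption on φ'. -/
lemma exists_gevreyAt_clampExtend {s : ℝ} (hs : 0 < s ∧ s < 1) (hκ : 0 < κ ∧ κ < 1 / 2)
    (hφ : ContDiff ℝ (⊤ : ℕ∞) φ)
    (h : ∀ y ∈ Icc (0 : ℝ) 1, y ∉ Icc κ (1 - κ) → deriv φ y = 0)
    (hG : IsGevreyOn s (Icc 0 1) (deriv φ)) :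
    ∃ A M : ℝ, 0 < A ∧ 1 ≤ M ∧ ∀ y, GevreyAt s A M (fun y => (clampExtend φ y : ℂ)) y := by
  obtain ⟨A, M, hA, hM, hb⟩ := hG.exists_bound
  obtain ⟨D, hD⟩ := isCompact_Icc.exists_bound_of_continuousOn (s := Icc (0 : ℝ) 1)
    hφ.continuous.continuousOn
  have hD0 : 0 ≤ D := (norm_nonneg _).trans (hD 0 ⟨le_rfl, zero_le_one⟩)
  refine ⟨D + 4 * A, M, by positivity, hM, fun y => ?_⟩
  have hc : ∀ z ∈ Icc (0 : ℝ) 1, (clampExtend φ =ᶠ[𝓝 y] fun _ => φ z) →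
      GevreyAt s (D + 4 * A) M (fun y => (clampExtend φ y : ℂ)) y := fun z hz h => by
    refine (GevreyAt.const (φ z : ℂ) ?_ (by linarith)).congr
      (h.mono fun x hx => by simp only [hx])
    rw [Complex.norm_real]
    linarith [hD z hz]
  rcases clampExtend_eventuallyEq hκ hφ h y with h | h | ⟨hy, h⟩
  · exact hc 0 ⟨le_rfl, zero_le_one⟩ h
  · exact hc 1 ⟨zero_le_one, le_rfl⟩ h
  · refine (GevreyAt.of_deriv (f := fun x => (φ x : ℂ)) hs hM
      (Complex.ofRealCLM.contDiff.comp hφ).contDiffAt ?_ fun m => ?_).congr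
      (h.mono fun x hx => by simp only [hx])
    · rw [Complex.norm_real]; exact hD y hy
    · rw [← iteratedDeriv_succ', iteratedDeriv_ofReal_comp hφ, Complex.norm_real, iteratedDeriv_succ']
      exact hb m y hy

end clamp

lemma tilde_eq {u φ : ℝ → ℝ} {y : ℝ} (hu : InjOn u (Icc 0 1)) (hy : y ∈ Icc (0 : ℝ) 1) :
    tilde u φ (u y) = φ y := by
  have hex : ∃ x ∈ Icc (0 : ℝ) 1, u x = u y := ⟨y, hy, rfl⟩
  rw [tilde, hu (Function.invFunOn_mem hex) hy (Function.invFunOn_eq hex)]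

/-- A smooth diffeomorphism with a given positive derivative, together with its inverse. -/
lemma exists_diffeo {V : ℝ → ℝ} {c u₀ : ℝ} (hc : 0 < c) (hV : ContDiff ℝ (⊤ : ℕ∞) V)
    (hVc : ∀ y, c ≤ V y) :
    ∃ U Y : ℝ → ℝ, U 0 = u₀ ∧ (∀ y, HasDerivAt U (V y) y) ∧ StrictMono U ∧ (∀ v, U (Y v) = v) ∧
      (∀ y, Y (U y) = y) ∧ ContDiff ℝ (⊤ : ℕ∞) Y ∧ ∀ v, HasDerivAt Y (V (Y v))⁻¹ v := by
  set U : ℝ → ℝ := fun y => u₀ + ∫ x in (0 : ℝ)..y, V x with hU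
  have hUd : ∀ y, HasDerivAt U (V y) y := fun y =>
    (intervalIntegral.integral_hasDerivAt_right (hV.continuous.intervalIntegrable _ _)
      (hV.continuous.stronglyMeasurableAtFilter _ _) hV.continuous.continuousAt).const_add u₀
  have hUdiff : Differentiable ℝ U := fun y => (hUd y).differentiableAt
  have hderiv : deriv U = V := funext fun y => (hUd y).deriv
  have hUs : ContDiff ℝ (⊤ : ℕ∞) U := contDiff_infty_iff_deriv.mpr ⟨hUdiff, by rw [hderiv]; exact hV⟩
  have hmono : StrictMono U := strictMono_of_deriv_pos fun y => by
    rw [hderiv]; exact hc.trans_le (hVc y)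
  -- At least linear growth in both directions gives surjectivity of U.
  have hlin : Monotone fun y => U y - c * y := monotone_of_deriv_nonneg
    (hUdiff.sub (differentiable_id.const_mul c)) fun y => by
      have : HasDerivAt (fun y => U y - c * y) (V y - c * 1) y :=
        (hUd y).sub ((hasDerivAt_id y).const_mul c)
      rw [this.deriv]
      linarith [hVc y]
  have htop : Filter.Tendsto U Filter.atTop Filter.atTop := by
    refine Filter.tendsto_atTop_mono' _ ?_ (Filter.tendsto_atTop_add_const_left _ (U 0)
      (Filter.tendsto_id.const_mul_atTop hc))
    filter_upwards [Filter.eventually_ge_atTop 0] with y hy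
    have := hlin hy
    simp only [id] at this ⊢
    linarith
  have hbot : Filter.Tendsto U Filter.atBot Filter.atBot := by
    refine Filter.tendsto_atBot_mono' _ ?_ (Filter.tendsto_atBot_add_const_left _ (U 0)
      (Filter.tendsto_id.const_mul_atBot hc))
    filter_upwards [Filter.eventually_le_atBot 0] with y hy
    have := hlin hy
    simp only [id] at this ⊢
    linarith
  set e := hmono.orderIsoOfSurjective U (hUdiff.continuous.surjective htop hbot)
  have he : ∀ y, e y = U y := fun y => rfl
  have hYs : ContDiff ℝ (⊤ : ℕ∞) e.toHomeomorph.symm :=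
    e.toHomeomorph.contDiff_symm_deriv (f' := V) (fun y => (hc.trans_le (hVc y)).ne') hUd hUs
  refine ⟨U, e.symm, by simp [hU], hUd, hmono, fun v => e.apply_symm_apply v,
    fun y => e.symm_apply_apply y, hYs, fun v => ?_⟩
  exact HasDerivAt.of_local_left_inverse (f := U) e.symm.continuous.continuousAt
    (hUd _) (hc.trans_le (hVc _)).ne' (Filter.Eventually.of_forall fun y => e.apply_symm_apply y)

/-- The coefficients of the elliptic operator as functions of `v`. -/
lemma exists_coefficients {u θ : ℝ → ℝ} {c₀ κ s : ℝ} (hs : 0 < s ∧ s < 1)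
    (hκ : 0 < κ ∧ κ < 1 / 2) (hc₀ : 0 < c₀) (hu : ContDiff ℝ (⊤ : ℕ∞) u)
    (hθ : ContDiff ℝ (⊤ : ℕ∞) θ) (hu_mono : ∀ y ∈ Icc (0 : ℝ) 1, c₀ ≤ deriv u y)
    (hθ_pos : ∀ y ∈ Icc (0 : ℝ) 1, c₀ ≤ θ y)
    (hu_supp : ∀ y ∈ Icc (0 : ℝ) 1, y ∉ Icc κ (1 - κ) → deriv (deriv u) y = 0)
    (hθ_supp : ∀ y ∈ Icc (0 : ℝ) 1, y ∉ Icc κ (1 - κ) → deriv θ y = 0)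
    (hu_gevrey : IsGevreyOn s (Icc 0 1) (deriv (deriv u)))
    (hθ_gevrey : IsGevreyOn s (Icc 0 1) (deriv θ)) :
    ∃ (ϑ b : ℝ → ℝ) (δ : ℝ), 0 < δ ∧ (∀ d, 0 < d → d ≤ δ → u 0 + 16 * d ≤ u 1 ∧
      GevreyCoeff s (u 0) (u 1) d ϑ ∧ GevreyCoeff s (u 0) (u 1) d b) ∧
      ∀ v ∈ Icc (u 0) (u 1), tilde u θ v = ϑ v ∧ tilde u (deriv u) v = b v := by
  have hu' : ContDiff ℝ (⊤ : ℕ∞) (deriv u) := (contDiff_infty_iff_deriv.mp hu).2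
  have hud : Differentiable ℝ u := hu.differentiable (by simp)
  set V := clampExtend (deriv u) with hV
  set Θ := clampExtend θ with hΘ
  have hVs : ContDiff ℝ (⊤ : ℕ∞) V := contDiff_clampExtend hκ hu' hu_supp
  have hΘs : ContDiff ℝ (⊤ : ℕ∞) Θ := contDiff_clampExtend hκ hθ hθ_supp
  have hVc : ∀ y, c₀ ≤ V y := fun y => hu_mono _ (max_min_mem y)
  have hΘc : ∀ y, c₀ ≤ Θ y := fun y => hθ_pos _ (max_min_mem y)
  obtain ⟨U, Y, hU0, hUd, hUm, hUY, hYU, hYs, hYd⟩ := exists_diffeo (u₀ := u 0) hc₀ hVs hVc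
  have hUu : ∀ y ∈ Icc (0 : ℝ) 1, U y = u y := by
    intro y hy
    have := constant_of_derivWithin_zero (f := fun y => U y - u y) (a := 0) (b := 1)
      (fun x _ => ((hUd x).differentiableAt.sub (hud x)).differentiableWithinAt) (fun x hx => ?_) y hy
    · have h0 : U 0 - u 0 = 0 := by rw [hU0, sub_self]
      linarith
    · have hx' := Ico_subset_Icc_self hx
      have h := ((hUd x).sub (hud x).hasDerivAt).hasDerivWithinAt (s := Icc 0 1)
      have h' := h.derivWithin (uniqueDiffOn_Icc zero_lt_one x hx')
      rw [show V x = deriv u x from clampExtend_eq _ hx', sub_self] at h'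
      exact h'
  have hU1 : U 1 = u 1 := hUu 1 ⟨zero_le_one, le_rfl⟩
  have hinj : InjOn u (Icc 0 1) := fun x hx y hy h => hUm.injective (by rw [hUu x hx, hUu y hy, h])
  have hYm : StrictMono Y := fun v w h => hUm.lt_iff_lt.mp (by rwa [hUY, hUY])
  have hY0 : Y (u 0) = 0 := by rw [← hU0, hYU]
  have hY1 : Y (u 1) = 1 := by rw [← hU1, hYU]
  -- Gevrey regularity
  obtain ⟨A₁, M₁, hA₁, hM₁, hVG⟩ := exists_gevreyAt_clampExtend hs hκ hu' hu_supp hu_gevrey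
  obtain ⟨A₂, M₂, hA₂, hM₂, hΘG⟩ := exists_gevreyAt_clampExtend hs hκ hθ hθ_supp hθ_gevrey
  have hVU : UniformGevrey s (univ : Set Unit) univ (fun _ => 1) (fun _ x => (V x : ℂ)) :=
    ⟨A₁, M₁, hA₁, hM₁, fun _ _ x _ => by simpa using hVG x⟩
  obtain ⟨A₃, M₃, hA₃, hM₃, hIG⟩ := hVU.inv hs (by simp) hc₀ (fun _ _ x _ => by
    rw [mul_one, Complex.norm_real]
    exact (hVc x).trans (le_abs_self _))
  set M := max M₁ (max M₂ M₃)
  have hM : 1 ≤ M := hM₁.trans (le_max_left _ _)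
  -- The inverse Y satisfies Y' = 1/V(Y), so it is the flow of the Gevrey field 1/V and composition
  -- with it preserves the class.
  have htrans : ∀ (φ : ℝ → ℝ) (A N : ℝ), 0 < A → 1 ≤ N → N ≤ M →
      (∀ x, GevreyAt s A N (fun y => (φ y : ℂ)) x) →
      ∃ A' M' : ℝ, 0 < A' ∧ 1 ≤ M' ∧ ∀ v, GevreyAt s A' M' (fun v => (φ (Y v) : ℂ)) v := by
    intro φ A N hA hN hNM h
    refine ⟨A, max 1 (8 * A₃ * M), hA, le_max_left _ _, fun v => ?_⟩
    have h1 : ∀ x, GevreyAt s A₃ M (fun x => ((V x : ℂ))⁻¹) x := fun x => by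
      have := hIG () trivial x trivial
      rw [inv_one, mul_one] at this
      exact this.mono le_rfl (by linarith) ((le_max_right _ _).trans (le_max_right _ _))
    have := exists_gevreyAt_comp_flow hs (by linarith) h1
      (fun x => (h x).mono le_rfl (by linarith) hNM) hYs hYd (fun v => by push_cast; rfl) v
    exact this.mono le_rfl (by positivity) (le_max_right _ _)
  have hbG := htrans V A₁ M₁ hA₁ hM₁ (le_max_left _ _) hVG
  have hϑG := htrans Θ A₂ M₂ hA₂ hM₂ ((le_max_left _ _).trans (le_max_right _ _)) hΘG
  have hUl : u 0 < U κ := by rw [← hU0]; exact hUm hκ.1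
  have hUr : U (1 - κ) < u 1 := by rw [← hU1]; exact hUm (by linarith [hκ.1])
  have h01 : u 0 < u 1 := by rw [← hU0, ← hU1]; exact hUm zero_lt_one
  have hcoef : ∀ φ : ℝ → ℝ, ContDiff ℝ (⊤ : ℕ∞) φ → (∀ y ∈ Icc (0 : ℝ) 1, c₀ ≤ φ y) →
      (∀ y ∈ Icc (0 : ℝ) 1, y ∉ Icc κ (1 - κ) → deriv φ y = 0) →
      (∃ A' M' : ℝ, 0 < A' ∧ 1 ≤ M' ∧ ∀ v, GevreyAt s A' M' (fun v => (clampExtend φ (Y v) : ℂ)) v) →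
      ∀ d, 0 < d → 16 * d ≤ U κ - u 0 → 16 * d ≤ u 1 - U (1 - κ) →
        GevreyCoeff s (u 0) (u 1) d (fun v => clampExtend φ (Y v)) := by
    intro φ hφ hφc hφs hG d hd h1 h2
    refine ⟨(contDiff_clampExtend hκ hφ hφs).comp hYs, ⟨c₀, hc₀, fun v => hφc _ (max_min_mem _)⟩,
      hG, fun x hx => ?_, fun x hx => ?_⟩
    · have : Y x < κ := by
        rw [← hYU κ]; exact hYm (by linarith)
      rw [clampExtend_left hκ hφ hφs this, hY0, clampExtend_eq _ ⟨le_rfl, zero_le_one⟩]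
    · have : 1 - κ < Y x := by
        rw [← hYU (1 - κ)]; exact hYm (by linarith)
      rw [clampExtend_right hκ hφ hφs this, hY1, clampExtend_eq _ ⟨zero_le_one, le_rfl⟩]
  refine ⟨fun v => Θ (Y v), fun v => V (Y v),
    min ((u 1 - u 0) / 16) (min ((U κ - u 0) / 16) ((u 1 - U (1 - κ)) / 16)),
    by refine lt_min ?_ (lt_min ?_ ?_) <;> linarith, fun d hd hdδ => ?_, fun v hv => ?_⟩
  · have h1 := hdδ.trans (min_le_left _ _)
    have h2 := (hdδ.trans (min_le_right _ _)).trans (min_le_left _ _)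
    have h3 := (hdδ.trans (min_le_right _ _)).trans (min_le_right _ _)
    exact ⟨by linarith, hcoef θ hθ hθ_pos hθ_supp hϑG d hd (by linarith) (by linarith),
      hcoef (deriv u) hu' hu_mono hu_supp hbG d hd (by linarith) (by linarith)⟩
  · have hYv : Y v ∈ Icc (0 : ℝ) 1 := by
      rw [← hY0, ← hY1]
      exact ⟨hYm.monotone hv.1, hYm.monotone hv.2⟩
    have huY : u (Y v) = v := by rw [← hUu _ hYv, hUY]
    constructor
    · conv_lhs => rw [← huY]
      exact (tilde_eq hinj hYv).trans (clampExtend_eq _ hYv).symm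
    · conv_lhs => rw [← huY]
      exact (tilde_eq hinj hYv).trans (clampExtend_eq _ hYv).symm

/-- Gevrey cutoff functions, built from a nonzero Gevrey function with compact support. -/
lemma exists_gevrey_cutoff {s α β d : ℝ} (hs : 0 < s ∧ s < 1) (hd : 0 < d) (hαβ : α < β)
    {Υ : ℝ → ℝ} (hΥ : ContDiff ℝ (⊤ : ℕ∞) Υ) (hG : IsGevreyOn s univ Υ)
    (hΥs : ∀ x, x ∉ Icc α β → Υ x = 0) (hne : ∃ x, Υ x ≠ 0) :
    ∃ χ : ℝ → ℂ, UniformGevrey s (univ : Set Unit) univ (fun _ => 1) (fun _ => χ) ∧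
      (∀ x ∈ Icc α β, χ x = 1) ∧ ∀ x, x ∉ Icc (α - 2 * d) (β + 2 * d) → χ x = 0 := by
  -- Υ² is a nonnegative Gevrey bump, so its normalized primitive ρ is a Gevrey step from 0 at α to
  -- 1 at β. Existence of Gevrey cutoffs thus follows from the given nonzero Υ.
  set ψ : ℝ → ℝ := fun x => Υ x ^ 2 with hψ
  have hψc : Continuous ψ := hΥ.continuous.pow 2
  have hψ0 : ∀ x, x ∉ Icc α β → ψ x = 0 := fun x hx => by simp [hψ, hΥs x hx]
  set T : ℝ := ∫ x in α..β, ψ x with hT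
  have hTpos : 0 < T := by
    obtain ⟨x₀, hx₀⟩ := hne
    have hx₀' : x₀ ∈ Icc α β := by
      by_contra h
      exact hx₀ (hΥs _ h)
    exact intervalIntegral.integral_pos hαβ hψc.continuousOn (fun x _ => sq_nonneg _)
      ⟨x₀, hx₀', by positivity⟩
  set ρ : ℝ → ℂ := fun x => ((T⁻¹ * ∫ y in α..x, ψ y : ℝ) : ℂ) with hρ
  have hρd : ∀ x, HasDerivAt ρ (((T⁻¹ : ℝ) : ℂ) * ((Υ x : ℂ) * (Υ x : ℂ))) x := fun x => by
    have := ((intervalIntegral.integral_hasDerivAt_right (hψc.intervalIntegrable α x)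
      (hψc.stronglyMeasurableAtFilter _ _) hψc.continuousAt).const_mul T⁻¹).ofReal_comp
    refine this.congr_deriv ?_
    simp only [hψ]; push_cast; ring
  have hρ0 : ∀ x ≤ α, ρ x = 0 := fun x hx => by
    have : ∫ y in α..x, ψ y = ∫ y in α..x, (0 : ℝ) := by
      refine intervalIntegral.integral_congr_ae (Filter.Eventually.mono
        (measure_eq_zero_iff_ae_notMem.mp (measure_singleton α)) fun y hy hy' => ?_)
      rw [uIoc_of_ge hx] at hy'
      exact hψ0 y fun h => hy (le_antisymm hy'.2 h.1)
    simp [hρ, this]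
  have hρ1 : ∀ x, β ≤ x → ρ x = 1 := fun x hx => by
    have : ∫ y in α..x, ψ y = T := by
      rw [← intervalIntegral.integral_add_adjacent_intervals (hψc.intervalIntegrable α β)
        (hψc.intervalIntegrable β x)]
      have : ∫ y in β..x, ψ y = ∫ y in β..x, (0 : ℝ) := by
        refine intervalIntegral.integral_congr_ae (Filter.Eventually.of_forall fun y hy => ?_)
        rw [uIoc_of_le hx] at hy
        exact hψ0 y fun h => by linarith [h.2, hy.1]
      rw [this]; simp [hT]
    simp only [hρ, this]
    rw [inv_mul_cancel₀ hTpos.ne']; simp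
  have hρs : ContDiff ℝ (⊤ : ℕ∞) ρ := by
    have hΥC : ContDiff ℝ (⊤ : ℕ∞) fun x => (Υ x : ℂ) := Complex.ofRealCLM.contDiff.comp hΥ
    refine contDiff_infty_iff_deriv.mpr ⟨fun x => (hρd x).differentiableAt, ?_⟩
    rw [show deriv ρ = _ from funext fun x => (hρd x).deriv]
    exact contDiff_const.mul (hΥC.mul hΥC)
  have hρG : ∃ A M : ℝ, 0 < A ∧ 1 ≤ M ∧ ∀ x, GevreyAt s A M ρ x := by
    obtain ⟨A, M, hA, hM, hb⟩ := hG.exists_bound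
    have hΥG : ∀ x, GevreyAt s A M (fun x => (Υ x : ℂ)) x := fun x =>
      ⟨(Complex.ofRealCLM.contDiff.comp hΥ).contDiffAt, fun m => by
        rw [iteratedDeriv_ofReal_comp hΥ, Complex.norm_real]
        exact hb m x trivial⟩
    have hder : ∀ x, GevreyAt s _ M (deriv ρ) x := fun x => by
      rw [show deriv ρ = _ from funext fun x => (hρd x).deriv]
      exact ((hΥG x).mul hs (by linarith) (hΥG x)).const_mul ((T⁻¹ : ℝ) : ℂ)
    refine ⟨1 + 4 * (‖((T⁻¹ : ℝ) : ℂ)‖ * (8 * A * A)), M, by positivity, hM, fun x =>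
      GevreyAt.of_deriv hs hM hρs.contDiffAt ?_ (hder x).bound⟩
    have hnn : ∀ a b : ℝ, a ≤ b → 0 ≤ ∫ y in a..b, ψ y := fun a b h =>
      intervalIntegral.integral_nonneg h fun y _ => sq_nonneg _
    rcases le_total x α with h | h
    · rw [hρ0 x h]; simp
    · rcases le_total β x with h' | h'
      · rw [hρ1 x h']; simp
      · rw [Complex.norm_real, Real.norm_eq_abs, abs_of_nonneg (mul_nonneg (by positivity) (hnn _ _ h)),
          inv_mul_le_one₀ hTpos, hT, ← intervalIntegral.integral_add_adjacent_intervals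
            (hψc.intervalIntegrable α x) (hψc.intervalIntegrable x β)]
        linarith [hnn x β h']
  obtain ⟨A, M, hA, hM, hρG⟩ := hρG
  -- Rescaling by r compresses the transition of the step from length β - α to length 2d. An
  -- increasing and a decreasing copy are multiplied, with transitions just outside [α, β].
  set r := (β - α) / (2 * d) with hr
  have hr0 : 0 < r := div_pos (by linarith) (by linarith)
  have hr1 : r * (2 * d) = β - α := by rw [hr]; field_simp
  -- rescaling
  have hscale : ∀ e c : ℝ, |e| = r → UniformGevrey s (univ : Set Unit) univ (fun _ => 1)
      (fun _ x => ρ (e * x + c)) := fun e c he => by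
    have hcs : ContDiff ℝ (⊤ : ℕ∞) fun x => ρ (x + c) := hρs.comp (contDiff_id.add contDiff_const)
    refine ⟨A, M * max 1 r, hA, one_le_mul_of_one_le_of_one_le hM (le_max_left _ _),
      fun _ _ x _ => ⟨(hcs.comp (contDiff_const.mul contDiff_id)).contDiffAt, fun m => ?_⟩⟩
    have h1 := iteratedDeriv_comp_const_smul (n := m) (hcs.of_le (by exact_mod_cast le_top)) e
    have h2 : iteratedDeriv m (fun x => ρ (x + c)) = fun x => iteratedDeriv m ρ (x + c) := by
      have := iteratedDeriv_comp_add_const m ρ c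
      exact this
    rw [h1, h2, norm_smul, norm_pow, Real.norm_eq_abs, he, mul_one]
    have h3 := (hρG (e * x + c)).bound m
    have := gevreyWeight_pos s m
    calc _ ≤ (max 1 r) ^ m * (A * M ^ m * gevreyWeight s m) := by
          gcongr
          exact le_max_right _ _
      _ = _ := by rw [mul_pow]; ring
  refine ⟨fun x => ρ (r * x + (α - r * (α - 2 * d))) * ρ (-r * x + (α + r * (β + 2 * d))), ?_,
    fun x hx => ?_, fun x hx => ?_⟩
  · have := (hscale r (α - r * (α - 2 * d)) (abs_of_pos hr0)).mul hs
      (hscale (-r) (α + r * (β + 2 * d)) (by rw [abs_neg, abs_of_pos hr0]))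
    simpa using this
  · have h1 := mul_nonneg hr0.le (sub_nonneg.mpr hx.1)
    have h2 := mul_nonneg hr0.le (sub_nonneg.mpr hx.2)
    simp only
    rw [hρ1 _ (by linarith), hρ1 _ (by linarith), one_mul]
  · simp only
    rcases lt_or_ge x (α - 2 * d) with h | h
    · have h1 := mul_pos hr0 (sub_pos.mpr h)
      rw [hρ0 _ (by linarith), zero_mul]
    · have h' : β + 2 * d < x := by
        by_contra h'
        exact hx ⟨h, not_lt.mp h'⟩
      have h1 := mul_pos hr0 (sub_pos.mpr h')
      rw [hρ0 (-r * x + (α + r * (β + 2 * d))) (by linarith), mul_zero]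

/-! ### Decay of Fourier transforms of Gevrey functions -/

lemma norm_cexp_neg_I_mul (v x : ℝ) : ‖Complex.exp (-(Complex.I * v * x))‖ = 1 := by
  rw [show -(Complex.I * v * x) = ((-(v * x) : ℝ) : ℂ) * Complex.I by push_cast; ring]
  exact Complex.norm_exp_ofReal_mul_I _

lemma continuous_cexp_neg_I_mul (x : ℝ) :
    Continuous fun v : ℝ => Complex.exp (-(Complex.I * v * x)) := by fun_prop

lemma iteratedDeriv_eq_zero_of_support {f : ℝ → ℂ} {a b : ℝ} (hf : ∀ x, x ∉ Icc a b → f x = 0)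
    (m : ℕ) {x : ℝ} (hx : x ∉ Icc a b) : iteratedDeriv m f x = 0 := by
  have h : f =ᶠ[𝓝 x] fun _ => 0 := by
    filter_upwards [isClosed_Icc.isOpen_compl.mem_nhds hx] with y hy using hf y hy
  rw [h.iteratedDeriv_eq]
  simp

lemma integrable_of_continuous_of_support {f : ℝ → ℂ} {a b : ℝ} (hc : Continuous f)
    (hf : ∀ x, x ∉ Icc a b → f x = 0) : Integrable f :=
  hc.integrable_of_hasCompactSupport (HasCompactSupport.intro isCompact_Icc hf)

lemma integral_iteratedDeriv_mul_cexp {f : ℝ → ℂ} {a b : ℝ} (hs : ContDiff ℝ (⊤ : ℕ∞) f)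
    (hf : ∀ x, x ∉ Icc a b → f x = 0) (x : ℝ) (m : ℕ) :
    ∫ v, iteratedDeriv m f v * Complex.exp (-(Complex.I * v * x)) =
      (Complex.I * x) ^ m * ∫ v, f v * Complex.exp (-(Complex.I * v * x)) := by
  induction m with
  | zero => simp
  | succ m ih =>
    have hc : ∀ n, Continuous (iteratedDeriv n f) := fun n =>
      hs.continuous_iteratedDeriv n (by exact_mod_cast le_top)
    have hint : ∀ n, ∀ g : ℝ → ℂ, Continuous g → Integrable fun v => iteratedDeriv n f v * g v :=
      fun n g hg => integrable_of_continuous_of_support ((hc n).mul hg) fun v hv => by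
        rw [iteratedDeriv_eq_zero_of_support hf n hv, zero_mul]
    have hd : ∀ v, HasDerivAt (iteratedDeriv m f) (iteratedDeriv (m + 1) f v) v := fun v => by
      rw [iteratedDeriv_succ]
      exact (hs.differentiable_iteratedDeriv m (by exact_mod_cast WithTop.coe_lt_top _) v).hasDerivAt
    have he : ∀ v : ℝ, HasDerivAt (fun v : ℝ => Complex.exp (-(Complex.I * v * x)))
        (-(Complex.I * x) * Complex.exp (-(Complex.I * v * x))) v := fun v => by
      have := (((hasDerivAt_id v).ofReal_comp.const_mul Complex.I).mul_const (x : ℂ)).neg.cexp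
      refine this.congr_deriv ?_
      simp; ring
    have hec := continuous_cexp_neg_I_mul x
    have key := integral_mul_deriv_eq_deriv_mul_of_integrable (fun v _ => hd v) (fun v _ => he v)
      (hint m _ (continuous_const.mul hec)) (hint (m + 1) _ hec) (hint m _ hec)
    have e : ∀ v : ℝ, iteratedDeriv m f v * (-(Complex.I * x) * Complex.exp (-(Complex.I * v * x))) =
        -(Complex.I * x) * (iteratedDeriv m f v * Complex.exp (-(Complex.I * v * x))) := fun v => by ring
    simp only [e] at key
    rw [integral_const_mul, ih] at key
    rw [pow_succ]
    linear_combination key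

lemma norm_integral_mul_cexp_le {f : ℝ → ℂ} {a b D : ℝ} (hab : a ≤ b)
    (hf : ∀ x, x ∉ Icc a b → f x = 0) (hD : ∀ x, ‖f x‖ ≤ D) (x : ℝ) :
    ‖∫ v, f v * Complex.exp (-(Complex.I * v * x))‖ ≤ D * (b - a) := by
  rw [← setIntegral_eq_integral_of_forall_compl_eq_zero (s := Icc a b)
    (fun v hv => by rw [hf v hv, zero_mul])]
  refine (norm_setIntegral_le_of_norm_le_const (C := D) (by simp) fun v _ => ?_).trans_eq ?_
  · rw [norm_mul, norm_cexp_neg_I_mul, mul_one]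
    exact hD v
  · simp [Measure.real, hab]

/-- Subadditivity of the power s ≤ 1 applied to ⟨x⟩ ≤ 1 + |x|. -/
lemma bracket_rpow_le {s : ℝ} (hs : 0 < s ∧ s < 1) (x : ℝ) : bracket x ^ s ≤ 1 + |x| ^ s := by
  have h1 : bracket x ≤ 1 + |x| := by
    rw [bracket]
    refine Real.sqrt_le_iff.mpr ⟨by positivity, ?_⟩
    nlinarith [abs_nonneg x, sq_abs x]
  calc bracket x ^ s ≤ (1 + |x|) ^ s :=
        Real.rpow_le_rpow (Real.sqrt_nonneg _) h1 hs.1.le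
    _ ≤ 1 ^ s + |x| ^ s := Real.rpow_add_le_add_rpow zero_le_one (abs_nonneg x) hs.1.le hs.2.le
    _ = 1 + |x| ^ s := by rw [Real.one_rpow]

lemma gevreyWeight_le_rpow {s : ℝ} (hs : 0 < s ∧ s < 1) (m : ℕ) :
    gevreyWeight s m ≤ ((m : ℝ) ^ (1 / s)) ^ m := by
  have h1s : 0 ≤ 1 / s := by have := hs.1; positivity
  rw [gevreyWeight, ← Real.rpow_natCast ((m : ℝ) ^ (1 / s)), ← Real.rpow_mul (by positivity),
    mul_comm (1 / s), Real.rpow_mul (by positivity), Real.rpow_natCast]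
  refine (div_le_self (by positivity) (one_le_pow₀ (by linarith [show (0 : ℝ) ≤ m by positivity]))).trans ?_
  refine Real.rpow_le_rpow (by positivity) ?_ h1s
  exact_mod_cast Nat.factorial_le_pow m

/-- Factorial moment bounds give stretched exponential decay. -/
lemma le_exp_of_moments {s M D K x : ℝ} (hs : 0 < s ∧ s < 1) (hM : 0 < M) (hD : 0 ≤ D)
    (h : ∀ m : ℕ, |x| ^ m * K ≤ D * M ^ m * gevreyWeight s m) :
    K ≤ D * Real.exp (1 + (Real.exp 1 * M)⁻¹ ^ s) *
      Real.exp (-(Real.exp 1 * M)⁻¹ ^ s * bracket x ^ s) := by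
  set lam := (Real.exp 1 * M)⁻¹ ^ s with hlam
  have hlam0 : 0 < lam := Real.rpow_pos_of_pos (by positivity) _
  set y := lam * |x| ^ s with hy
  have hy0 : 0 ≤ y := by positivity
  -- With m ≤ λ|x|^s and λ = (eM)^{-s} one has m^{1/s} e M ≤ |x|, so the m-th moment bound gives
  -- e^{-m}. Rounding down costs the factor e in the constant.
  set m := ⌊y⌋₊ with hm
  have hmy : (m : ℝ) ≤ y := Nat.floor_le hy0
  have hym : y < m + 1 := Nat.lt_floor_add_one y
  have hroot : (m : ℝ) ^ (1 / s) * (Real.exp 1 * M) ≤ |x| := by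
    have h1 : (m : ℝ) ^ (1 / s) ≤ y ^ (1 / s) :=
      Real.rpow_le_rpow (by positivity) hmy (by have := hs.1; positivity)
    have h2 : y ^ (1 / s) = (Real.exp 1 * M)⁻¹ * |x| := by
      rw [hy, hlam, ← Real.mul_rpow (by positivity) (abs_nonneg x), ← Real.rpow_mul (by positivity),
        mul_one_div_cancel hs.1.ne', Real.rpow_one]
    rw [h2] at h1
    calc _ ≤ (Real.exp 1 * M)⁻¹ * |x| * (Real.exp 1 * M) := by gcongr
      _ = |x| := by field_simp
  have hK : K ≤ D * Real.exp (-m) := by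
    have h1 := h m
    have h2 : D * M ^ m * gevreyWeight s m ≤ D * Real.exp (-m) * |x| ^ m := by
      calc _ ≤ D * M ^ m * ((m : ℝ) ^ (1 / s)) ^ m := by
            gcongr; exact gevreyWeight_le_rpow hs m
        _ = D * Real.exp (-m) * ((m : ℝ) ^ (1 / s) * (Real.exp 1 * M)) ^ m := by
            have : Real.exp (-m) * Real.exp 1 ^ m = 1 := by
              rw [← Real.exp_nat_mul, ← Real.exp_add]; simp
            rw [mul_pow, mul_pow]
            linear_combination (-(D * M ^ m * ((m : ℝ) ^ (1 / s)) ^ m)) * this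
        _ ≤ _ := by gcongr
    rcases eq_or_ne x 0 with rfl | hx
    · have hm0 : m = 0 := by
        rw [hm, hy, abs_zero, Real.zero_rpow hs.1.ne', mul_zero, Nat.floor_zero]
      rw [hm0] at h1 ⊢
      simpa [gevreyWeight_zero] using h1
    · have hpos : 0 < |x| ^ m := pow_pos (abs_pos.mpr hx) m
      refine le_of_mul_le_mul_left ?_ hpos
      linarith
  refine hK.trans ?_
  rw [mul_assoc, ← Real.exp_add]
  gcongr
  have := mul_le_mul_of_nonneg_left (bracket_rpow_le hs x) hlam0.le
  have e : lam * (1 + |x| ^ s) = lam + y := by rw [hy]; ring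
  linarith

/-- Integrating by parts m times bounds |x|^m times the transform by the sup of the m-th derivative
times the length of the support. These are the moment bounds of `le_exp_of_moments`, uniform in the
index. -/
lemma exists_fourier_decay {ι : Type*} {s a b : ℝ} (hs : 0 < s ∧ s < 1) {w : ι → ℝ}
    {H : ι → ℝ → ℂ} (hab : a < b) (hH : UniformGevrey s univ univ w H)
    (hsupp : ∀ i x, x ∉ Icc a b → H i x = 0) :
    ∃ C lam : ℝ, 0 < C ∧ 0 < lam ∧ ∀ i (x : ℝ),
      ‖∫ v, H i v * Complex.exp (-(Complex.I * v * x))‖ ≤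
        C * w i * Real.exp (-lam * bracket x ^ s) := by
  obtain ⟨A, M, hA, hM, hH⟩ := hH
  have hM0 : 0 < M := by linarith
  refine ⟨A * (b - a) * Real.exp (1 + (Real.exp 1 * M)⁻¹ ^ s), (Real.exp 1 * M)⁻¹ ^ s,
    mul_pos (mul_pos hA (by linarith)) (Real.exp_pos _), Real.rpow_pos_of_pos (by positivity) _,
    fun i x => ?_⟩
  have hsm : ContDiff ℝ (⊤ : ℕ∞) (H i) := contDiff_iff_contDiffAt.mpr fun x => (hH i trivial x trivial).smooth
  have hAw : 0 ≤ A * w i := (hH i trivial 0 trivial).nonneg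
  have := le_exp_of_moments (K := ‖∫ v, H i v * Complex.exp (-(Complex.I * v * x))‖) (x := x)
    (D := A * w i * (b - a)) hs hM0 (mul_nonneg hAw (by linarith)) fun m => ?_
  · calc _ ≤ _ := this
      _ = _ := by ring
  · have h1 := norm_integral_mul_cexp_le hab.le
      (fun x hx => iteratedDeriv_eq_zero_of_support (hsupp i) m hx)
      (fun x => (hH i trivial x trivial).bound m) x
    rw [integral_iteratedDeriv_mul_cexp hsm (hsupp i), norm_mul, norm_pow, norm_mul, Complex.norm_I,
      one_mul, Complex.norm_real, Real.norm_eq_abs] at h1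
    exact h1.trans_eq (by ring)

/-- Both the quadratic and the stretched exponential decay of the Fourier transform. -/
lemma exists_fourier_decay_sq {ι : Type*} {s a b : ℝ} (hs : 0 < s ∧ s < 1) {w : ι → ℝ}
    {H : ι → ℝ → ℂ} (hab : a < b) (hH : UniformGevrey s univ univ w H)
    (hsupp : ∀ i x, x ∉ Icc a b → H i x = 0) :
    ∃ C lam : ℝ, 0 < C ∧ 0 < lam ∧ ∀ i (x : ℝ),
      (1 + x ^ 2) * ‖∫ v, H i v * Complex.exp (-(Complex.I * v * x))‖ ≤
        C * w i * Real.exp (-lam * bracket x ^ s) := by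
  -- The transform of H - H'' is (1 + x²) times that of H, and H - H'' obeys the same kind of Gevrey
  -- bounds.
  have hH2 : UniformGevrey s univ univ w (fun i x => H i x - iteratedDeriv 2 (H i) x) := by
    have := hH.sub ((hH.deriv hs).deriv hs)
    simpa only [iteratedDeriv_succ, iteratedDeriv_zero] using this
  obtain ⟨C, lam, hC, hlam, h⟩ := exists_fourier_decay hs hab hH2 fun i x hx => by
    rw [hsupp i x hx, iteratedDeriv_eq_zero_of_support (hsupp i) 2 hx, sub_zero]
  refine ⟨C, lam, hC, hlam, fun i x => le_trans (le_of_eq ?_) (h i x)⟩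
  have hsm : ContDiff ℝ (⊤ : ℕ∞) (H i) := contDiff_iff_contDiffAt.mpr fun x =>
    hH.contDiffAt (i := i) trivial (x := x) trivial
  have hec := continuous_cexp_neg_I_mul x
  have hcd : ∀ n : ℕ, Continuous (iteratedDeriv n (H i)) := fun n =>
    hsm.continuous_iteratedDeriv n (by exact_mod_cast le_top)
  have h1 : ∫ v, (H i v - iteratedDeriv 2 (H i) v) * Complex.exp (-(Complex.I * v * x)) =
      (1 + x ^ 2 : ℝ) * ∫ v, H i v * Complex.exp (-(Complex.I * v * x)) := by
    simp only [sub_mul]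
    rw [integral_sub, integral_iteratedDeriv_mul_cexp hsm (hsupp i)]
    · rw [mul_pow, Complex.I_sq]; push_cast; ring
    · exact integrable_of_continuous_of_support (hsm.continuous.mul hec) fun v hv => by
        rw [hsupp i v hv, zero_mul]
    · exact integrable_of_continuous_of_support
        ((hcd 2).mul hec) fun v hv => by
        rw [iteratedDeriv_eq_zero_of_support (hsupp i) 2 hv, zero_mul]
  rw [h1, norm_mul, Complex.norm_real, Real.norm_eq_abs, abs_of_pos (by positivity)]

/-! ### Fourier inversion -/

lemma continuous_integral_mul_cexp {f : ℝ → ℂ} (hf : Integrable f) :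
    Continuous fun x : ℝ => ∫ v : ℝ, f v * Complex.exp (-(Complex.I * v * x)) := by
  refine continuous_of_dominated (bound := fun v => ‖f v‖) (fun x => ?_) (fun x => ?_) hf.norm ?_
  · exact hf.aestronglyMeasurable.mul (continuous_cexp_neg_I_mul x).aestronglyMeasurable
  · exact Filter.Eventually.of_forall fun v => by rw [norm_mul, norm_cexp_neg_I_mul, mul_one]
  · exact Filter.Eventually.of_forall fun v => by fun_prop

lemma norm_integral_mul_cexp_le_integral_norm (f : ℝ → ℂ) (x : ℝ) :
    ‖∫ v : ℝ, f v * Complex.exp (-(Complex.I * v * x))‖ ≤ ∫ v, ‖f v‖ :=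
  (norm_integral_le_integral_norm _).trans_eq (by simp only [norm_mul, norm_cexp_neg_I_mul, mul_one])

/-- The Fourier transform with the normalization of a convolution kernel. -/
noncomputable def kernelFT (H : ℝ → ℂ) (x : ℝ) : ℂ :=
  (1 / (2 * (Real.pi : ℂ))) * ∫ v : ℝ, H v * Complex.exp (-(Complex.I * v * x))

/-- Fourier inversion, transferred from the convention with 2π in the exponent by the dilation x ↦
2πx. -/
lemma integral_kernelFT_mul_cexp {H : ℝ → ℂ} (hc : Continuous H) (hi : Integrable H)
    (hK : Integrable (kernelFT H)) (v : ℝ) :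
    ∫ x : ℝ, kernelFT H x * Complex.exp (Complex.I * v * x) = H v := by
  have hpi : (0 : ℝ) < 2 * Real.pi := by positivity
  have hF : ∀ w : ℝ, FourierTransform.fourier H w = (2 * Real.pi : ℂ) * kernelFT H (2 * Real.pi * w) := by
    intro w
    rw [Real.fourier_real_eq_integral_exp_smul, kernelFT, ← mul_assoc,
      mul_one_div_cancel (by exact_mod_cast hpi.ne'), one_mul]
    congr 1
    funext y
    rw [smul_eq_mul, mul_comm]
    congr 2
    push_cast
    ring
  have hFi : Integrable (FourierTransform.fourier H) := by
    rw [show FourierTransform.fourier H = _ from funext hF]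
    exact (hK.comp_mul_left' hpi.ne').const_mul _
  have hinv := congrFun (hc.fourierInv_fourier_eq hi hFi) v
  rw [Real.fourierInv_eq'] at hinv
  rw [← hinv]
  have := Measure.integral_comp_mul_left
    (fun x : ℝ => kernelFT H x * Complex.exp (Complex.I * v * x)) (2 * Real.pi)
  rw [abs_of_pos (inv_pos.mpr hpi)] at this
  have h2 : ∫ x : ℝ, kernelFT H x * Complex.exp (Complex.I * v * x) = (2 * Real.pi : ℂ) *
      ∫ x : ℝ, kernelFT H (2 * Real.pi * x) * Complex.exp (Complex.I * v * (2 * Real.pi * x : ℝ)) := by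
    rw [this, Complex.real_smul, ← mul_assoc]
    push_cast
    rw [mul_inv_cancel₀ (by exact_mod_cast hpi.ne'), one_mul]
  rw [h2, ← integral_const_mul]
  congr 1
  funext w
  have e : Complex.exp (((2 * Real.pi * inner ℝ w v : ℝ) : ℂ) * Complex.I) =
      Complex.exp (Complex.I * v * (2 * Real.pi * w : ℝ)) := by
    congr 1
    rw [real_inner_eq_re_inner]
    simp
    ring
  rw [hF, smul_eq_mul, e]
  ring

/-- The Fourier transform of a product is a convolution. -/
lemma integral_kernelFT_mul_fourier {H ω : ℝ → ℂ} (hc : Continuous H) (hi : Integrable H)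
    (hK : Integrable (kernelFT H)) (hω : Integrable ω) (ξ : ℝ) :
    Integrable (fun η : ℝ => kernelFT H (ξ - η) * ∫ v : ℝ, ω v * Complex.exp (-(Complex.I * v * η))) ∧
    ∫ η : ℝ, kernelFT H (ξ - η) * ∫ v : ℝ, ω v * Complex.exp (-(Complex.I * v * η)) =
      ∫ v : ℝ, ω v * H v * Complex.exp (-(Complex.I * v * ξ)) := by
  have hKξ : Integrable fun η => kernelFT H (ξ - η) := hK.comp_sub_left ξ
  refine ⟨hKξ.mul_bdd (continuous_integral_mul_cexp hω).aestronglyMeasurable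
    (Filter.Eventually.of_forall fun η => norm_integral_mul_cexp_le_integral_norm ω η), ?_⟩
  -- Absolute integrability on the product justifies the exchange of integrals; the inner integral
  -- then becomes H(v) by inversion.
  have hprod : Integrable (fun p : ℝ × ℝ => kernelFT H (ξ - p.1) * ω p.2 *
      Complex.exp (-(Complex.I * p.2 * p.1))) (volume.prod volume) :=
    (hKξ.mul_prod hω).mul_bdd (c := 1) (Continuous.aestronglyMeasurable (by fun_prop))
      (Filter.Eventually.of_forall fun p => (norm_cexp_neg_I_mul p.2 p.1).le)
  calc _ = ∫ η : ℝ, ∫ v : ℝ, kernelFT H (ξ - η) * ω v * Complex.exp (-(Complex.I * v * η)) := by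
        simp only [mul_assoc, integral_const_mul]
    _ = ∫ v : ℝ, ∫ η : ℝ, kernelFT H (ξ - η) * ω v * Complex.exp (-(Complex.I * v * η)) :=
        integral_integral_swap hprod
    _ = _ := by
        congr 1
        funext v
        have h1 : ∀ η : ℝ, kernelFT H (ξ - η) * ω v * Complex.exp (-(Complex.I * v * η)) =
            ω v * Complex.exp (-(Complex.I * v * ξ)) *
              (kernelFT H (ξ - η) * Complex.exp (Complex.I * v * (ξ - η : ℝ))) := fun η => by
          have : Complex.exp (-(Complex.I * v * η)) = Complex.exp (-(Complex.I * v * ξ)) *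
              Complex.exp (Complex.I * v * (ξ - η : ℝ)) := by
            rw [← Complex.exp_add]
            congr 1
            push_cast
            ring
          rw [this]
          ring
        simp only [h1]
        rw [integral_const_mul, integral_sub_left_eq_self
          (fun x : ℝ => kernelFT H x * Complex.exp (Complex.I * v * x)) volume ξ,
          integral_kernelFT_mul_cexp hc hi hK]
        ring

/-- The kernel attached to a Gevrey family with elliptic gain. -/
lemma exists_kernel_bound {s a b : ℝ} (hs : 0 < s ∧ s < 1) {H : ℕ × ℝ → ℝ → ℂ} (hab : a < b)
    (hH : UniformGevrey s univ univ
      (fun i : ℕ × ℝ => (1 + (i.1 : ℝ) + |i.2|)⁻¹ * (1 + (i.1 : ℝ) + |i.2|)⁻¹) H)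
    (hsupp : ∀ i x, x ∉ Icc a b → H i x = 0) :
    ∃ C lam : ℝ, 0 < C ∧ 0 < lam ∧ (∀ i, Integrable (kernelFT (H i))) ∧ ∀ (k : ℕ) (ξ η : ℝ),
      ‖kernelFT (H (k, ξ)) (ξ - η)‖ ≤ C * min
        (Real.exp (-lam * bracket (ξ - η) ^ s) / (1 + (k : ℝ) ^ 2 + ξ ^ 2))
        (Real.exp (-lam * bracket (ξ - η) ^ s) / (1 + (k : ℝ) ^ 2 + η ^ 2)) := by
  obtain ⟨C, lam, hC, hlam, h⟩ := exists_fourier_decay_sq hs hab hH hsupp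
  have hsm : ∀ i, ContDiff ℝ (⊤ : ℕ∞) (H i) := fun i => contDiff_iff_contDiffAt.mpr fun x =>
    hH.contDiffAt (i := i) trivial (x := x) trivial
  have hpi1 : ‖(1 / (2 * (Real.pi : ℂ)))‖ ≤ 1 := by
    have : (1 / (2 * (Real.pi : ℂ))) = ((1 / (2 * Real.pi) : ℝ) : ℂ) := by push_cast; rfl
    rw [this, Complex.norm_real, Real.norm_eq_abs, abs_of_pos (by positivity),
      div_le_one (by positivity)]
    linarith [Real.pi_gt_three]
  have hbound : ∀ i (x : ℝ), (1 + x ^ 2) * ‖kernelFT (H i) x‖ ≤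
      C * ((1 + (i.1 : ℝ) + |i.2|)⁻¹ * (1 + (i.1 : ℝ) + |i.2|)⁻¹) *
        Real.exp (-lam * bracket x ^ s) := fun i x => by
    refine le_trans ?_ (h i x)
    rw [kernelFT, norm_mul]
    have := norm_nonneg (∫ v, H i v * Complex.exp (-(Complex.I * v * x)))
    gcongr
    exact mul_le_of_le_one_left this hpi1
  refine ⟨2 * C, lam, by positivity, hlam, fun i => ?_, fun k ξ η => ?_⟩
  · have hHi : Integrable (H i) := integrable_of_continuous_of_support (hsm i).continuous (hsupp i)
    refine (integrable_inv_one_add_sq.const_mul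
      (C * ((1 + (i.1 : ℝ) + |i.2|)⁻¹ * (1 + (i.1 : ℝ) + |i.2|)⁻¹))).mono'
      (continuous_const.mul (continuous_integral_mul_cexp hHi)).aestronglyMeasurable
      (Filter.Eventually.of_forall fun x => ?_)
    have hx : (0 : ℝ) < 1 + x ^ 2 := by positivity
    rw [← div_eq_mul_inv, le_div_iff₀ hx, mul_comm]
    refine (hbound i x).trans (mul_le_of_le_one_right (by positivity) (Real.exp_le_one_iff.mpr ?_))
    have : 0 ≤ bracket x ^ s := Real.rpow_nonneg (Real.sqrt_nonneg _) _
    nlinarith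
  · have hb := hbound (k, ξ) (ξ - η)
    simp only at hb
    set E := Real.exp (-lam * bracket (ξ - η) ^ s)
    have hE : 0 < E := Real.exp_pos _
    have hk : (0 : ℝ) ≤ k := by positivity
    have hw : (1 + (k : ℝ) + |ξ|)⁻¹ * (1 + (k : ℝ) + |ξ|)⁻¹ ≤ (1 + (k : ℝ) ^ 2 + ξ ^ 2)⁻¹ := by
      rw [← mul_inv]
      refine inv_anti₀ (by positivity) ?_
      nlinarith [abs_nonneg ξ, sq_abs ξ, mul_nonneg hk (abs_nonneg ξ)]
    have hb' : (1 + (ξ - η) ^ 2) * ‖kernelFT (H (k, ξ)) (ξ - η)‖ * (1 + (k : ℝ) ^ 2 + ξ ^ 2) ≤ C * E := by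
      calc _ ≤ C * (1 + (k : ℝ) ^ 2 + ξ ^ 2)⁻¹ * E * (1 + (k : ℝ) ^ 2 + ξ ^ 2) := by
            refine mul_le_mul_of_nonneg_right (hb.trans ?_) (by positivity)
            gcongr
        _ = C * E := by field_simp
    set K := ‖kernelFT (H (k, ξ)) (ξ - η)‖
    have hK : 0 ≤ K := norm_nonneg _
    rw [mul_min_of_nonneg _ _ (by positivity)]
    refine le_min ?_ ?_
    · rw [← mul_div_assoc, le_div_iff₀ (by positivity)]
      refine le_trans (b := (1 + (ξ - η) ^ 2) * K * (1 + (k : ℝ) ^ 2 + ξ ^ 2)) ?_ (by nlinarith)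
      gcongr
      exact le_mul_of_one_le_left hK (by nlinarith [sq_nonneg (ξ - η)])
    · rw [← mul_div_assoc, le_div_iff₀ (by positivity)]
      -- Peetre's inequality: the spare quadratic decay in ξ - η exchanges the weight at ξ for the
      -- weight at η. Its constant is the factor 2 in the final bound.
      have h1 : 1 + (k : ℝ) ^ 2 + η ^ 2 ≤ 2 * ((1 + (ξ - η) ^ 2) * (1 + (k : ℝ) ^ 2 + ξ ^ 2)) := by
        nlinarith [sq_nonneg (2 * ξ - η), mul_nonneg (sq_nonneg (ξ - η)) (sq_nonneg ξ),
          mul_nonneg (sq_nonneg (ξ - η)) (sq_nonneg (k : ℝ)), sq_nonneg (k : ℝ)]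
      calc K * (1 + (k : ℝ) ^ 2 + η ^ 2) ≤
            K * (2 * ((1 + (ξ - η) ^ 2) * (1 + (k : ℝ) ^ 2 + ξ ^ 2))) := by gcongr
        _ = 2 * ((1 + (ξ - η) ^ 2) * K * (1 + (k : ℝ) ^ 2 + ξ ^ 2)) := by ring
        _ ≤ 2 * (C * E) := by gcongr
        _ = 2 * C * E := by ring

/-! ### Fourier modes of the elliptic equation -/

section modes

variable {α β t : ℝ} {f g : ℝ → ℝ → ℂ}

lemma continuousOn_fourierZ {K : Set ℝ} (hf : ContinuousOn (Function.uncurry f) (univ ×ˢ K)) (k : ℤ) :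
    ContinuousOn (fourierZ f k) K := by
  rw [continuousOn_iff_continuous_domRestrict]
  have hc : Continuous fun p : K × ℝ => f p.2 p.1 :=
    hf.comp_continuous (f := fun p : K × ℝ => (p.2, (p.1 : ℝ))) (by fun_prop)
      fun p => ⟨trivial, p.1.2⟩
  exact continuous_const.mul (intervalIntegral.continuous_parametric_intervalIntegral_of_continuous'
    (f := fun (x : K) (z : ℝ) => f z x * Complex.exp (-(Complex.I * z * k)))
    (hc.mul (by fun_prop)) 0 (2 * Real.pi))

lemma continuous_slice {K : Set ℝ} (hf : ContinuousOn (Function.uncurry f) (univ ×ˢ K)) {v : ℝ}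
    (hv : v ∈ K) : Continuous fun z => f z v :=
  hf.comp_continuous (f := fun z : ℝ => (z, v)) (by fun_prop) fun _ => ⟨trivial, hv⟩

lemma fourierZ_linear {v : ℝ} (hf : Continuous fun z => f z v) (hg : Continuous fun z => g z v)
    (c d : ℝ → ℂ) (k : ℤ) :
    fourierZ (fun z v => c v * f z v + d v * g z v) k v =
      c v * fourierZ f k v + d v * fourierZ g k v := by
  have he : Continuous fun z : ℝ => Complex.exp (-(Complex.I * z * k)) := by fun_prop
  have h1 : ∀ z : ℝ, (c v * f z v + d v * g z v) * Complex.exp (-(Complex.I * z * k)) =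
      c v * (f z v * Complex.exp (-(Complex.I * z * k))) +
        d v * (g z v * Complex.exp (-(Complex.I * z * k))) := fun z => by ring
  have hi : ∀ (a : ℂ) (h : ℝ → ℂ), Continuous h → IntervalIntegrable
      (fun z : ℝ => a * (h z * Complex.exp (-(Complex.I * z * k)))) volume 0 (2 * Real.pi) :=
    fun a h hh => (continuous_const.mul (hh.mul he)).intervalIntegrable _ _
  simp only [fourierZ, h1]
  rw [intervalIntegral.integral_add (hi _ _ hf) (hi _ _ hg),
    intervalIntegral.integral_const_mul, intervalIntegral.integral_const_mul]
  ring

lemma isOpen_strip : IsOpen ((univ : Set ℝ) ×ˢ Ioo α β) := isOpen_univ.prod isOpen_Ioo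

lemma hasDerivAt_slice_fst {n : WithTop ℕ∞} (hn : n ≠ 0)
    (hf : ContDiffOn ℝ n (Function.uncurry f) (univ ×ˢ Ioo α β)) (z : ℝ) {v : ℝ} (hv : v ∈ Ioo α β) :
    HasDerivAt (fun z' => f z' v) (fderiv ℝ (Function.uncurry f) (z, v) (1, 0)) z := by
  have h := ((hf.contDiffAt (isOpen_strip.mem_nhds ⟨trivial, hv⟩)).differentiableAt hn
    (x := (z, v))).hasFDerivAt
  exact h.comp_hasDerivAt z ((hasDerivAt_id z).prodMk (hasDerivAt_const z v))

lemma hasDerivAt_slice_snd {n : WithTop ℕ∞} (hn : n ≠ 0)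
    (hf : ContDiffOn ℝ n (Function.uncurry f) (univ ×ˢ Ioo α β)) (z : ℝ) {v : ℝ} (hv : v ∈ Ioo α β) :
    HasDerivAt (fun v' => f z v') (fderiv ℝ (Function.uncurry f) (z, v) (0, 1)) v := by
  have h := ((hf.contDiffAt (isOpen_strip.mem_nhds ⟨trivial, hv⟩)).differentiableAt hn
    (x := (z, v))).hasFDerivAt
  exact h.comp_hasDerivAt v ((hasDerivAt_const v z).prodMk (hasDerivAt_id v))

lemma ne_zero_of_add_one_le {m n : WithTop ℕ∞} (hmn : m + 1 ≤ n) : n ≠ 0 := by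
  rintro rfl
  simp at hmn

lemma contDiffOn_dz {m n : WithTop ℕ∞} (hmn : m + 1 ≤ n)
    (hf : ContDiffOn ℝ n (Function.uncurry f) (univ ×ˢ Ioo α β)) :
    ContDiffOn ℝ m (Function.uncurry (dz f)) (univ ×ˢ Ioo α β) :=
  ((hf.fderiv_of_isOpen isOpen_strip hmn).clm_apply contDiffOn_const).congr fun p hp =>
    (hasDerivAt_slice_fst (ne_zero_of_add_one_le hmn) hf p.1 hp.2).deriv

lemma contDiffOn_dv {m n : WithTop ℕ∞} (hmn : m + 1 ≤ n)
    (hf : ContDiffOn ℝ n (Function.uncurry f) (univ ×ˢ Ioo α β)) :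
    ContDiffOn ℝ m (Function.uncurry fun z v => deriv (fun v' => f z v') v) (univ ×ˢ Ioo α β) :=
  ((hf.fderiv_of_isOpen isOpen_strip hmn).clm_apply contDiffOn_const).congr fun p hp =>
    (hasDerivAt_slice_snd (ne_zero_of_add_one_le hmn) hf p.1 hp.2).deriv

lemma contDiffOn_dvt {m n : WithTop ℕ∞} (hmn : m + 1 ≤ n)
    (hf : ContDiffOn ℝ n (Function.uncurry f) (univ ×ˢ Ioo α β)) :
    ContDiffOn ℝ m (Function.uncurry (dvt t f)) (univ ×ˢ Ioo α β) :=
  (contDiffOn_dv hmn hf).sub (contDiffOn_const.mul (contDiffOn_dz hmn hf))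

/-- `2π`-periodicity in the first variable. -/
def PeriodicOn (α β : ℝ) (f : ℝ → ℝ → ℂ) : Prop :=
  ∀ z, ∀ v ∈ Ioo α β, f (z + 2 * Real.pi) v = f z v

lemma PeriodicOn.dz (hf : PeriodicOn α β f) : PeriodicOn α β (dz f) := fun z v hv => by
  have h : (fun z' => f z' v) = fun z' => f (z' + 2 * Real.pi) v := funext fun z' => (hf z' v hv).symm
  simp only [DistortedElliptic.dz]
  conv_rhs => rw [h]
  rw [deriv_comp_add_const (fun z' => f z' v)]

lemma PeriodicOn.dvt (hf : PeriodicOn α β f) : PeriodicOn α β (dvt t f) := fun z v hv => by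
  have h : (fun v' => f (z + 2 * Real.pi) v') =ᶠ[𝓝 v] fun v' => f z v' := by
    filter_upwards [isOpen_Ioo.mem_nhds hv] with v' hv' using hf z v' hv'
  have h2 := hf.dz z v hv
  simp only [DistortedElliptic.dz] at h2
  simp only [DistortedElliptic.dvt]
  rw [h.deriv_eq, h2]

lemma hasDerivAt_fourierZ (hf : ContDiffOn ℝ 1 (Function.uncurry f) (univ ×ˢ Ioo α β)) (k : ℤ)
    {v : ℝ} (hv : v ∈ Ioo α β) :
    HasDerivAt (fourierZ f k) (fourierZ (fun z v => deriv (fun v' => f z v') v) k v) v := by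
  have hfv : ContinuousOn (Function.uncurry fun z v => deriv (fun v' => f z v') v)
      (univ ×ˢ Ioo α β) := (contDiffOn_dv (m := 0) (by simp) hf).continuousOn
  have he : Continuous fun z : ℝ => Complex.exp (-(Complex.I * z * k)) := by fun_prop
  obtain ⟨ε, hε, hball⟩ := Metric.nhds_basis_closedBall.mem_iff.mp (isOpen_Ioo.mem_nhds hv)
  have hcpt : IsCompact (Icc 0 (2 * Real.pi) ×ˢ Metric.closedBall v ε) :=
    isCompact_Icc.prod (isCompact_closedBall v ε)
  obtain ⟨C, hC⟩ := hcpt.exists_bound_of_continuousOn (hfv.mono fun p hp => ⟨trivial, hball hp.2⟩)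
  have key := intervalIntegral.hasDerivAt_integral_of_dominated_loc_of_deriv_le (𝕜 := ℝ)
    (μ := volume) (a := 0) (b := 2 * Real.pi)
    (F := fun v z => f z v * Complex.exp (-(Complex.I * z * k)))
    (F' := fun v z => deriv (fun v' => f z v') v * Complex.exp (-(Complex.I * z * k))) (x₀ := v)
    (bound := fun _ => C) (Metric.closedBall_mem_nhds v hε)
    (by
      filter_upwards [isOpen_Ioo.mem_nhds hv] with x hx
      exact ((continuous_slice hf.continuousOn hx).mul he).aestronglyMeasurable)
    (((continuous_slice hf.continuousOn hv).mul he).intervalIntegrable _ _)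
    ((continuous_slice hfv hv).mul he).aestronglyMeasurable
    (Filter.Eventually.of_forall fun z hz x hx => by
      have hexp : ‖Complex.exp (-(Complex.I * z * k))‖ = 1 := by
        have := norm_cexp_neg_I_mul z k
        simpa using this
      rw [norm_mul, hexp, mul_one]
      rw [uIoc_of_le (by positivity)] at hz
      exact hC (z, x) ⟨Ioc_subset_Icc_self hz, hx⟩)
    (by simp)
    (Filter.Eventually.of_forall fun z _ x hx =>
      ((hasDerivAt_slice_snd one_ne_zero hf z (hball hx)).differentiableAt.hasDerivAt).mul_const _)
  exact key.2.const_mul _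

/-- Integration by parts over one period; the boundary terms cancel by periodicity because k is an
integer. -/
lemma fourierZ_dz (hf : ContDiffOn ℝ 1 (Function.uncurry f) (univ ×ˢ Ioo α β))
    (hper : PeriodicOn α β f) (k : ℤ) {v : ℝ} (hv : v ∈ Ioo α β) :
    fourierZ (dz f) k v = Complex.I * k * fourierZ f k v := by
  have hfz : Continuous fun z => dz f z v :=
    continuous_slice (contDiffOn_dz (m := 0) (by simp) hf).continuousOn hv
  have he : ∀ z : ℝ, HasDerivAt (fun z : ℝ => Complex.exp (-(Complex.I * z * k)))
      (-(Complex.I * k) * Complex.exp (-(Complex.I * z * k))) z := fun z => by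
    have := (((hasDerivAt_id z).ofReal_comp.const_mul Complex.I).mul_const (k : ℂ)).neg.cexp
    refine this.congr_deriv ?_
    simp; ring
  have hec : Continuous fun z : ℝ => Complex.exp (-(Complex.I * z * k)) := by fun_prop
  have key := intervalIntegral.integral_mul_deriv_eq_deriv_mul (a := 0) (b := 2 * Real.pi)
    (fun z _ => (hasDerivAt_slice_fst one_ne_zero hf z hv).differentiableAt.hasDerivAt)
    (fun z _ => he z) (hfz.intervalIntegrable _ _)
    ((continuous_const.mul hec).intervalIntegrable _ _)
  have h0 : f (2 * Real.pi) v * Complex.exp (-(Complex.I * (2 * Real.pi : ℝ) * k)) -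
      f 0 v * Complex.exp (-(Complex.I * (0 : ℝ) * k)) = 0 := by
    have h1 := hper 0 v hv
    rw [zero_add] at h1
    have h2 : Complex.exp (-(Complex.I * (2 * Real.pi : ℝ) * k)) = 1 := by
      rw [Complex.exp_eq_one_iff]
      exact ⟨-k, by push_cast; ring⟩
    rw [h1, h2]
    simp
  rw [h0, zero_sub] at key
  have h3 : ∀ z : ℝ, f z v * (-(Complex.I * k) * Complex.exp (-(Complex.I * z * k))) =
      -(Complex.I * k) * (f z v * Complex.exp (-(Complex.I * z * k))) := fun z => by ring
  simp only [h3] at key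
  rw [intervalIntegral.integral_const_mul] at key
  simp only [fourierZ, dz]
  linear_combination (1 / (2 * (Real.pi : ℂ))) * key

/-- On the k-th mode ∂_v - t∂_z acts as ∂_v - ikt, which the factor e^{-iktv} later conjugates to
∂_v. -/
lemma fourierZ_dvt (hf : ContDiffOn ℝ 1 (Function.uncurry f) (univ ×ˢ Ioo α β))
    (hper : PeriodicOn α β f) (k : ℤ) {v : ℝ} (hv : v ∈ Ioo α β) :
    HasDerivAt (fourierZ f k) (fourierZ (dvt t f) k v + Complex.I * k * t * fourierZ f k v) v := by
  refine (hasDerivAt_fourierZ hf k hv).congr_deriv ?_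
  have h := fourierZ_linear (f := fun z v => deriv (fun v' => f z v') v) (g := dz f)
    (continuous_slice (contDiffOn_dv (m := 0) (by simp) hf).continuousOn hv)
    (continuous_slice (contDiffOn_dz (m := 0) (by simp) hf).continuousOn hv)
    (fun _ => 1) (fun _ => -t) k
  have e : (fun z v => (1 : ℂ) * deriv (fun v' => f z v') v + -(t : ℂ) * dz f z v) = dvt t f := by
    funext z v
    simp only [dvt, dz]
    ring
  rw [e, fourierZ_dz hf hper k hv] at h
  rw [h]
  ring

end modes

/-- The equation for the `k`-th Fourier mode in the moving frame, as a first order system. -/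
lemma IsDirichletSolution.mode_equation {u θ : ℝ → ℝ} {t : ℝ} {Ω Ψ : ℝ → ℝ → ℂ} {ϑ b : ℝ → ℝ}
    (hΨ : IsDirichletSolution u θ t Ω Ψ) (hϑ : ContDiff ℝ (⊤ : ℕ∞) ϑ) (hb : ContDiff ℝ (⊤ : ℕ∞) b)
    (hϑ0 : ∀ v, ϑ v ≠ 0) (hb0 : ∀ v, b v ≠ 0)
    (htilde : ∀ v ∈ Icc (u 0) (u 1), tilde u θ v = ϑ v ∧ tilde u (deriv u) v = b v) (k : ℤ) :
    ContinuousOn (fourierZ Ω k) (Ioo (u 0) (u 1)) ∧ ∃ Q : ℝ → ℂ, ∀ v ∈ Ioo (u 0) (u 1),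
      HasDerivAt (fun v : ℝ => Complex.exp (Complex.I * (-(k * t) : ℝ) * v) * fourierZ Ψ k v)
        (((b v * (ϑ v)⁻¹ : ℝ) : ℂ)⁻¹ * Q v) v ∧
      HasDerivAt Q ((k : ℂ) ^ 2 * (((b v * ϑ v)⁻¹ : ℝ) : ℂ) *
        (Complex.exp (Complex.I * (-(k * t) : ℝ) * v) * fourierZ Ψ k v) +
        Complex.exp (Complex.I * (-(k * t) : ℝ) * v) * fourierZ Ω k v * (b v : ℂ)⁻¹) v := by
  set α := u 0
  set β := u 1
  have hper : PeriodicOn α β Ψ := fun z v hv => hΨ.periodic z v (Ioo_subset_Icc_self hv)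
  have hC2 := hΨ.contDiffOn
  have hC1 : ContDiffOn ℝ 1 (Function.uncurry Ψ) (univ ×ˢ Ioo α β) := hC2.of_le (by norm_num)
  -- The flux is kept as a separate unknown, because W is only C¹ and the operator is a first order
  -- derivative of it. Its k-th mode in the moving frame is Q.
  set W : ℝ → ℝ → ℂ := fun z v => (((ϑ v)⁻¹ * b v : ℝ) : ℂ) * dvt t Ψ z v with hW
  have hDC1 : ContDiffOn ℝ 1 (Function.uncurry (dvt t Ψ)) (univ ×ˢ Ioo α β) :=
    contDiffOn_dvt (by norm_num) hC2
  have hZC1 : ContDiffOn ℝ 1 (Function.uncurry (dz Ψ)) (univ ×ˢ Ioo α β) :=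
    contDiffOn_dz (by norm_num) hC2
  have hpc : ContDiff ℝ (⊤ : ℕ∞) fun v => (((ϑ v)⁻¹ * b v : ℝ) : ℂ) :=
    Complex.ofRealCLM.contDiff.comp ((hϑ.inv hϑ0).mul hb)
  have hWC1 : ContDiffOn ℝ 1 (Function.uncurry W) (univ ×ˢ Ioo α β) :=
    ((hpc.of_le (by exact_mod_cast le_top)).comp contDiff_snd).contDiffOn.mul hDC1
  have hWper : PeriodicOn α β W := fun z v hv => by
    simp only [hW]
    rw [hper.dvt z v hv]
  have hΩ : ∀ z, ∀ v ∈ Ioo α β, Ω z v = (((ϑ v)⁻¹ : ℝ) : ℂ) * dz (dz Ψ) z v + (b v : ℂ) * dvt t W z v := by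
    intro z v hv
    rw [← hΨ.equation z v hv, distortedOp, (htilde v (Ioo_subset_Icc_self hv)).1,
      (htilde v (Ioo_subset_Icc_self hv)).2]
    congr 2
    have h1 : ∀ z, ∀ v ∈ Ioo α β, (((tilde u θ v)⁻¹ * tilde u (deriv u) v : ℝ) : ℂ) * dvt t Ψ z v =
        W z v := fun z v hv => by
      rw [(htilde v (Ioo_subset_Icc_self hv)).1, (htilde v (Ioo_subset_Icc_self hv)).2]
    conv_lhs => rw [dvt]
    conv_rhs => rw [dvt]
    have h2 : (fun v' => (((tilde u θ v')⁻¹ * tilde u (deriv u) v' : ℝ) : ℂ) * dvt t Ψ z v') =ᶠ[𝓝 v]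
        fun v' => W z v' := by
      filter_upwards [isOpen_Ioo.mem_nhds hv] with v' hv' using h1 z v' hv'
    rw [h2.deriv_eq]
    simp only [h1 _ v hv]
  have hΩk : ∀ v ∈ Ioo α β, fourierZ Ω k v =
      (((ϑ v)⁻¹ : ℝ) : ℂ) * ((Complex.I * k) ^ 2 * fourierZ Ψ k v) + b v * fourierZ (dvt t W) k v := by
    intro v hv
    have h1 : fourierZ Ω k v = fourierZ (fun z v => (((ϑ v)⁻¹ : ℝ) : ℂ) * dz (dz Ψ) z v +
        (b v : ℂ) * dvt t W z v) k v := by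
      simp only [fourierZ, hΩ _ v hv]
    rw [h1, fourierZ_linear
      (continuous_slice (contDiffOn_dz (m := 0) (by simp) hZC1).continuousOn hv)
      (continuous_slice (contDiffOn_dvt (m := 0) (by simp) hWC1).continuousOn hv)
      (fun v => (((ϑ v)⁻¹ : ℝ) : ℂ)) (fun v => (b v : ℂ)),
      fourierZ_dz hZC1 hper.dz k hv, fourierZ_dz hC1 hper k hv]
    ring
  have hWk : ∀ v ∈ Ioo α β, fourierZ W k v =
      (((ϑ v)⁻¹ * b v : ℝ) : ℂ) * fourierZ (dvt t Ψ) k v := by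
    intro v hv
    have hc := continuous_slice hDC1.continuousOn hv
    have := fourierZ_linear hc hc (fun v => (((ϑ v)⁻¹ * b v : ℝ) : ℂ)) (fun _ => 0) k
    simpa only [zero_mul, add_zero] using this
  refine ⟨?_, fun v => Complex.exp (Complex.I * (-(k * t) : ℝ) * v) * fourierZ W k v,
    fun v hv => ⟨?_, ?_⟩⟩
  -- No regularity of Ω is assumed; continuity of its mode is read off from the equation, since Ψ is
  -- C².
  · refine ContinuousOn.congr ?_ hΩk
    refine ContinuousOn.add (ContinuousOn.mul ?_ (continuousOn_const.mul
      (continuousOn_fourierZ hC1.continuousOn k))) (ContinuousOn.mul ?_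
      (continuousOn_fourierZ (contDiffOn_dvt (m := 0) (by simp) hWC1).continuousOn k))
    · exact (Complex.continuous_ofReal.comp (hϑ.inv hϑ0).continuous).continuousOn
    · exact (Complex.continuous_ofReal.comp hb.continuous).continuousOn
  · refine ((hasDerivAt_cexp_I_mul (-(k * t)) v).mul
      (fourierZ_dvt (t := t) hC1 hper k hv)).congr_deriv ?_
    simp only [hWk v hv]
    have h1 : (ϑ v : ℂ) ≠ 0 := by exact_mod_cast hϑ0 v
    have h2 : (b v : ℂ) ≠ 0 := by exact_mod_cast hb0 v
    push_cast
    field_simp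
    ring
  · refine ((hasDerivAt_cexp_I_mul (-(k * t)) v).mul
      (fourierZ_dvt (t := t) hWC1 hWper k hv)).congr_deriv ?_
    rw [hΩk v hv]
    have h1 : (ϑ v : ℂ) ≠ 0 := by exact_mod_cast hϑ0 v
    have h2 : (b v : ℂ) ≠ 0 := by exact_mod_cast hb0 v
    rw [mul_pow, Complex.I_sq]
    push_cast
    field_simp
    ring

/-! ### Duality between the two Dirichlet problems -/

/-- Green's identity for the two Dirichlet problems `(p h')' - V h = f` and
`(p Φ')' - V Φ = g`. -/
lemma green_identity {α β : ℝ} (hαβ : α < β) {p : ℝ → ℝ} {V f g h Φ Q : ℝ → ℂ}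
    (hp : ∀ x, p x ≠ 0) (hV : Continuous V) (hf : Continuous f) (hg : Continuous g)
    (hh : Differentiable ℝ h)
    (hh' : ∀ x, HasDerivAt (fun v => (p v : ℂ) * deriv h v) (V x * h x + f x) x)
    (hhα : h α = 0) (hhβ : h β = 0) (hΦ : ContinuousOn Φ (Icc α β)) (hΦα : Φ α = 0) (hΦβ : Φ β = 0)
    (hΦd : ∀ x ∈ Ioo α β, HasDerivAt Φ ((p x : ℂ)⁻¹ * Q x) x)
    (hQ : ∀ x ∈ Ioo α β, HasDerivAt Q (V x * Φ x + g x) x) :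
    ∫ x in α..β, f x * Φ x = ∫ x in α..β, g x * h x := by
  -- the flux `Q` is bounded
  obtain ⟨C, hC⟩ := isCompact_Icc.exists_bound_of_continuousOn
    ((hV.continuousOn.mul hΦ).add hg.continuousOn (s := Icc α β))
  set v₀ := (α + β) / 2 with hv₀
  have hv₀m : v₀ ∈ Ioo α β := ⟨by rw [hv₀]; linarith, by rw [hv₀]; linarith⟩
  have hC0 : 0 ≤ C := (norm_nonneg _).trans (hC v₀ (Ioo_subset_Icc_self hv₀m))
  have hQb : ∀ x ∈ Ioo α β, ‖Q x‖ ≤ ‖Q v₀‖ + C * (β - α) := fun x hx => by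
    have h1 := (convex_Ioo α β).norm_image_sub_le_of_norm_hasDerivWithin_le
      (fun y hy => (hQ y hy).hasDerivWithinAt) (fun y hy => hC y (Ioo_subset_Icc_self hy)) hv₀m hx
    have h2 : ‖x - v₀‖ ≤ β - α := by
      rw [Real.norm_eq_abs, abs_le]
      constructor <;> linarith [hx.1, hx.2, hv₀m.1, hv₀m.2]
    have h3 : ‖Q x‖ ≤ ‖Q v₀‖ + ‖Q x - Q v₀‖ := by
      simpa using norm_add_le (Q v₀) (Q x - Q v₀)
    have h4 := mul_le_mul_of_nonneg_left h2 hC0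
    linarith
  set G : ℝ → ℂ := fun x => (p x : ℂ) * deriv h x * Φ x - Q x * h x with hG
  have hGd : ∀ x ∈ Ioo α β, HasDerivAt G (f x * Φ x - g x * h x) x := fun x hx => by
    refine (((hh' x).mul (hΦd x hx)).sub ((hQ x hx).mul (hh x).hasDerivAt)).congr_deriv ?_
    have : (p x : ℂ) ≠ 0 := by exact_mod_cast hp x
    field_simp
    ring
  -- Φ is only continuous up to the boundary, so its flux Q need not have been defined there.
  -- Boundedness of Q times h → 0, and continuity of ph' times Φ → 0, make the boundary terms
  -- vanish.
  have hlim : ∀ x₀ ∈ Icc α β, h x₀ = 0 → Φ x₀ = 0 → ∀ l ≤ 𝓝[Ioo α β] x₀,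
      Filter.Tendsto G l (𝓝 0) := by
    intro x₀ hx₀ h0 hΦ0 l hl
    have hl' : l ≤ 𝓝 x₀ := hl.trans nhdsWithin_le_nhds
    have hmem : ∀ᶠ x in l, x ∈ Ioo α β := hl self_mem_nhdsWithin
    have t1 : Filter.Tendsto Φ l (𝓝 0) := by
      rw [← hΦ0]
      exact (hΦ x₀ hx₀).mono_left (hl.trans (nhdsWithin_mono _ Ioo_subset_Icc_self))
    have t2 : Filter.Tendsto h l (𝓝 0) := by
      rw [← h0]
      exact (hh x₀).continuousAt.tendsto.mono_left hl'
    have t3 := (hh' x₀).continuousAt.tendsto.mono_left hl'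
    have t4 : Filter.Tendsto (fun x => Q x * h x) l (𝓝 0) := by
      refine squeeze_zero_norm' (a := fun x => (‖Q v₀‖ + C * (β - α)) * ‖h x‖) ?_ ?_
      · filter_upwards [hmem] with x hx
        rw [norm_mul]
        exact mul_le_mul_of_nonneg_right (hQb x hx) (norm_nonneg _)
      · simpa using t2.norm.const_mul (‖Q v₀‖ + C * (β - α))
    simpa using (t3.mul t1).sub t4
  have hfΦ : IntervalIntegrable (fun x => f x * Φ x) volume α β :=
    (hf.continuousOn.mul hΦ).intervalIntegrable_of_Icc hαβ.le
  have hgh : IntervalIntegrable (fun x => g x * h x) volume α β :=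
    (hg.mul hh.continuous).intervalIntegrable _ _
  have key := intervalIntegral.integral_eq_sub_of_hasDerivAt_of_tendsto hαβ hGd (hfΦ.sub hgh)
    (hlim α ⟨le_rfl, hαβ.le⟩ hhα hΦα _ (by rw [nhdsWithin_Ioo_eq_nhdsGT hαβ]))
    (hlim β ⟨hαβ.le, le_rfl⟩ hhβ hΦβ _ (by rw [nhdsWithin_Ioo_eq_nhdsLT hαβ]))
  rw [intervalIntegral.integral_sub hfΦ hgh, sub_self] at key
  exact sub_eq_zero.mp key

lemma continuous_of_continuousOn_of_support {f : ℝ → ℂ} {α β a b : ℝ} (hα : α < a) (hβ : b < β)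
    (hf : ContinuousOn f (Ioo α β)) (h0 : ∀ x, x ∉ Icc a b → f x = 0) : Continuous f := by
  refine continuous_iff_continuousAt.mpr fun x => ?_
  by_cases hx : x ∈ Icc a b
  · exact hf.continuousAt (isOpen_Ioo.mem_nhds ⟨by linarith [hx.1], by linarith [hx.2]⟩)
  · refine (continuousAt_const (y := (0 : ℂ))).congr ?_
    filter_upwards [isClosed_Icc.isOpen_compl.mem_nhds hx] with y hy using (h0 y hy).symm

/-- The localized solution is obtained by pairing the source with the solutions of the Dirichlet
problem with modulated right-hand side. -/
lemma IsDirichletSolution.fourierZV_mul_eq {u θ Υ : ℝ → ℝ} {t : ℝ} {Ω Ψ : ℝ → ℝ → ℂ} {ϑ b : ℝ → ℝ}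
    (hΨ : IsDirichletSolution u θ t Ω Ψ) (hΩ : CompactlySupportedIn (u 0) (u 1) Ω) (h01 : u 0 < u 1)
    (hϑ : ContDiff ℝ (⊤ : ℕ∞) ϑ) (hb : ContDiff ℝ (⊤ : ℕ∞) b)
    (hϑ0 : ∀ v, ϑ v ≠ 0) (hb0 : ∀ v, b v ≠ 0)
    (htilde : ∀ v ∈ Icc (u 0) (u 1), tilde u θ v = ϑ v ∧ tilde u (deriv u) v = b v)
    (hΥ : Continuous Υ) (hΥs : ∀ v, v ∉ Ioo (u 0) (u 1) → Υ v = 0) (k : ℤ) (ξ : ℝ)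
    {F H : ℝ → ℂ} (hF : Differentiable ℝ F) (hFα : F (u 0) = 0) (hFβ : F (u 1) = 0)
    (hFode : ∀ h : ℝ → ℂ, (∀ x, h x = Complex.exp (Complex.I * (-(ξ - k * t) : ℝ) * x) * F x) →
      ∀ x, HasDerivAt (fun v => ((b v * (ϑ v)⁻¹ : ℝ) : ℂ) * deriv h v)
        ((k : ℂ) ^ 2 * (((b x * ϑ x)⁻¹ : ℝ) : ℂ) * h x +
          (Υ x : ℂ) * Complex.exp (Complex.I * (-(ξ - k * t) : ℝ) * x)) x)
    (hH : ∀ v ∈ Icc (u 0) (u 1), H v = F v * (b v : ℂ)⁻¹) :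
    Integrable (fourierZ Ω k) ∧ fourierZV (fun z v => (Υ v : ℂ) * Ψ z v) k ξ =
      ∫ v : ℝ, fourierZ Ω k v * H v * Complex.exp (-(Complex.I * v * ξ)) := by
  obtain ⟨a', b', ha', hb', hsupp⟩ := hΩ
  obtain ⟨hΩc, Q, hQ⟩ := hΨ.mode_equation hϑ hb hϑ0 hb0 htilde k
  have hΩ0 : ∀ v, v ∉ Icc a' b' → fourierZ Ω k v = 0 := fun v hv => by
    simp [fourierZ, hsupp _ v hv]
  have hΩcont : Continuous (fourierZ Ω k) := continuous_of_continuousOn_of_support ha' hb' hΩc hΩ0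
  refine ⟨integrable_of_continuous_of_support hΩcont hΩ0, ?_⟩
  have hexp : ∀ c : ℝ, Continuous fun v : ℝ => Complex.exp (Complex.I * (c : ℝ) * v) :=
    fun c => by fun_prop
  have hbC : Continuous fun v => (b v : ℂ)⁻¹ :=
    (Complex.continuous_ofReal.comp hb.continuous).inv₀ fun v =>
      Complex.ofReal_ne_zero.mpr (hb0 v)
  have hqC : Continuous fun v => (((b v * ϑ v)⁻¹ : ℝ) : ℂ) :=
    Complex.continuous_ofReal.comp ((hb.mul hϑ).continuous.inv₀ fun v => mul_ne_zero (hb0 v) (hϑ0 v))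
  set h : ℝ → ℂ := fun x => Complex.exp (Complex.I * (-(ξ - k * t) : ℝ) * x) * F x with hh
  have hz : ∀ v, (∀ z, Ψ z v = 0) → fourierZ Ψ k v = 0 := fun v hv => by simp [fourierZ, hv]
  have key := green_identity h01 (p := fun v => b v * (ϑ v)⁻¹)
    (V := fun v => (k : ℂ) ^ 2 * (((b v * ϑ v)⁻¹ : ℝ) : ℂ))
    (f := fun x => (Υ x : ℂ) * Complex.exp (Complex.I * (-(ξ - k * t) : ℝ) * x))
    (g := fun v => Complex.exp (Complex.I * (-(k * t) : ℝ) * v) * fourierZ Ω k v * (b v : ℂ)⁻¹)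
    (h := h) (Φ := fun v : ℝ => Complex.exp (Complex.I * (-(k * t) : ℝ) * v) * fourierZ Ψ k v) (Q := Q)
    (fun x => mul_ne_zero (hb0 x) (inv_ne_zero (hϑ0 x))) (continuous_const.mul hqC)
    ((Complex.continuous_ofReal.comp hΥ).mul (hexp _)) (((hexp _).mul hΩcont).mul hbC)
    (fun x => ((hasDerivAt_cexp_I_mul _ x).differentiableAt).mul (hF x)) (hFode h fun _ => rfl)
    (by simp [hh, hFα]) (by simp [hh, hFβ])
    ((hexp _).continuousOn.mul (continuousOn_fourierZ hΨ.continuousOn k))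
    (by simp only [hz _ hΨ.boundary_left, mul_zero]) (by simp only [hz _ hΨ.boundary_right, mul_zero])
    (fun x hx => (hQ x hx).1) (fun x hx => (hQ x hx).2)
  have hset : ∀ G : ℝ → ℂ, (∀ v, v ∉ Ioo (u 0) (u 1) → G v = 0) →
      ∫ v, G v = ∫ v in (u 0)..(u 1), G v := fun G hG => by
    rw [intervalIntegral.integral_of_le h01.le, setIntegral_eq_integral_of_forall_compl_eq_zero]
    exact fun v hv => hG v fun h => hv (Ioo_subset_Ioc_self h)
  rw [fourierZV, hset _ fun v hv => by simp [fourierZ, hΥs v hv], hset _ fun v hv => by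
    rw [hΩ0 v fun h => hv ⟨by linarith [h.1], by linarith [h.2]⟩, zero_mul, zero_mul]]
  -- The character at ξ splits into the moving-frame factor, which belongs to Φ and the source, and
  -- the modulation at ξ - kt, which belongs to h.
  have e : ∀ v : ℝ, Complex.exp (-(Complex.I * v * ξ)) =
      Complex.exp (Complex.I * (-(k * t) : ℝ) * v) * Complex.exp (Complex.I * (-(ξ - k * t) : ℝ) * v) :=
    fun v => by
      rw [← Complex.exp_add]
      congr 1
      push_cast
      ring
  have e1 : ∀ v : ℝ, fourierZ (fun z v => (Υ v : ℂ) * Ψ z v) k v = Υ v * fourierZ Ψ k v := fun v => by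
    simp only [fourierZ, mul_assoc, intervalIntegral.integral_const_mul]
    ring
  refine Eq.trans ?_ (key.trans ?_)
  · congr 1
    funext v
    rw [e, e1]
    ring
  · refine intervalIntegral.integral_congr fun v hv => ?_
    rw [uIcc_of_le h01.le] at hv
    simp only [hh]
    rw [e, hH v hv]
    ring

lemma exists_Icc_of_tsupport_subset {Υ : ℝ → ℝ} {α β : ℝ} (h : tsupport Υ ⊆ Ioo α β)
    (hne : ∃ x, Υ x ≠ 0) : ∃ a b, α < a ∧ b < β ∧ ∀ x, x ∉ Icc a b → Υ x = 0 := by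
  obtain ⟨x₀, hx₀⟩ := hne
  have hcpt : IsCompact (tsupport Υ) :=
    isCompact_Icc.of_isClosed_subset (isClosed_tsupport Υ) (h.trans Ioo_subset_Icc_self)
  have hne : (tsupport Υ).Nonempty := ⟨x₀, subset_tsupport Υ hx₀⟩
  obtain ⟨a, ha, ha'⟩ := hcpt.exists_isLeast hne
  obtain ⟨b, hb, hb'⟩ := hcpt.exists_isGreatest hne
  refine ⟨a, b, (h ha).1, (h hb).2, fun x hx => ?_⟩
  by_contra hne
  have := subset_tsupport Υ hne
  exact hx ⟨ha' this, hb' this⟩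

end DistortedElliptic

/-! ### Construction of the kernel and conclusion -/

open DistortedElliptic in
theorem propositionC
    (u θ Υ : ℝ → ℝ) (c₀ κ₀ s : ℝ)
    (hs : 0 < s ∧ s < 1)
    (hκ₀ : 0 < κ₀ ∧ κ₀ ≤ 1 / 10)
    (hc₀ : 0 < c₀)
    (hu_smooth : ContDiff ℝ (⊤ : ℕ∞) u)
    (hθ_smooth : ContDiff ℝ (⊤ : ℕ∞) θ)
    (hu_mono : ∀ y ∈ Set.Icc (0 : ℝ) 1, c₀ ≤ deriv u y)
    (hθ_pos : ∀ y ∈ Set.Icc (0 : ℝ) 1, c₀ ≤ θ y)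
    (hu_supp : ∀ y ∈ Set.Icc (0 : ℝ) 1,
      y ∉ Set.Icc (4 * κ₀) (1 - 4 * κ₀) → deriv (deriv u) y = 0)
    (hθ_supp : ∀ y ∈ Set.Icc (0 : ℝ) 1,
      y ∉ Set.Icc (4 * κ₀) (1 - 4 * κ₀) → deriv θ y = 0)
    (hu_gevrey : DistortedElliptic.IsGevreyOn s (Set.Icc 0 1) (deriv (deriv u)))
    (hθ_gevrey : DistortedElliptic.IsGevreyOn s (Set.Icc 0 1) (deriv θ))
    (hΥ_smooth : ContDiff ℝ (⊤ : ℕ∞) Υ)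
    (hΥ_supp : tsupport Υ ⊆ Set.Ioo (u 0) (u 1))
    (hΥ_gevrey : DistortedElliptic.IsGevreyOn s Set.univ Υ) :
    ∃ (C lam : ℝ) (G : ℝ → ℤ → ℝ → ℝ → ℂ), 0 < C ∧ 0 < lam ∧
      (∀ (t : ℝ) (k : ℤ) (ξ η : ℝ),
        ‖G t k ξ η‖ ≤ C * min
          (Real.exp (-lam * DistortedElliptic.bracket (ξ - η) ^ s)
            / (1 + (k : ℝ) ^ 2 + (ξ - k * t) ^ 2))
          (Real.exp (-lam * DistortedElliptic.bracket (ξ - η) ^ s)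
            / (1 + (k : ℝ) ^ 2 + (η - k * t) ^ 2))) ∧
      ∀ (t : ℝ) (Ω Ψ : ℝ → ℝ → ℂ),
        DistortedElliptic.CompactlySupportedIn (u 0) (u 1) Ω →
        DistortedElliptic.IsDirichletSolution u θ t Ω Ψ →
        ∀ (k : ℤ) (ξ : ℝ),
          MeasureTheory.Integrable
            (fun η : ℝ => G t k ξ η * DistortedElliptic.fourierZV Ω k η) ∧
          DistortedElliptic.fourierZV (fun z v => (Υ v : ℂ) * Ψ z v) k ξ
            = ∫ η : ℝ, G t k ξ η * DistortedElliptic.fourierZV Ω k η := by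
  -- If Υ vanishes identically the zero kernel works. Otherwise Υ supplies the cutoff, whose
  -- construction needs a nonzero function.
  by_cases hne : ∃ x, Υ x ≠ 0
  swap
  · push Not at hne
    refine ⟨1, 1, fun _ _ _ _ => 0, one_pos, one_pos, fun t k ξ η => ?_, fun t Ω Ψ _ _ k ξ => ?_⟩
    · rw [norm_zero, one_mul]
      positivity
    · simp [fourierZV, fourierZ, hne]
  obtain ⟨a, b', ha, hb', hΥs⟩ := exists_Icc_of_tsupport_subset hΥ_supp hne
  obtain ⟨ϑ, b, δ, hδ, hcoef, htilde⟩ := exists_coefficients hs (κ := 4 * κ₀)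
    ⟨by linarith [hκ₀.1], by linarith [hκ₀.2]⟩ hc₀ hu_smooth hθ_smooth hu_mono hθ_pos hu_supp
    hθ_supp hu_gevrey hθ_gevrey
  set α := u 0
  set β := u 1
  obtain ⟨d, hd, hdδ, hda, hdb⟩ : ∃ d, 0 < d ∧ d ≤ δ ∧ α + 8 * d ≤ a ∧ b' ≤ β - 8 * d := by
    refine ⟨min δ (min ((a - α) / 8) ((β - b') / 8)), lt_min hδ (lt_min ?_ ?_), min_le_left _ _, ?_, ?_⟩
    · linarith
    · linarith
    · linarith [(min_le_right δ (min ((a - α) / 8) ((β - b') / 8))).trans (min_le_left _ _)]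
    · linarith [(min_le_right δ (min ((a - α) / 8) ((β - b') / 8))).trans (min_le_right _ _)]
  obtain ⟨hαβ, hϑ, hb⟩ := hcoef d hd hdδ
  have h01 : α < β := by linarith
  have hΥ8 : ∀ x, x ∉ Set.Icc (α + 8 * d) (β - 8 * d) → Υ x = 0 := fun x hx =>
    hΥs x fun h => hx ⟨hda.trans h.1, h.2.trans hdb⟩
  have hΥG : UniformGevrey s (Set.univ : Set (ℕ × ℝ)) Set.univ (fun _ => 1) (fun _ x => (Υ x : ℂ)) := by
    obtain ⟨A, M, hA, hM, hbd⟩ := hΥ_gevrey.exists_bound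
    refine ⟨A, M, hA, hM, fun _ _ x _ => ⟨(Complex.ofRealCLM.contDiff.comp hΥ_smooth).contDiffAt,
      fun m => ?_⟩⟩
    rw [iteratedDeriv_ofReal_comp hΥ_smooth, Complex.norm_real, mul_one]
    exact hbd m x trivial
  obtain ⟨F, hFG, hF⟩ := exists_dirichlet_family hs hd hαβ (hb.mul hs (hϑ.inv hs))
    ((hb.mul hs hϑ).inv hs) hΥG (fun x hx => by rw [hΥ8 x hx, Complex.ofReal_zero])
  obtain ⟨χ, hχG, hχ1, hχ0⟩ := exists_gevrey_cutoff hs hd h01 hΥ_smooth hΥ_gevrey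
    (fun x hx => hΥ8 x fun h => hx ⟨by linarith [h.1], by linarith [h.2]⟩) hne
  -- F is controlled up to distance 3d outside [α, β] and χ is supported within distance 2d, so H is
  -- Gevrey on the line. The cutoff does not affect the pairing, since χ = 1 on [α, β] and the
  -- source is supported inside.
  set H : ℕ × ℝ → ℝ → ℂ := fun i v => χ v * (F i v * (((b v)⁻¹ : ℝ) : ℂ)) with hH
  have hH0 : ∀ i v, v ∉ Set.Icc (α - 2 * d) (β + 2 * d) → H i v = 0 := fun i v hv => by
    simp only [hH, hχ0 v hv, zero_mul]
  have hHG : UniformGevrey s Set.univ Set.univ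
      (fun i : ℕ × ℝ => (1 + (i.1 : ℝ) + |i.2|)⁻¹ * (1 + (i.1 : ℝ) + |i.2|)⁻¹) H := by
    have hw : ∀ i : ℕ × ℝ, 0 ≤ (1 + (i.1 : ℝ) + |i.2|)⁻¹ * (1 + (i.1 : ℝ) + |i.2|)⁻¹ := fun i => by
      positivity
    have h1 := ((hχG.comp_index (fun _ : ℕ × ℝ => ())).mono_set le_rfl
      (Set.subset_univ (Set.Icc (α - 3 * d) (β + 3 * d)))).mul hs
      (hFG.mul hs ((hb.inv hs).uniform Set.univ (Set.Icc (α - 3 * d) (β + 3 * d))))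
    simp only [one_mul, mul_one] at h1
    have h2 : UniformGevrey s (Set.univ : Set (ℕ × ℝ)) (Set.Icc (α - 3 * d) (β + 3 * d))ᶜ
        (fun i : ℕ × ℝ => (1 + (i.1 : ℝ) + |i.2|)⁻¹ * (1 + (i.1 : ℝ) + |i.2|)⁻¹) H := by
      refine (UniformGevrey.const (fun _ => 0) fun i _ => by rw [norm_zero]; exact hw i).congr
        fun i _ x hx => ?_
      filter_upwards [isClosed_Icc.isOpen_compl.mem_nhds hx] with y hy
      exact hH0 i y fun h => hy ⟨by linarith [h.1], by linarith [h.2]⟩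
    have := UniformGevrey.union h1 h2 fun i _ => hw i
    rwa [Set.union_compl_self] at this
  obtain ⟨C, lam, hC, hlam, hKi, hK⟩ := exists_kernel_bound hs (by linarith) hHG hH0
  have hsq : ∀ k : ℤ, ((k.natAbs : ℝ)) ^ 2 = (k : ℝ) ^ 2 := fun k => by
    rw [Nat.cast_natAbs, Int.cast_abs, sq_abs]
  -- The mode equation involves k only through k², so the family is indexed by |k|. Time enters only
  -- through the frequency ξ - kt, hence the constants are uniform in t.
  refine ⟨C, lam, fun t k ξ η => kernelFT (H (k.natAbs, ξ - k * t)) (ξ - η), hC, hlam,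
    fun t k ξ η => ?_, fun t Ω Ψ hΩ hΨ k ξ => ?_⟩
  · have := hK k.natAbs (ξ - k * t) (η - k * t)
    rwa [sub_sub_sub_cancel_right, hsq] at this
  · obtain ⟨hFα, hFβ, hFs, hFode⟩ := hF (k.natAbs, ξ - k * t)
    obtain ⟨hΩi, heq⟩ := hΨ.fourierZV_mul_eq hΩ h01 hϑ.smooth hb.smooth (fun v => (hϑ.pos v).ne')
      (fun v => (hb.pos v).ne') htilde hΥ_smooth.continuous
      (fun v hv => image_eq_zero_of_notMem_tsupport fun h => hv (hΥ_supp h)) k ξ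
      (hFs.differentiable (by simp)) hFα hFβ
      (fun h hh x => by
        have := hFode h hh x
        have e : (((k.natAbs : ℝ) : ℂ)) ^ 2 = (k : ℂ) ^ 2 := by exact_mod_cast congrArg ((↑) : ℝ → ℂ) (hsq k)
        simpa only [e] using this)
      (H := H (k.natAbs, ξ - k * t)) (fun v hv => by
        simp only [hH, hχ1 v hv, one_mul, Complex.ofReal_inv])
    have hHs : Continuous (H (k.natAbs, ξ - k * t)) := continuous_iff_continuousAt.mpr fun x =>
      (hHG.contDiffAt (i := (k.natAbs, ξ - k * t)) trivial (x := x) trivial).continuousAt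
    obtain ⟨h1, h2⟩ := integral_kernelFT_mul_fourier hHs
      (integrable_of_continuous_of_support hHs (hH0 _)) (hKi (k.natAbs, ξ - k * t)) hΩi ξ
    exact ⟨h1, heq.trans h2.symm⟩
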